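/- Fix real numbers $q\in(0,1)$ and $\zeta_-<0<\zeta_+$, and let $\mathfrak L=\zeta_-q^{\mathbb Z}\sqcup\zeta_+q^{\mathbb Z}\subset\mathbb R$ be the two-sided $q$-lattice. **Notation.** $(z;q)_\infty=\prod_{i\ge 0}(1-zq^i)$, $(z_1,\dots,z_m;q)_\infty=\prod_j(z_j;q)_\infty$, $\theta_q(z)=(z,q/z;q)_\infty$, $\theta_q(z_1,\dots,z_m)=\prod_j\theta_q(z_j)$, and $${}_2\phi_1(a_1,a_2;b\mid z)=\sum_{n\ge0}z^n\prod_{i=1}^n\frac{(1-a_1q^{i-1})(1-a_2q^{i-1})}{(1-bq^{i-1})(1-q^i)}\qquad(|z|<1),$$ continued meromorphically in $z$; its poles are at most simple and lie in $\{1,q^{-1},q^{-2},\dots\}$, so that the function $z\mapsto(z;q)_\infty\,{}_2\phi_1(a_1,a_2;b\mid z)$ is entire, and such products below are read as values of this entire function. **Parameters.** A pair $(x,y)\in\mathbb C^2$ is *admissible* if either $y=\overline x\notin\mathbb R$, or $x,y$ are real and both lie in one interval $(\zeta_-^{-1}q^m,\zeta_-^{-1}q^{m+1})$ or both in one interval $(\zeta_+^{-1}q^{m+1},\zeta_+^{-1}q^m)$,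 $m\in\mathbb Z$. A quadruple $(\alpha,\beta,\gamma,\delta)$ is *admissible* if $(\alpha,\beta)$ and $(\gamma,\delta)$ are admissible pairs and $\alpha\beta<q^2\gamma\delta$ (both sides are real). **Basic hypergeometric kernel.** For $\mathbf r=0,1$ and real $x$ near $\mathfrak L$ let $$\mathfrak F_{\mathbf r}(x)=\sqrt{|x|\frac{(x\alpha,x\beta;q)_\infty}{\theta_q(x\gamma,x\delta)}}\,(-x)^{1-\mathbf r}\,\frac{\left(\frac{\beta q^{\mathbf r-1}}{\gamma},\frac{q^{\mathbf r}}{\delta x};q\right)_\infty}{\left(\frac{\alpha\beta q^{2\mathbf r-2}}{\gamma\delta};q\right)_\infty}\;{}_2\phi_1\!\left(\frac{\alpha q^{\mathbf r-1}}{\delta},\frac{q}{\beta x};\frac{q^{\mathbf r}}{\delta x}\,\Big|\,\frac{\beta q^{\mathbf r-1}}{\gamma}\right),$$ $$\mathfrak C=\frac{\theta_q(\gamma\zeta_-,\gamma\zeta_+,\delta\zeta_-,\delta\zeta_+)}{\zeta_+\,\theta_q(\zeta_- /\zeta_+,\gamma\delta\zeta_-\zeta_+)}\cdot\frac{\left(\frac{\alpha\beta}{\gamma\delta},\frac{\alpha\beta}{q\gamma\delta};q\right)_\infty}{\left(\frac{\alpha}{\gamma},\frac{\alpha}{\delta},\frac{\beta}{\gamma},\frac{\beta}{\delta},q,q;q\right)_\infty},$$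 and $K^{\alpha,\beta,\gamma,\delta}(x,y)=\mathfrak C\,\dfrac{\mathfrak F_1(x)\mathfrak F_0(y)-\mathfrak F_1(y)\mathfrak F_0(x)}{x-y}$ for $x\ne y$ in $\mathfrak L$, $K^{\alpha,\beta,\gamma,\delta}(x,x)=\mathfrak C\,(\mathfrak F_1'(x)\mathfrak F_0(x)-\mathfrak F_1(x)\mathfrak F_0'(x))$. **Elliptic tail kernel.** For an admissible pair $(\gamma,\delta)$ with $\gamma\neq\delta$ let $$C=\frac{\theta_q(\gamma\zeta_-,\gamma\zeta_+,\delta\zeta_-,\delta\zeta_+)}{\zeta_+\,\theta_q(\zeta_- /\zeta_+,\gamma\delta\zeta_-\zeta_+)}\cdot\frac{\delta-\gamma}{\gamma\delta\,(\delta/\gamma,\gamma/\delta,q,q;q)_\infty},\quad P(x)=\frac{\sqrt{|x|}\,\theta_q(x\delta)}{\sqrt{\theta_q(x\gamma,x\delta)}},\quad Q(x)=\frac{\sqrt{|x|}\,\theta_q(x\gamma)}{\sqrt{\theta_q(x\gamma,x\delta)}},$$ and $K^{\gamma,\delta}(x,y)=C\,\dfrac{P(x)Q(y)-Q(x)P(y)}{x-y}$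 for $x\neq y$, $K^{\gamma,\delta}(x,x)=C\,(P'(x)Q(x)-Q'(x)P(x))$. For $\gamma=\delta\in\mathbb R$ the kernel is the limit as $\delta\to\gamma$: for $x\ne y$ $$K^{\gamma,\gamma}(x,y)=\frac{\theta_q(\gamma\zeta_-,\gamma\zeta_+)^2}{\zeta_+\,(q;q)_\infty^4\,\theta_q(\zeta_- /\zeta_+,\gamma^2\zeta_-\zeta_+)}\cdot\frac{\sqrt{|xy|}}{|\theta_q(x\gamma)\theta_q(y\gamma)|}\cdot\frac{y\,\theta_q(x\gamma)\theta_q'(y\gamma)-x\,\theta_q'(x\gamma)\theta_q(y\gamma)}{x-y},$$ extended to $x=y$ by L'Hôpital's rule. **Point processes.** The space $\operatorname{Conf}(\mathfrak L)$ of all subsets of $\mathfrak L$ is identified with $\{0,1\}^{\mathfrak L}$ and carries the product topology. A Borel probability measure $M$ on it is *determinantal with correlation kernel $K$* if $M(\{X:x_1,\dots,x_n\in X\})=\det[K(x_i,x_j)]_{i,j=1}^n$ for all $n\ge1$ and all pairwise distinct $x_1,\dots,x_n\in\mathfrak L$. For an admissible quadruple, the $q$–$zw$ measure $M^{\alpha,\beta,\gamma,\delta}$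 is the unique probability measure that is determinantal with correlation kernel $K^{\alpha,\beta,\gamma,\delta}$. For a probability measure $M$ and $k\ge0$ put $(T^{-k}M)(A)=M(q^kA)$, where $q^kA=\{q^kX:X\in A\}$. **Theorem.** Let $(\alpha,\beta,\gamma,\delta)$ be an admissible quadruple. 1. For all $x,y\in\mathfrak L$ (including $x=y$), $$\lim_{M\to\infty}(\operatorname{sgn}(x)\operatorname{sgn}(y))^M\,K^{\alpha,\beta,\gamma,\delta}(q^Mx,q^My)=K^{\gamma,\delta}(x,y).$$ 2. Let $M^{\alpha,\beta,\gamma,\delta}$ be the $q$–$zw$ measure. Then there is exactly one probability measure $M^{\gamma,\delta}$ on $\operatorname{Conf}(\mathfrak L)$ that is determinantal with correlation kernel $K^{\gamma,\delta}$ (so it depends on $\gamma,\delta$ only), and, as $k\to\infty$, the measures $T^{-k}M^{\alpha,\beta,\gamma,\delta}$ converge weakly to $M^{\gamma,\delta}$. -/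

import Mathlib

open Filter Topology MeasureTheory

namespace QZW

noncomputable section

/-! ### `q`-calculus -/

/-- The infinite `q`-Pochhammer symbol `(z; q)_∞ = ∏_{i ≥ 0} (1 - z q ^ i)`. -/
def qPoch (q : ℝ) (z : ℂ) : ℂ := ∏' i : ℕ, (1 - z * (q : ℂ) ^ i)

/-- The theta function `θ_q(z) = (z; q)_∞ (q / z; q)_∞`. -/
def qTheta (q : ℝ) (z : ℂ) : ℂ := qPoch q z * qPoch q ((q : ℂ) / z)

/-- The basic hypergeometric series `₂φ₁(a₁, a₂; b | z)`, for `‖z‖ < 1`. The `n = 0` term is `1`. -/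
def phiSeries (q : ℝ) (a₁ a₂ b z : ℂ) : ℂ :=
  ∑' n : ℕ, z ^ n * ∏ i ∈ Finset.range n,
    ((1 - a₁ * (q : ℂ) ^ i) * (1 - a₂ * (q : ℂ) ^ i)) /
      ((1 - b * (q : ℂ) ^ i) * (1 - (q : ℂ) ^ (i + 1)))

/-- `G` is the entire function of `z` that extends `(z; q)_∞ · ₂φ₁(a₁, a₂; b | z)` from the open
unit disc. There is at most one such `G`; it exists because the meromorphic continuation of
`₂φ₁(a₁, a₂; b | ·)` has at most simple poles, at `1, q⁻¹, q⁻², …`, where `(z; q)_∞` vanishes. -/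
def IsEntireExtension (q : ℝ) (a₁ a₂ b : ℂ) (G : ℂ → ℂ) : Prop :=
  Differentiable ℂ G ∧ ∀ z : ℂ, ‖z‖ < 1 → G z = qPoch q z * phiSeries q a₁ a₂ b z

/-- The entire function `z ↦ (z; q)_∞ · ₂φ₁(a₁, a₂; b | z)`, where `₂φ₁` is analytically continued
in `z`. -/
def phiReg (q : ℝ) (a₁ a₂ b : ℂ) : ℂ → ℂ := Classical.epsilon (IsEntireExtension q a₁ a₂ b)

/-! ### The two-sided `q`-lattice and admissible parameters -/

/-- The two-sided `q`-lattice `ζ₋ q^ℤ ⊔ ζ₊ q^ℤ`. -/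
def qLattice (q ζm ζp : ℝ) : Set ℝ := {x | ∃ m : ℤ, x = ζm * q ^ m ∨ x = ζp * q ^ m}

/-- Admissible pairs: principal and complementary series. -/
def AdmissiblePair (q ζm ζp : ℝ) (x y : ℂ) : Prop :=
  (y = (starRingEnd ℂ) x ∧ x.im ≠ 0) ∨
  ∃ s t : ℝ, x = s ∧ y = t ∧
    ((∃ m : ℤ, s ∈ Set.Ioo (ζm⁻¹ * q ^ m) (ζm⁻¹ * q ^ (m + 1)) ∧
        t ∈ Set.Ioo (ζm⁻¹ * q ^ m) (ζm⁻¹ * q ^ (m + 1))) ∨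
      (∃ n : ℤ, s ∈ Set.Ioo (ζp⁻¹ * q ^ (n + 1)) (ζp⁻¹ * q ^ n) ∧
        t ∈ Set.Ioo (ζp⁻¹ * q ^ (n + 1)) (ζp⁻¹ * q ^ n)))

/-- Admissible quadruples. For admissible pairs the products `α β` and `γ δ` are real, so that
`α β < q² γ δ` is an inequality between real numbers. -/
def AdmissibleQuadruple (q ζm ζp : ℝ) (α β γ δ : ℂ) : Prop :=
  AdmissiblePair q ζm ζp α β ∧ AdmissiblePair q ζm ζp γ δ ∧
    (α * β).re < q ^ 2 * (γ * δ).re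

/-! ### The kernels -/

/-- The kernel `c (A(x) B(y) - B(x) A(y)) / (x - y)`, given on the diagonal by L'Hôpital's rule,
`c (A'(x) B(x) - B'(x) A(x))`. -/
def integrableKernel (c : ℂ) (A B : ℝ → ℂ) (x y : ℝ) : ℂ :=
  open Classical in
  if x = y then c * (deriv A x * B x - deriv B x * A x)
  else c * ((A x * B y - B x * A y) / ((x : ℂ) - (y : ℂ)))

/-- The square root `√w` (principal branch; it is only needed for `w > 0`). -/
def csqrt (w : ℂ) : ℂ := w ^ (1 / 2 : ℂ)

/-- The constant in the basic hypergeometric kernel. -/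
def basicConst (q ζm ζp : ℝ) (α β γ δ : ℂ) : ℂ :=
  qTheta q (γ * ζm) * qTheta q (γ * ζp) * qTheta q (δ * ζm) * qTheta q (δ * ζp) /
      (ζp * (qTheta q ((ζm : ℂ) / ζp) * qTheta q (γ * δ * ζm * ζp))) *
    (qPoch q (α * β / (γ * δ)) * qPoch q (α * β / (q * γ * δ)) /
      (qPoch q (α / γ) * qPoch q (α / δ) * qPoch q (β / γ) * qPoch q (β / δ) *
        qPoch q q * qPoch q q))

/-- The functions `𝔉_r`, for `r = 0, 1`, on the real line. The factor
`(β q^{r-1} / γ; q)_∞ · ₂φ₁(α q^{r-1} / δ, q / (β x); q^r / (δ x) | β q^{r-1} / γ)`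
is the value at `β q^{r-1} / γ` of the entire function `phiReg`. -/
def basicF (q : ℝ) (α β γ δ : ℂ) (r : ℕ) (x : ℝ) : ℂ :=
  csqrt (((|x| : ℝ) : ℂ) * (qPoch q (x * α) * qPoch q (x * β) / (qTheta q (x * γ) * qTheta q (x * δ)))) *
    (-(x : ℂ)) ^ (1 - (r : ℤ)) *
    (qPoch q ((q : ℂ) ^ r / (δ * x)) /
      qPoch q (α * β * (q : ℂ) ^ (2 * (r : ℤ) - 2) / (γ * δ))) *
    phiReg q (α * (q : ℂ) ^ ((r : ℤ) - 1) / δ) (q / (β * x)) ((q : ℂ) ^ r / (δ * x))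
      (β * (q : ℂ) ^ ((r : ℤ) - 1) / γ)

/-- The basic hypergeometric kernel `K^{α, β, γ, δ}(x, y)`. -/
def basicKernel (q ζm ζp : ℝ) (α β γ δ : ℂ) : ℝ → ℝ → ℂ :=
  integrableKernel (basicConst q ζm ζp α β γ δ) (basicF q α β γ δ 1) (basicF q α β γ δ 0)

/-- The factor of the elliptic kernel's constant that is common to `γ ≠ δ` and `γ = δ`. -/
def ellipticPrefactor (q ζm ζp : ℝ) (γ δ : ℂ) : ℂ :=
  qTheta q (γ * ζm) * qTheta q (γ * ζp) * qTheta q (δ * ζm) * qTheta q (δ * ζp) /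
    (ζp * (qTheta q ((ζm : ℂ) / ζp) * qTheta q (γ * δ * ζm * ζp)))

/-- The constant `C(γ, δ)`, for `γ ≠ δ`. -/
def ellipticConst (q ζm ζp : ℝ) (γ δ : ℂ) : ℂ :=
  ellipticPrefactor q ζm ζp γ δ *
    ((δ - γ) / (γ * δ * (qPoch q (δ / γ) * qPoch q (γ / δ) * qPoch q q * qPoch q q)))

/-- The function `√|x| · u(x) / √(θ_q(x γ) θ_q(x δ))`. -/
def thetaNormalized (q : ℝ) (γ δ : ℂ) (u : ℝ → ℂ) (x : ℝ) : ℂ :=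
  csqrt ((|x| : ℝ) : ℂ) * (u x / csqrt (qTheta q (x * γ) * qTheta q (x * δ)))

/-- The function `P` for `γ ≠ δ`. -/
def ellipticP (q : ℝ) (γ δ : ℂ) : ℝ → ℂ := thetaNormalized q γ δ fun x => qTheta q (x * δ)

/-- The function `Q` for `γ ≠ δ`. -/
def ellipticQ (q : ℝ) (γ δ : ℂ) : ℝ → ℂ := thetaNormalized q γ δ fun x => qTheta q (x * γ)

/-- The elliptic tail kernel `K^{γ, δ}(x, y)`. For `γ = δ` the constant `C(γ, δ)` has the form
`0 / 0` and the kernel is the limit as `δ → γ`, namely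
`(prefactor / (q; q)_∞ ^ 4) · √|x y| / (√(θ_q(xγ)²) √(θ_q(yγ)²))
  · (y θ_q(xγ) θ_q'(yγ) - x θ_q'(xγ) θ_q(yγ)) / (x - y)`. -/
def ellipticKernel (q ζm ζp : ℝ) (γ δ : ℂ) : ℝ → ℝ → ℂ :=
  open Classical in
  if γ = δ then
    integrableKernel (ellipticPrefactor q ζm ζp γ γ / qPoch q q ^ 4)
      (thetaNormalized q γ γ fun x => qTheta q (x * γ))
      (thetaNormalized q γ γ fun x => x * deriv (qTheta q) (x * γ))
  else
    integrableKernel (ellipticConst q ζm ζp γ δ) (ellipticP q γ δ) (ellipticQ q γ δ)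

/-! ### Point processes on the lattice -/

instance countable_qLattice (q ζm ζp : ℝ) : Countable (qLattice q ζm ζp) := by
  have h : qLattice q ζm ζp =
      Set.range (fun m : ℤ => ζm * q ^ m) ∪ Set.range (fun m : ℤ => ζp * q ^ m) := by
    ext x
    simp only [qLattice, Set.mem_ofPred_eq, Set.mem_union, Set.mem_range, exists_or, eq_comm]
  rw [h]
  exact ((Set.countable_range _).union (Set.countable_range _)).to_subtype

/-- The space of point configurations on the lattice: all subsets, written as indicator functions,
with the product topology (and its Borel `σ`-algebra, the product one). The lattice is discrete, so
every configuration is locally finite. -/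
abbrev Conf (q ζm ζp : ℝ) : Type := qLattice q ζm ζp → Bool

/-- `μ` is determinantal with correlation kernel `K`: the probability that a random configuration
contains given distinct points `x₁, …, xₙ` is `det [K(xᵢ, xⱼ)]`. The `q`-`zw` measure with parameters
`α, β, γ, δ` is the unique such `μ` for `K = K^{α, β, γ, δ}`. -/
def IsDeterminantal {q ζm ζp : ℝ} (μ : ProbabilityMeasure (Conf q ζm ζp)) (K : ℝ → ℝ → ℂ) : Prop :=
  ∀ (n : ℕ) (x : Fin n → qLattice q ζm ζp), Function.Injective x →
    (((μ {ω | ∀ i, ω (x i) = true} : NNReal) : ℝ) : ℂ) =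
      (Matrix.of fun i j => K (x i) (x j)).det

theorem mul_mem_qLattice {q ζm ζp : ℝ} (hq : q ≠ 0) (k : ℕ) {x : ℝ} (hx : x ∈ qLattice q ζm ζp) :
    q ^ k * x ∈ qLattice q ζm ζp := by
  obtain ⟨m, hm⟩ := hx
  refine ⟨m + k, ?_⟩
  rw [zpow_add₀ hq, zpow_natCast]
  rcases hm with rfl | rfl
  · left; ring
  · right; ring

/-- The homothety `x ↦ q ^ k x` of the lattice. -/
def latticeScale {q ζm ζp : ℝ} (hq : q ≠ 0) (k : ℕ) (x : qLattice q ζm ζp) : qLattice q ζm ζp :=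
  ⟨q ^ k * x, mul_mem_qLattice hq k x.2⟩

/-- The configuration `q ^ (-k) X`: it contains `x` if and only if `X` contains `q ^ k x`. -/
def confZoom {q ζm ζp : ℝ} (hq : q ≠ 0) (k : ℕ) (ω : Conf q ζm ζp) : Conf q ζm ζp :=
  fun x => ω (latticeScale hq k x)

theorem measurable_confZoom {q ζm ζp : ℝ} (hq : q ≠ 0) (k : ℕ) :
    Measurable (confZoom (ζm := ζm) (ζp := ζp) hq k) :=
  measurable_pi_lambda _ fun _ => measurable_pi_apply _

/-- The transformed measure `T^{-k} μ`, with `(T^{-k} μ)(A) = μ(q ^ k A)`: the law of `q ^ (-k) X`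
when `X` has law `μ`. -/
def zoomMeasure {q ζm ζp : ℝ} (hq : q ≠ 0) (k : ℕ) (μ : ProbabilityMeasure (Conf q ζm ζp)) :
    ProbabilityMeasure (Conf q ζm ζp) :=
  μ.map (measurable_confZoom hq k).aemeasurable

end

end QZW

namespace QZW

noncomputable section

/-! ### Infinite `q`-Pochhammer symbols and theta functions -/

/-! Part 1 is an asymptotic analysis of two functions. Write `j = 1 - r`. In `𝔉_r` the point `x`
sits in the parameters of `₂φ₁`; Heine's transformation moves it into the variable and gives `𝔉_r(x)
= √(…) (-x)^j Ψ_j(q/(αx))`, where `Ψ_j` is the entire function extending `(w;q)_∞ ₂φ₁(α/(q^jγ),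
α/(q^jδ); αβ/(q^{2j}γδ) | w)` (`qPoch_mul_phiReg_eq`). Replacing `x` by `q^M x` sends `w = q/(αx)`
to infinity along a geometric sequence.

For large `w`, with `A = α/(q^jγ)` and `B = α/(q^jδ)`, such a function is a combination of
`(Aw;q)_∞` and `(Bw;q)_∞` plus a smaller entire remainder (`exists_phi_expansion`). The reason: the
Taylor coefficients of `₂φ₁` are the values at `t = q^n` of a meromorphic function of `t`;
subtracting two `q`-binomial series removes its poles at `1/A` and `1/B`, and what is left is
analytic in a larger disc and vanishes at those of the points `q⁻¹, q⁻², …` that lie there. By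
`exists_entire_of_analytic_coeff` this forces the decay of the remainder.

At `w = q/(α q^M s)` the leading terms are theta functions by quasi-periodicity. With `g² = γδ` and
a common normalizing factor, both scaled functions have the form `a (g/γ)^M θ(γs) + b (g/δ)^M θ(δs)
+ O(η^M)`. In the antisymmetric combination of the kernel the powers cancel, because `(g/γ)(g/δ) =
1`; the errors disappear because `η` can be taken just above `q l` with `l = max(|g/γ|, |g/δ|)`, and
admissibility gives `q l² < 1` (`growthOn_wronskian`). The determinant of the coefficients `a, b`,
multiplied by the constant of the basic kernel, is the constant of the elliptic kernel up to the
sign due to the order of `P` and `Q` (`basicConst_mul_connCoeff`). For `γ = δ` the second leading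
term becomes a derivative in `A`, and the arguments are repeated with one extra factor linear in
`M`. All estimates are uniform on complex compact sets, so derivatives converge as well and the
diagonal is included. The square roots contribute `q^M` and the signs `(-sgn x)^M (-sgn y)^M`, which
the scaling of `1/(x - y)` and the sign factor in the statement remove.

Part 2 is soft. The signs are a diagonal conjugation, invisible to determinants, so all correlations
converge. Probability measures on the compact space of configurations form a compact space; every
cluster point has the limiting correlations, which determine a measure. Hence the limit exists, and
its kernel needs no separate proof of positivity (`exists_tendsto_zoomMeasure`). -/

/-- The finite `q`-Pochhammer symbol `(a; q)_n`. -/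
def qFin (q : ℝ) (a : ℂ) (n : ℕ) : ℂ := ∏ i ∈ Finset.range n, (1 - a * (q : ℂ) ^ i)

/-- The bound `exp (r / (1 - q))` for all products of the factors `1 - z q ^ i`, `‖z‖ ≤ r`. -/
def qExpBound (q r : ℝ) : ℝ := Real.exp (r / (1 - q))

section
variable {q : ℝ}

theorem qExpBound_mono (hq1 : q < 1) {r s : ℝ} (h : r ≤ s) : qExpBound q r ≤ qExpBound q s :=
  Real.exp_le_exp.2 (div_le_div_of_nonneg_right h (by linarith))

theorem qExpBound_pos (r : ℝ) : 0 < qExpBound q r := Real.exp_pos _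

theorem norm_ofReal_q (hq0 : 0 < q) : ‖(q : ℂ)‖ = q := by simp [abs_of_pos hq0]

theorem ofReal_q_ne_zero (hq0 : 0 < q) : (q : ℂ) ≠ 0 := by exact_mod_cast hq0.ne'

theorem hasSum_norm_mul_pow (hq0 : 0 < q) (hq1 : q < 1) (z : ℂ) :
    HasSum (fun i : ℕ => ‖-(z * (q : ℂ) ^ i)‖) (‖z‖ / (1 - q)) := by
  simpa [norm_ofReal_q hq0, div_eq_mul_inv, abs_of_pos hq0] using
    (hasSum_geometric_of_lt_one hq0.le hq1).mul_left ‖z‖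

theorem norm_prod_sub_one_le (hq0 : 0 < q) (hq1 : q < 1) (z : ℂ) (s : Finset ℕ) :
    ‖∏ i ∈ s, (1 - z * (q : ℂ) ^ i) - 1‖ ≤ qExpBound q ‖z‖ - 1 := by
  simp only [sub_eq_add_neg (1 : ℂ)]
  refine (Finset.norm_prod_one_add_sub_one_le s _).trans ?_
  gcongr
  exact Real.exp_le_exp.2 (sum_le_hasSum s (fun _ _ => norm_nonneg _)
    (hasSum_norm_mul_pow hq0 hq1 z))

theorem norm_prod_le (hq0 : 0 < q) (hq1 : q < 1) (z : ℂ) (s : Finset ℕ) :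
    ‖∏ i ∈ s, (1 - z * (q : ℂ) ^ i)‖ ≤ qExpBound q ‖z‖ := by
  have h := norm_prod_sub_one_le hq0 hq1 z s
  have h2 := norm_sub_norm_le (∏ i ∈ s, (1 - z * (q : ℂ) ^ i)) 1
  rw [norm_one] at h2
  linarith

theorem norm_qFin_le (hq0 : 0 < q) (hq1 : q < 1) (z : ℂ) (n : ℕ) :
    ‖qFin q z n‖ ≤ qExpBound q ‖z‖ := norm_prod_le hq0 hq1 z _

theorem multipliable_qPoch (hq0 : 0 < q) (hq1 : q < 1) (z : ℂ) :
    Multipliable fun i : ℕ => 1 - z * (q : ℂ) ^ i := by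
  simp only [sub_eq_add_neg (1 : ℂ)]
  exact multipliable_one_add_of_summable (hasSum_norm_mul_pow hq0 hq1 z).summable

theorem tendsto_qFin (hq0 : 0 < q) (hq1 : q < 1) (z : ℂ) :
    Tendsto (qFin q z) atTop (𝓝 (qPoch q z)) :=
  (multipliable_qPoch hq0 hq1 z).hasProd.tendsto_prod_nat

theorem norm_qPoch_sub_one_le (hq0 : 0 < q) (hq1 : q < 1) (z : ℂ) :
    ‖qPoch q z - 1‖ ≤ qExpBound q ‖z‖ - 1 :=
  le_of_tendsto ((tendsto_qFin hq0 hq1 z).sub_const 1).norm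
    (Eventually.of_forall fun _ => norm_prod_sub_one_le hq0 hq1 z _)

theorem norm_qPoch_le (hq0 : 0 < q) (hq1 : q < 1) (z : ℂ) :
    ‖qPoch q z‖ ≤ qExpBound q ‖z‖ :=
  le_of_tendsto (tendsto_qFin hq0 hq1 z).norm
    (Eventually.of_forall fun _ => norm_prod_le hq0 hq1 z _)

theorem qFin_succ (a : ℂ) (n : ℕ) : qFin q a (n + 1) = qFin q a n * (1 - a * (q : ℂ) ^ n) :=
  Finset.prod_range_succ _ _

theorem qFin_add (a : ℂ) (m n : ℕ) :
    qFin q a (m + n) = qFin q a m * qFin q (a * (q : ℂ) ^ m) n := by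
  simp only [qFin, Finset.prod_range_add, pow_add, mul_assoc]

theorem qPoch_eq_qFin_mul (hq0 : 0 < q) (hq1 : q < 1) (z : ℂ) (n : ℕ) :
    qPoch q z = qFin q z n * qPoch q (z * (q : ℂ) ^ n) := by
  have h := (tendsto_qFin hq0 hq1 (z * (q : ℂ) ^ n)).const_mul (qFin q z n)
  simp only [← qFin_add] at h
  refine tendsto_nhds_unique (((tendsto_add_atTop_iff_nat n).2 (tendsto_qFin hq0 hq1 z))) ?_
  simpa only [add_comm] using h

theorem qPoch_eq_mul (hq0 : 0 < q) (hq1 : q < 1) (z : ℂ) :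
    qPoch q z = (1 - z) * qPoch q (q * z) := by
  simpa [qFin, mul_comm z] using qPoch_eq_qFin_mul hq0 hq1 z 1

theorem qPoch_ne_zero (hq0 : 0 < q) (hq1 : q < 1) {z : ℂ} (h : ∀ i : ℕ, z * (q : ℂ) ^ i ≠ 1) :
    qPoch q z ≠ 0 := by
  simp only [qPoch, sub_eq_add_neg (1 : ℂ)]
  refine tprod_one_add_ne_zero_of_summable (fun i => ?_) (hasSum_norm_mul_pow hq0 hq1 z).summable
  rw [← sub_eq_add_neg, sub_ne_zero]
  exact (h i).symm

theorem qPoch_eq_zero (hq0 : 0 < q) (hq1 : q < 1) {z : ℂ} (i : ℕ) (h : z * (q : ℂ) ^ i = 1) :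
    qPoch q z = 0 := by
  rw [qPoch_eq_qFin_mul hq0 hq1 z (i + 1), qFin_succ, h]; simp

theorem qPoch_ne_zero_of_norm_lt_one (hq0 : 0 < q) (hq1 : q < 1) {z : ℂ} (h : ‖z‖ < 1) :
    qPoch q z ≠ 0 := by
  refine qPoch_ne_zero hq0 hq1 fun i hi => ?_
  have : ‖z * (q : ℂ) ^ i‖ < 1 := by
    rw [norm_mul, norm_pow, norm_ofReal_q hq0]
    exact mul_lt_one_of_nonneg_of_lt_one_left (norm_nonneg _) h (pow_le_one₀ hq0.le hq1.le)
  rw [hi, norm_one] at this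
  exact lt_irrefl _ this

theorem qPoch_zero : qPoch q 0 = 1 := by simp [qPoch]

theorem qPoch_one (hq0 : 0 < q) (hq1 : q < 1) : qPoch q 1 = 0 :=
  qPoch_eq_zero hq0 hq1 0 (by simp)

theorem qPoch_q_ne_zero (hq0 : 0 < q) (hq1 : q < 1) : qPoch q q ≠ 0 :=
  qPoch_ne_zero_of_norm_lt_one hq0 hq1 (by rwa [norm_ofReal_q hq0])

theorem differentiable_qFin (n : ℕ) : Differentiable ℂ fun z => qFin q z n := by
  unfold qFin; fun_prop

theorem differentiable_qPoch (hq0 : 0 < q) (hq1 : q < 1) : Differentiable ℂ (qPoch q) := by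
  intro z₀
  have hU : IsOpen (Metric.ball (0 : ℂ) (‖z₀‖ + 1)) := Metric.isOpen_ball
  have hz₀ : z₀ ∈ Metric.ball (0 : ℂ) (‖z₀‖ + 1) := by simp
  have key : MultipliableLocallyUniformlyOn (fun (n : ℕ) (z : ℂ) => 1 + -(z * (q : ℂ) ^ n))
      (Metric.ball (0 : ℂ) (‖z₀‖ + 1)) := by
    refine Summable.multipliableLocallyUniformlyOn_nat_one_add hU
      ((summable_geometric_of_lt_one hq0.le hq1).mul_left (‖z₀‖ + 1))
      (.of_forall fun n x hx => ?_) (fun _ => by fun_prop)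
    rw [norm_neg, norm_mul, norm_pow, norm_ofReal_q hq0]
    gcongr
    simpa using (Metric.mem_ball.1 hx).le
  have h2 : DifferentiableOn ℂ (fun z : ℂ => ∏' n : ℕ, (1 + -(z * (q : ℂ) ^ n)))
      (Metric.ball (0 : ℂ) (‖z₀‖ + 1)) := by
    refine key.hasProdLocallyUniformlyOn.differentiableOn (.of_forall fun s => ?_) hU
    simpa [Finset.prod_fn] using
      DifferentiableOn.finsetProd (fun _ _ => by fun_prop)
  have h3 := h2.differentiableAt (hU.mem_nhds hz₀)
  simp only [← sub_eq_add_neg] at h3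
  exact h3

theorem continuous_qPoch (hq0 : 0 < q) (hq1 : q < 1) : Continuous (qPoch q) :=
  (differentiable_qPoch hq0 hq1).continuous

theorem qTheta_mul (hq0 : 0 < q) (hq1 : q < 1) {z : ℂ} (hz : z ≠ 0) :
    qTheta q (q * z) = -qTheta q z / z := by
  have hq := ofReal_q_ne_zero hq0
  have e1 := qPoch_eq_mul hq0 hq1 z
  have e2 := qPoch_eq_mul hq0 hq1 (1 / z)
  have h1 : (q : ℂ) / (q * z) = 1 / z := by field_simp
  have h2 : (q : ℂ) * (1 / z) = q / z := by ring
  rw [qTheta, qTheta, h1, e2, h2, e1]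
  field_simp
  ring

/-- The Gaussian power of `q` produced by iterating `θ(qz) = -θ(z)/z` is what `scaleFactor` is
designed to cancel. -/
theorem qTheta_pow_mul (hq0 : 0 < q) (hq1 : q < 1) {z : ℂ} (hz : z ≠ 0) (N : ℕ) :
    qTheta q ((q : ℂ) ^ N * z) =
      (-1) ^ N * (z⁻¹) ^ N * ((q : ℂ) ^ (N * (N - 1) / 2))⁻¹ * qTheta q z := by
  have hq := ofReal_q_ne_zero hq0
  induction N with
  | zero => simp
  | succ N ih =>
    have hz' : (q : ℂ) ^ N * z ≠ 0 := by positivity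
    have e : (N + 1) * (N + 1 - 1) / 2 = N * (N - 1) / 2 + N := by
      have := Nat.triangle_succ N
      simpa using this
    rw [pow_succ', mul_assoc, qTheta_mul hq0 hq1 hz', ih, e, pow_add]
    simp only [inv_pow]
    field_simp
    ring

theorem differentiableAt_qTheta (hq0 : 0 < q) (hq1 : q < 1) {z : ℂ} (hz : z ≠ 0) :
    DifferentiableAt ℂ (qTheta q) z := by
  have h := differentiable_qPoch hq0 hq1
  have h1 : DifferentiableAt ℂ (fun z => (q : ℂ) / z) z :=
    (differentiableAt_const _).div differentiableAt_id hz
  exact (h z).mul (DifferentiableAt.comp z (h _) h1)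

theorem qTheta_ne_zero (hq0 : 0 < q) (hq1 : q < 1) {z : ℂ} (hz : ∀ m : ℤ, z ≠ (q : ℂ) ^ m) :
    qTheta q z ≠ 0 := by
  have hq := ofReal_q_ne_zero hq0
  refine mul_ne_zero (qPoch_ne_zero hq0 hq1 fun i hi => ?_) (qPoch_ne_zero hq0 hq1 fun i hi => ?_)
  · refine hz (-i) ?_
    rw [zpow_neg, zpow_natCast, eq_inv_of_mul_eq_one_left hi]
  · refine hz (i + 1) ?_
    have h0 : z ≠ 0 := by rintro rfl; simp at hi
    rw [zpow_add₀ hq, zpow_natCast, zpow_one]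
    field_simp at hi
    rw [← hi]; ring

/-! ### Series of holomorphic functions -/

theorem differentiableOn_tsum_ball {F : ℕ → ℂ → ℂ} {R : ℝ}
    (hF : ∀ n, DifferentiableOn ℂ (F n) (Metric.ball 0 R))
    (hb : ∀ r < R, ∃ u : ℕ → ℝ, Summable u ∧ ∀ n w, ‖w‖ < r → ‖F n w‖ ≤ u n) :
    DifferentiableOn ℂ (fun w => ∑' n, F n w) (Metric.ball 0 R) := by
  intro w hw
  rw [mem_ball_zero_iff] at hw
  obtain ⟨r, h1, h2⟩ := exists_between hw
  obtain ⟨u, hu, hu'⟩ := hb r h2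
  have h := Complex.differentiableOn_tsum_of_summable_norm (U := Metric.ball 0 r) hu
    (fun n => (hF n).mono (Metric.ball_subset_ball h2.le)) Metric.isOpen_ball
    (fun n w hw => hu' n w (by simpa using hw))
  exact (h.differentiableAt (Metric.isOpen_ball.mem_nhds (by simpa using h1))).differentiableWithinAt

theorem differentiable_tsum {F : ℕ → ℂ → ℂ} (hF : ∀ n, Differentiable ℂ (F n))
    (hb : ∀ r, ∃ u : ℕ → ℝ, Summable u ∧ ∀ n w, ‖w‖ < r → ‖F n w‖ ≤ u n) :
    Differentiable ℂ (fun w => ∑' n, F n w) := fun w =>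
  (differentiableOn_tsum_ball (R := ‖w‖ + 1) (fun n => (hF n).differentiableOn)
    fun r _ => hb r).differentiableAt (Metric.isOpen_ball.mem_nhds (by simp))

theorem summable_pow_mul {t : ℕ → ℂ} {K : ℝ} (ht : ∀ n, ‖t n‖ ≤ K) {z : ℂ} (hz : ‖z‖ < 1) :
    Summable fun n => z ^ n * t n := by
  refine Summable.of_norm_bounded ((summable_geometric_of_lt_one (norm_nonneg z) hz).mul_right K)
    fun n => ?_
  rw [norm_mul, norm_pow]
  gcongr
  exact ht n

theorem differentiableOn_tsum_pow_mul {t : ℕ → ℂ} {K : ℝ} (ht : ∀ n, ‖t n‖ ≤ K) :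
    DifferentiableOn ℂ (fun z : ℂ => ∑' n, z ^ n * t n) (Metric.ball 0 1) := by
  refine differentiableOn_tsum_ball (fun n => by fun_prop) fun r hr => ?_
  rcases lt_or_ge r 0 with h | h
  · exact ⟨0, summable_zero, fun n w hw => absurd (norm_nonneg w) (by linarith)⟩
  refine ⟨_, (summable_geometric_of_lt_one h hr).mul_right K, fun n w hw => ?_⟩
  rw [norm_mul, norm_pow]
  gcongr
  exact ht n

theorem differentiable_tsum_pow_mul {F : ℕ → ℂ → ℂ} (hF : ∀ n, Differentiable ℂ (F n))
    (hb : ∀ r, ∃ K : ℝ, ∀ n w, ‖w‖ < r → ‖F n w‖ ≤ K) {z : ℂ} (hz : ‖z‖ < 1) :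
    Differentiable ℂ (fun w => ∑' n, z ^ n * F n w) := by
  refine differentiable_tsum (fun n => (hF n).const_mul _) fun r => ?_
  obtain ⟨K, hK⟩ := hb r
  refine ⟨_, (summable_geometric_of_lt_one (norm_nonneg z) hz).mul_right K, fun n w hw => ?_⟩
  rw [norm_mul, norm_pow]
  gcongr
  exact hK n w hw

/-! ### The `q`-binomial theorem -/

theorem inv_qFin (hq0 : 0 < q) (hq1 : q < 1) {c : ℂ} (hc : qPoch q c ≠ 0) (n : ℕ) :
    (qFin q c n)⁻¹ = qPoch q (c * (q : ℂ) ^ n) / qPoch q c := by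
  have h := qPoch_eq_qFin_mul hq0 hq1 c n
  have h1 : qFin q c n ≠ 0 := fun h' => hc (by rw [h, h', zero_mul])
  have h2 : qPoch q (c * (q : ℂ) ^ n) ≠ 0 := fun h' => hc (by rw [h, h', mul_zero])
  rw [h]
  field_simp

theorem qFin_ne_zero (hq0 : 0 < q) (hq1 : q < 1) {c : ℂ} (hc : qPoch q c ≠ 0) (n : ℕ) :
    qFin q c n ≠ 0 := fun h' => hc (by rw [qPoch_eq_qFin_mul hq0 hq1 c n, h', zero_mul])

theorem norm_mul_pow_le (hq0 : 0 < q) (hq1 : q < 1) (c : ℂ) (n : ℕ) :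
    ‖c * (q : ℂ) ^ n‖ ≤ ‖c‖ := by
  rw [norm_mul, norm_pow, norm_ofReal_q hq0]
  exact mul_le_of_le_one_right (norm_nonneg _) (pow_le_one₀ hq0.le hq1.le)

theorem norm_qPoch_mul_pow_le (hq0 : 0 < q) (hq1 : q < 1) (c : ℂ) (n : ℕ) :
    ‖qPoch q (c * (q : ℂ) ^ n)‖ ≤ qExpBound q ‖c‖ :=
  (norm_qPoch_le hq0 hq1 _).trans (qExpBound_mono hq1 (norm_mul_pow_le hq0 hq1 c n))

theorem norm_inv_qFin_le (hq0 : 0 < q) (hq1 : q < 1) {c : ℂ} (hc : qPoch q c ≠ 0) (n : ℕ) :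
    ‖(qFin q c n)⁻¹‖ ≤ qExpBound q ‖c‖ / ‖qPoch q c‖ := by
  rw [inv_qFin hq0 hq1 hc, norm_div]
  gcongr
  exact norm_qPoch_mul_pow_le hq0 hq1 c n

/-- The constant `exp (q / (1 - q)) / (q; q)_∞`, which bounds all `1 / (q; q)_n`. -/
def qInvBound (q : ℝ) : ℝ := qExpBound q ‖(q : ℂ)‖ / ‖qPoch q q‖

theorem norm_inv_qFin_q_le (hq0 : 0 < q) (hq1 : q < 1) (n : ℕ) :
    ‖(qFin q q n)⁻¹‖ ≤ qInvBound q := norm_inv_qFin_le hq0 hq1 (qPoch_q_ne_zero hq0 hq1) n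

theorem qInvBound_nonneg : 0 ≤ qInvBound q := by
  unfold qInvBound qExpBound; positivity

theorem norm_qFin_div_le (hq0 : 0 < q) (hq1 : q < 1) (a : ℂ) (n : ℕ) :
    ‖qFin q a n / qFin q q n‖ ≤ qExpBound q ‖a‖ * qInvBound q := by
  rw [div_eq_mul_inv, norm_mul]
  exact mul_le_mul (norm_qFin_le hq0 hq1 a n) (norm_inv_qFin_q_le hq0 hq1 n) (norm_nonneg _)
    (qExpBound_pos _).le

theorem tendsto_tsum_pow_mul_zero {t : ℕ → ℂ} {K : ℝ} (ht : ∀ n, ‖t n‖ ≤ K) {u : ℕ → ℂ}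
    (hu : Tendsto u atTop (𝓝 0)) :
    Tendsto (fun m => ∑' n, u m ^ n * t n) atTop (𝓝 (t 0)) := by
  have h := ((differentiableOn_tsum_pow_mul ht).differentiableAt
    (Metric.isOpen_ball.mem_nhds (by simp : (0 : ℂ) ∈ Metric.ball 0 1))).continuousAt.tendsto.comp hu
  have h0 : ∑' n, (0 : ℂ) ^ n * t n = t 0 := by
    rw [tsum_eq_single 0 (fun n hn => by simp [hn])]; simp
  simpa only [h0, Function.comp_def] using h

theorem tendsto_pow_mul_zero (hq0 : 0 < q) (hq1 : q < 1) (z : ℂ) :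
    Tendsto (fun m : ℕ => z * (q : ℂ) ^ m) atTop (𝓝 0) := by
  simpa using (tendsto_pow_atTop_nhds_zero_of_norm_lt_one
    (by rwa [norm_ofReal_q hq0] : ‖(q : ℂ)‖ < 1)).const_mul z

theorem one_sub_pow_succ_ne_zero (hq0 : 0 < q) (hq1 : q < 1) (n : ℕ) :
    (1 : ℂ) - q * (q : ℂ) ^ n ≠ 0 := by
  have := qFin_ne_zero hq0 hq1 (qPoch_q_ne_zero hq0 hq1) (n + 1)
  rw [qFin_succ] at this
  exact right_ne_zero_of_mul this

/-- The sum `f` satisfies `(1 - z) f(z) = (1 - az) f(qz)`. Iterating, and using that `f` is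
continuous at `0` with `f(0) = 1`, gives the product. -/
theorem hasSum_qBinomial (hq0 : 0 < q) (hq1 : q < 1) (a : ℂ) {z : ℂ} (hz : ‖z‖ < 1) :
    HasSum (fun n => z ^ n * (qFin q a n / qFin q q n)) (qPoch q (a * z) / qPoch q z) := by
  set t : ℕ → ℂ := fun n => qFin q a n / qFin q q n with ht
  have hb := norm_qFin_div_le hq0 hq1 a
  have hs : ∀ {z : ℂ}, ‖z‖ < 1 → Summable fun n => z ^ n * t n := fun hz => summable_pow_mul hb hz
  suffices h : ∑' n, z ^ n * t n = qPoch q (a * z) / qPoch q z by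
    rw [← h]; exact (hs hz).hasSum
  have hz' : ∀ m : ℕ, ‖z * (q : ℂ) ^ m‖ < 1 := fun m =>
    (norm_mul_pow_le hq0 hq1 z m).trans_lt hz
  have step : ∀ {z : ℂ}, ‖z‖ < 1 →
      (1 - z) * ∑' n, z ^ n * t n = (1 - a * z) * ∑' n, (z * q) ^ n * t n := by
    intro z hz
    have hzq : ‖z * q‖ < 1 := by
      simpa using (norm_mul_pow_le hq0 hq1 z 1).trans_lt hz
    -- Termwise this is the recursion `t (n+1) (1 - q^(n+1)) = t n (1 - a q^n)`; the term `n = 0` on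
    -- the left vanishes.
    have e1 : ∑' n, (z ^ n * t n - (z * q) ^ n * t n) =
        ∑' n, z * (z ^ n * t n - a * ((z * q) ^ n * t n)) := by
      rw [((hs hz).sub (hs hzq)).tsum_eq_zero_add]
      simp only [pow_zero, sub_self, zero_add]
      refine tsum_congr fun n => ?_
      have h1 := one_sub_pow_succ_ne_zero hq0 hq1 n
      have h2 := qFin_ne_zero hq0 hq1 (qPoch_q_ne_zero hq0 hq1) n
      simp only [ht, qFin_succ, mul_pow, pow_succ]
      generalize (q : ℂ) ^ n = Q at h1 ⊢
      rw [mul_comm] at h1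
      field_simp
    rw [(hs hz).tsum_sub (hs hzq), tsum_mul_left,
      (hs hz).tsum_sub ((hs hzq).mul_left a), tsum_mul_left] at e1
    linear_combination e1
  have it : ∀ m : ℕ, qFin q z m * ∑' n, z ^ n * t n =
      qFin q (a * z) m * ∑' n, (z * (q : ℂ) ^ m) ^ n * t n := by
    intro m
    induction m with
    | zero => simp [qFin]
    | succ m ih =>
      rw [qFin_succ, qFin_succ, mul_right_comm, ih, pow_succ, ← mul_assoc z]
      have := step (hz' m)
      linear_combination (qFin q (a * z) m) * this
  have l1 := (tendsto_qFin hq0 hq1 z).mul_const (∑' n, z ^ n * t n)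
  have l2 := (tendsto_qFin hq0 hq1 (a * z)).mul
    (tendsto_tsum_pow_mul_zero hb (tendsto_pow_mul_zero hq0 hq1 z))
  have l3 := tendsto_nhds_unique (l1.congr it) l2
  rw [eq_div_iff (qPoch_ne_zero_of_norm_lt_one hq0 hq1 hz), mul_comm, l3]
  simp [qFin]

/-! ### Heine's transformations -/

/-- `(z; q)_∞ (c; q)_∞ ₂φ₁(a, b; c | z)`, with the denominators in `c` cleared. -/
def heineSeries (q : ℝ) (a b c z : ℂ) : ℂ :=
  qPoch q z * ∑' n, z ^ n * (qFin q a n * qFin q b n / qFin q q n * qPoch q (c * (q : ℂ) ^ n))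

theorem norm_heine_coeff_le (hq0 : 0 < q) (hq1 : q < 1) (a b c : ℂ) (n : ℕ) :
    ‖qFin q a n * qFin q b n / qFin q q n * qPoch q (c * (q : ℂ) ^ n)‖ ≤
      qExpBound q ‖a‖ * qExpBound q ‖b‖ * qInvBound q * qExpBound q ‖c‖ := by
  have := (qExpBound_pos (q := q) ‖a‖).le
  have := (qExpBound_pos (q := q) ‖b‖).le
  have := qInvBound_nonneg (q := q)
  rw [div_eq_mul_inv, norm_mul, norm_mul, norm_mul]
  gcongr
  · exact norm_qFin_le hq0 hq1 a n
  · exact norm_qFin_le hq0 hq1 b n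
  · exact norm_inv_qFin_q_le hq0 hq1 n
  · exact norm_qPoch_mul_pow_le hq0 hq1 c n

/-- Heine's argument: expand `(c q^n;q)_∞ / (b q^n;q)_∞` by the `q`-binomial theorem, interchange
the two absolutely convergent sums, and sum over `n` by the `q`-binomial theorem again. -/
theorem heineSeries_eq (hq0 : 0 < q) (hq1 : q < 1) (a c : ℂ) {b z : ℂ} (hz : ‖z‖ < 1)
    (hb : ‖b‖ < 1) (hb0 : b ≠ 0) :
    heineSeries q a b c z = heineSeries q (c / b) z (a * z) b := by
  set f : ℕ → ℕ → ℂ := fun n m =>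
    z ^ n * (qFin q a n / qFin q q n) * ((b * (q : ℂ) ^ n) ^ m *
      (qFin q (c / b) m / qFin q q m)) with hf
  have hfb : ∀ n m, ‖f n m‖ ≤ (‖z‖ ^ n * (qExpBound q ‖a‖ * qInvBound q)) *
      (‖b‖ ^ m * (qExpBound q ‖c / b‖ * qInvBound q)) := by
    intro n m
    simp only [hf]
    rw [norm_mul, norm_mul, norm_mul, norm_pow, norm_pow]
    have := (qExpBound_pos (q := q) ‖a‖).le
    have := qInvBound_nonneg (q := q)
    gcongr
    · exact norm_qFin_div_le hq0 hq1 a n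
    · exact norm_mul_pow_le hq0 hq1 b n
    · exact norm_qFin_div_le hq0 hq1 _ m
  have hsum : Summable (Function.uncurry f) := by
    refine Summable.of_norm_bounded (Summable.mul_of_nonneg
      ((summable_geometric_of_lt_one (norm_nonneg z) hz).mul_right
        (qExpBound q ‖a‖ * qInvBound q))
      ((summable_geometric_of_lt_one (norm_nonneg b) hb).mul_right
        (qExpBound q ‖c / b‖ * qInvBound q)) (fun n => ?_) (fun n => ?_)) fun p => hfb p.1 p.2
    · have := (qExpBound_pos (q := q) ‖a‖).le
      have := qInvBound_nonneg (q := q)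
      positivity
    · have := (qExpBound_pos (q := q) ‖c / b‖).le
      have := qInvBound_nonneg (q := q)
      positivity
  have key : ∀ (u v : ℂ) (n : ℕ), ‖v‖ < 1 → HasSum
      (fun m => (v * (q : ℂ) ^ n) ^ m * (qFin q u m / qFin q q m))
      (qPoch q (u * v * (q : ℂ) ^ n) * qFin q v n / qPoch q v) := by
    intro u v n hv
    have h := hasSum_qBinomial hq0 hq1 u ((norm_mul_pow_le hq0 hq1 v n).trans_lt hv)
    convert h using 1
    have h1 := qPoch_ne_zero_of_norm_lt_one hq0 hq1 hv
    have h2 := qPoch_ne_zero_of_norm_lt_one hq0 hq1 ((norm_mul_pow_le hq0 hq1 v n).trans_lt hv)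
    rw [qPoch_eq_qFin_mul hq0 hq1 v n] at h1 ⊢
    have h3 := left_ne_zero_of_mul h1
    rw [mul_assoc u]
    field_simp
  have hzp := qPoch_ne_zero_of_norm_lt_one hq0 hq1 hz
  have hbp := qPoch_ne_zero_of_norm_lt_one hq0 hq1 hb
  have e1 : heineSeries q a b c z = qPoch q z * qPoch q b * ∑' n, ∑' m, f n m := by
    rw [heineSeries, mul_assoc, ← tsum_mul_left (a := qPoch q b)]
    congr 1
    refine tsum_congr fun n => ?_
    simp only [hf]
    rw [tsum_mul_left, (key (c / b) b n hb).tsum_eq, div_mul_cancel₀ _ hb0]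
    field_simp
  have e2 : heineSeries q (c / b) z (a * z) b =
      qPoch q z * qPoch q b * ∑' m, ∑' n, f n m := by
    rw [heineSeries, mul_comm (qPoch q z), mul_assoc, ← tsum_mul_left (a := qPoch q z)]
    congr 1
    refine tsum_congr fun m => ?_
    have : ∀ n, f n m = b ^ m * (qFin q (c / b) m / qFin q q m) *
        ((z * (q : ℂ) ^ m) ^ n * (qFin q a n / qFin q q n)) := by
      intro n
      simp only [hf, mul_pow, ← pow_mul, mul_comm n m]
      ring
    simp only [this]
    rw [tsum_mul_left, (key a z m hz).tsum_eq]
    field_simp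
  rw [e1, e2]
  congr 1
  exact hsum.tsum_comm.symm

theorem heineSeries_comm (a b c z : ℂ) : heineSeries q a b c z = heineSeries q b a c z := by
  simp only [heineSeries, mul_comm (qFin q a _)]

/-- Two applications of `heineSeries_eq`, with the numerator parameters exchanged before each.
Writing the parameters as `a`, `kaw`, `aw` makes `z` and `w` trade places and leaves no division, so
that both sides are entire in `a`. -/
theorem heineSeries_symm_aux (hq0 : 0 < q) (hq1 : q < 1) {a z w : ℂ} (k : ℂ) (hz : ‖z‖ < 1)
    (hw : ‖w‖ < 1) (hw0 : w ≠ 0) (ha : ‖a‖ < 1) (ha0 : a ≠ 0) :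
    heineSeries q a (k * a * w) (a * w) z = heineSeries q (k * a * z) a (a * z) w := by
  have h1 : a * w / a = w := by field_simp
  have h2 : k * a * w * z / w = k * a * z := by field_simp
  rw [heineSeries_comm, heineSeries_eq hq0 hq1 _ _ hz ha ha0, h1, heineSeries_comm,
    heineSeries_eq hq0 hq1 _ _ ha hw hw0, h2, mul_comm z a]

theorem norm_mul_le_of_le' {a b : ℂ} {r s : ℝ} (ha : ‖a‖ ≤ r) (hb : ‖b‖ ≤ s) :
    ‖a * b‖ ≤ r * s := by
  rw [norm_mul]; exact mul_le_mul ha hb (norm_nonneg _) ((norm_nonneg _).trans ha)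

theorem differentiable_heineSeries_comp (hq0 : 0 < q) (hq1 : q < 1) {a b c : ℂ → ℂ} {z : ℂ}
    (ha : Differentiable ℂ a) (hb : Differentiable ℂ b) (hc : Differentiable ℂ c) (hz : ‖z‖ < 1) :
    Differentiable ℂ fun x => heineSeries q (a x) (b x) (c x) z := by
  have bd : ∀ {f : ℂ → ℂ}, Differentiable ℂ f → ∀ r : ℝ, ∃ K, ∀ x, ‖x‖ < r → ‖f x‖ ≤ K := by
    intro f hf r
    obtain ⟨K, hK⟩ := (isCompact_closedBall (0 : ℂ) r).exists_bound_of_continuousOn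
      hf.continuous.continuousOn
    exact ⟨K, fun x hx => hK x (by simpa using hx.le)⟩
  unfold heineSeries
  refine Differentiable.const_mul (differentiable_tsum_pow_mul (fun n => ?_) (fun r => ?_) hz) _
  · exact ((((differentiable_qFin n).comp ha).mul ((differentiable_qFin n).comp hb)).div_const
      _).mul ((differentiable_qPoch hq0 hq1).comp (hc.mul_const _))
  · obtain ⟨A, hA⟩ := bd ha r
    obtain ⟨B, hB⟩ := bd hb r
    obtain ⟨C, hC⟩ := bd hc r
    refine ⟨qExpBound q A * qExpBound q B * qInvBound q * qExpBound q C, fun n x hx => ?_⟩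
    refine (norm_heine_coeff_le hq0 hq1 _ _ _ n).trans ?_
    have := (qExpBound_pos (q := q) A).le
    have := (qExpBound_pos (q := q) B).le
    have := (qExpBound_pos (q := q) ‖b x‖).le
    have := (qExpBound_pos (q := q) ‖c x‖).le
    have := qInvBound_nonneg (q := q)
    gcongr ?_ * ?_ * _ * ?_
    · exact qExpBound_mono hq1 (hA x hx)
    · exact qExpBound_mono hq1 (hB x hx)
    · exact qExpBound_mono hq1 (hC x hx)

theorem eq_of_eventuallyEq_of_differentiable {f g : ℂ → ℂ} (hf : Differentiable ℂ f)
    (hg : Differentiable ℂ g) {z₀ : ℂ} (h : f =ᶠ[𝓝 z₀] g) : f = g :=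
  AnalyticOnNhd.eq_of_eventuallyEq (fun z _ => hf.analyticAt z) (fun z _ => hg.analyticAt z) h

/-- The restriction `0 < |a| < 1` needed for the two Heine steps is removed by the identity theorem
in `a`. -/
theorem heineSeries_symm (hq0 : 0 < q) (hq1 : q < 1) (a k : ℂ) {z w : ℂ} (hz : ‖z‖ < 1)
    (hw : ‖w‖ < 1) (hw0 : w ≠ 0) :
    heineSeries q a (k * a * w) (a * w) z = heineSeries q (k * a * z) a (a * z) w := by
  have h := eq_of_eventuallyEq_of_differentiable (z₀ := (1 / 2 : ℂ))
    (f := fun a => heineSeries q a (k * a * w) (a * w) z)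
    (g := fun a => heineSeries q (k * a * z) a (a * z) w)
    (differentiable_heineSeries_comp hq0 hq1 differentiable_id (by fun_prop) (by fun_prop) hz)
    (differentiable_heineSeries_comp hq0 hq1 (by fun_prop) differentiable_id (by fun_prop) hw) ?_
  · exact congrFun h a
  have h1 : ∀ᶠ a : ℂ in 𝓝 (1 / 2 : ℂ), ‖a‖ < 1 :=
    continuous_norm.continuousAt.eventually_lt continuousAt_const (by norm_num)
  have h2 : ∀ᶠ a : ℂ in 𝓝 (1 / 2 : ℂ), a ≠ 0 := eventually_ne_nhds (by norm_num)
  filter_upwards [h1, h2] with a ha ha0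
  exact heineSeries_symm_aux hq0 hq1 k hz hw hw0 ha ha0

/-! ### Partial fractions in the variable of the hypergeometric series -/

/-- The product `(w; q)_∞ / (1 - w q ^ k)`. -/
def qPunct (q : ℝ) (k : ℕ) (w : ℂ) : ℂ := qFin q w k * qPoch q (w * (q : ℂ) ^ (k + 1))

theorem one_sub_mul_qPunct (hq0 : 0 < q) (hq1 : q < 1) (k : ℕ) (w : ℂ) :
    (1 - w * (q : ℂ) ^ k) * qPunct q k w = qPoch q w := by
  rw [qPoch_eq_qFin_mul hq0 hq1 w (k + 1), qFin_succ, qPunct]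
  ring

theorem norm_qPunct_le (hq0 : 0 < q) (hq1 : q < 1) (k : ℕ) (w : ℂ) :
    ‖qPunct q k w‖ ≤ qExpBound q ‖w‖ * qExpBound q ‖w‖ :=
  norm_mul_le_of_le' (norm_qFin_le hq0 hq1 w k) (norm_qPoch_mul_pow_le hq0 hq1 w _)

theorem differentiable_qPunct (hq0 : 0 < q) (hq1 : q < 1) (k : ℕ) :
    Differentiable ℂ (qPunct q k) :=
  (differentiable_qFin k).mul ((differentiable_qPoch hq0 hq1).comp (by fun_prop))

/-- The entire function `(w; q)_∞ ∑ₖ hₖ / (1 - w q ^ k)`. -/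
def pfSeries (q : ℝ) (h : ℕ → ℂ) (w : ℂ) : ℂ := ∑' k, h k * qPunct q k w

theorem differentiable_pfSeries (hq0 : 0 < q) (hq1 : q < 1) {h : ℕ → ℂ}
    (hh : Summable fun k => ‖h k‖) : Differentiable ℂ (pfSeries q h) := by
  refine differentiable_tsum (fun k => (differentiable_qPunct hq0 hq1 k).const_mul _) fun r =>
    ⟨_, hh.mul_right (qExpBound q r * qExpBound q r), fun k w hw => ?_⟩
  refine norm_mul_le_of_le' le_rfl ((norm_qPunct_le hq0 hq1 k w).trans ?_)
  have := qExpBound_mono (q := q) hq1 hw.le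
  have := (qExpBound_pos (q := q) ‖w‖).le
  have := (qExpBound_pos (q := q) r).le
  gcongr

/-- Expand each `1 / (1 - w q^k)` as a geometric series and interchange the sums: partial fractions
in `w` correspond to coefficients that are power series in `q^n`. -/
theorem pfSeries_eq (hq0 : 0 < q) (hq1 : q < 1) {h : ℕ → ℂ}
    (hh : Summable fun k => ‖h k‖) {w : ℂ} (hw : ‖w‖ < 1) :
    pfSeries q h w = qPoch q w * ∑' n, w ^ n * ∑' k, h k * ((q : ℂ) ^ n) ^ k := by
  set f : ℕ → ℕ → ℂ := fun n k => w ^ n * (h k * ((q : ℂ) ^ n) ^ k)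
  have hs : Summable (Function.uncurry f) := by
    refine Summable.of_norm_bounded (Summable.mul_of_nonneg
      (summable_geometric_of_lt_one (norm_nonneg w) hw) hh (fun n => by positivity)
      (fun n => by positivity)) fun p => ?_
    change ‖w ^ p.1 * (h p.2 * ((q : ℂ) ^ p.1) ^ p.2)‖ ≤ _
    rw [norm_mul, norm_pow, norm_mul, norm_pow, norm_pow, norm_ofReal_q hq0]
    gcongr
    exact mul_le_of_le_one_right (norm_nonneg _)
      (pow_le_one₀ (by positivity) (pow_le_one₀ hq0.le hq1.le))
  have e1 : ∑' n, w ^ n * ∑' k, h k * ((q : ℂ) ^ n) ^ k = ∑' n, ∑' k, f n k :=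
    tsum_congr fun n => tsum_mul_left.symm
  rw [e1, ← hs.tsum_comm, pfSeries, ← tsum_mul_left]
  refine tsum_congr fun k => ?_
  have hk : ‖w * (q : ℂ) ^ k‖ < 1 := (norm_mul_pow_le hq0 hq1 w k).trans_lt hw
  have h1 : 1 - w * (q : ℂ) ^ k ≠ 0 := by
    intro h0
    rw [← sub_eq_zero.1 h0, norm_one] at hk
    exact lt_irrefl _ hk
  have e2 : ∀ n, f n k = h k * (w * (q : ℂ) ^ k) ^ n := by
    intro n
    simp only [f, mul_pow, ← pow_mul, mul_comm n k]
    ring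
  simp only [e2]
  rw [tsum_mul_left, tsum_geometric_of_norm_lt_one hk, ← one_sub_mul_qPunct hq0 hq1 k]
  field_simp

theorem exists_taylor_coeff {H : ℂ → ℂ} {R : ℝ}
    (hH : DifferentiableOn ℂ H (Metric.ball 0 R)) :
    ∃ h : ℕ → ℂ, (∀ ρ : ℝ, 0 ≤ ρ → ρ < R → Summable fun k => ‖h k‖ * ρ ^ k) ∧
      ∀ t : ℂ, ‖t‖ < R → H t = ∑' k, h k * t ^ k := by
  refine ⟨fun k => (↑(k.factorial) : ℂ)⁻¹ * iteratedDeriv k H 0, fun ρ h0 h1 => ?_, fun t ht => ?_⟩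
  · have h := Complex.hasSum_taylorSeries_on_ball (r := R) (c := 0) (f := H) (z := (ρ : ℂ))
      (by simpa using hH) (by simpa [abs_of_nonneg h0] using h1)
    have h2 := h.summable.norm
    refine h2.congr fun k => ?_
    simp [abs_of_nonneg h0]
    ring
  · have h := Complex.hasSum_taylorSeries_on_ball (r := R) (c := 0) (f := H) (z := t)
      (by simpa using hH) (by simpa using ht)
    rw [← h.tsum_eq]
    refine tsum_congr fun k => ?_
    simp
    ring

/-- A lower bound for `|1 - w q^(-M) q^k|`, uniform for `w` away from the zeros of `θ`. For `k ≥ M`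
the quantity is a factor of `(w;q)_∞` and stays away from `0`. For `k < M` it equals `|w| q^(k-M)`
times a factor of `(q/w;q)_∞`, and `q^(k-M) ≥ τ^(k-M)` because `q ≤ τ`. -/
theorem exists_dist_bound (hq0 : 0 < q) (hq1 : q < 1) {K : Set ℂ} (hK : IsCompact K)
    (hK0 : ∀ w ∈ K, w ≠ 0 ∧ qTheta q w ≠ 0) :
    ∃ c : ℝ, 0 ≤ c ∧ ∀ w ∈ K, ∀ τ : ℝ, q ≤ τ → τ ≤ 1 → ∀ k M : ℕ,
      τ ^ k ≤ c * τ ^ M * ‖1 - w * ((q : ℂ) ^ M)⁻¹ * (q : ℂ) ^ k‖ := by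
  have hq := ofReal_q_ne_zero hq0
  set F : ℂ → ℝ := fun w => (qExpBound q ‖w‖ * qExpBound q ‖w‖) / ‖qPoch q w‖ +
    (qExpBound q ‖q / w‖ * qExpBound q ‖q / w‖) / (‖w‖ * ‖qPoch q (q / w)‖) with hF
  have hex : Continuous (qExpBound q) := by unfold qExpBound; fun_prop
  have hcont : ContinuousOn F K := by
    intro w hw
    obtain ⟨h1, h2⟩ := hK0 w hw
    have h3 := left_ne_zero_of_mul h2
    have h4 := right_ne_zero_of_mul h2
    have hp := continuous_qPoch hq0 hq1
    have hd : ContinuousAt (fun w : ℂ => (q : ℂ) / w) w := continuousAt_const.div continuousAt_id h1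
    have hd2 : ContinuousAt (fun w : ℂ => qExpBound q ‖(q : ℂ) / w‖) w :=
      hex.continuousAt.comp hd.norm
    have hd3 : ContinuousAt (fun w : ℂ => ‖qPoch q ((q : ℂ) / w)‖) w :=
      (ContinuousAt.comp (f := fun w : ℂ => (q : ℂ) / w) hp.continuousAt hd).norm
    have hd4 : ContinuousAt (fun w : ℂ => qExpBound q ‖w‖) w := by fun_prop
    refine ContinuousAt.continuousWithinAt (ContinuousAt.add ?_ ?_)
    · exact (hd4.mul hd4).div hp.norm.continuousAt (norm_ne_zero_iff.2 h3)
    · exact (hd2.mul hd2).div (continuous_norm.continuousAt.mul hd3)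
        (mul_ne_zero (norm_ne_zero_iff.2 h1) (norm_ne_zero_iff.2 h4))
  obtain ⟨c, hc⟩ := hK.exists_bound_of_continuousOn hcont
  refine ⟨max c 0, le_max_right _ _, fun w hw τ hτq hτ1 k M => ?_⟩
  obtain ⟨h1, h2⟩ := hK0 w hw
  have h3 := norm_pos_iff.2 (left_ne_zero_of_mul h2)
  have h4 := norm_pos_iff.2 (right_ne_zero_of_mul h2)
  have h1' := norm_pos_iff.2 h1
  have hτ0 : 0 < τ := hq0.trans_le hτq
  have hFc : F w ≤ max c 0 := (le_abs_self _).trans ((hc w hw).trans (le_max_left _ _))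
  have := qExpBound_pos (q := q) ‖w‖
  have := qExpBound_pos (q := q) ‖(q : ℂ) / w‖
  rcases le_or_gt M k with hMk | hMk
  · obtain ⟨j, rfl⟩ := Nat.exists_eq_add_of_le hMk
    have e : w * ((q : ℂ) ^ M)⁻¹ * (q : ℂ) ^ (M + j) = w * (q : ℂ) ^ j := by
      rw [pow_add]; field_simp
    have h5 : ‖qPoch q w‖ ≤ ‖1 - w * (q : ℂ) ^ j‖ * (qExpBound q ‖w‖ * qExpBound q ‖w‖) := by
      rw [← one_sub_mul_qPunct hq0 hq1 j w, norm_mul]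
      gcongr
      exact norm_qPunct_le hq0 hq1 j w
    have h6 : 1 ≤ F w * ‖1 - w * (q : ℂ) ^ j‖ := by
      have : 1 ≤ (qExpBound q ‖w‖ * qExpBound q ‖w‖) / ‖qPoch q w‖ * ‖1 - w * (q : ℂ) ^ j‖ := by
        rw [div_mul_eq_mul_div, le_div_iff₀ h3]; linarith
      refine this.trans ?_
      gcongr
      simp only [hF]
      exact le_add_of_nonneg_right (by positivity)
    rw [e, pow_add, mul_comm (max c 0), mul_assoc]
    refine mul_le_mul_of_nonneg_left ?_ (by positivity)
    refine (pow_le_one₀ hτ0.le hτ1).trans (h6.trans ?_)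
    gcongr
  · obtain ⟨j, rfl⟩ := Nat.exists_eq_add_of_lt hMk
    have e : 1 - w * ((q : ℂ) ^ (k + j + 1))⁻¹ * (q : ℂ) ^ k =
        -(w * ((q : ℂ) ^ (j + 1))⁻¹) * (1 - (q / w) * (q : ℂ) ^ j) := by
      rw [pow_succ, pow_succ, pow_add]; field_simp; ring
    have h5 : ‖qPoch q (q / w)‖ ≤
        ‖1 - (q / w) * (q : ℂ) ^ j‖ * (qExpBound q ‖q / w‖ * qExpBound q ‖q / w‖) := by
      rw [← one_sub_mul_qPunct hq0 hq1 j (q / w), norm_mul]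
      gcongr
      exact norm_qPunct_le hq0 hq1 j _
    have h6 : 1 ≤ F w * (‖w‖ * ‖1 - (q / w) * (q : ℂ) ^ j‖) := by
      have : 1 ≤ (qExpBound q ‖q / w‖ * qExpBound q ‖q / w‖) / (‖w‖ * ‖qPoch q (q / w)‖) *
          (‖w‖ * ‖1 - (q / w) * (q : ℂ) ^ j‖) := by
        rw [div_mul_eq_mul_div, le_div_iff₀ (by positivity)]
        nlinarith
      refine this.trans ?_
      gcongr
      simp only [hF]
      exact le_add_of_nonneg_left (by positivity)
    have h7 : 1 ≤ τ ^ (j + 1) * (q ^ (j + 1))⁻¹ := by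
      rw [← div_eq_mul_inv, one_le_div (by positivity)]
      exact pow_le_pow_left₀ hq0.le hτq _
    rw [e, norm_mul, norm_neg, norm_mul, norm_inv, norm_pow, norm_ofReal_q hq0, add_assoc, pow_add]
    have h8 : 1 ≤ max c 0 * (‖w‖ * ‖1 - (q / w) * (q : ℂ) ^ j‖) := h6.trans (by gcongr)
    calc τ ^ k = τ ^ k * 1 := by ring
      _ ≤ τ ^ k * ((max c 0 * (‖w‖ * ‖1 - (q / w) * (q : ℂ) ^ j‖)) *
          (τ ^ (j + 1) * (q ^ (j + 1))⁻¹)) := by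
        refine mul_le_mul_of_nonneg_left ?_ (by positivity)
        exact one_le_mul_of_one_le_of_one_le h8 h7
      _ = _ := by ring

/-- The first `J` terms of the expansion of `1/(1 - u)` at infinity, with exact remainder. -/
theorem inv_one_sub_eq {u : ℂ} (h0 : u ≠ 0) (h1 : 1 - u ≠ 0) (J : ℕ) :
    (1 - u)⁻¹ = (u⁻¹) ^ J * (1 - u)⁻¹ - ∑ j ∈ Finset.range J, (u⁻¹) ^ (j + 1) := by
  induction J with
  | zero => simp
  | succ J ih =>
    rw [Finset.sum_range_succ]
    conv_lhs => rw [ih]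
    have : u⁻¹ ^ J * u⁻¹ * (1 - u)⁻¹ - u⁻¹ ^ J * u⁻¹ = u⁻¹ ^ J * (1 - u)⁻¹ := by
      field_simp; ring
    rw [pow_succ]
    linear_combination -this

/-- With `H(t) = ∑ h_k t^k`, the function is `E(w) = (w;q)_∞ ∑ h_k / (1 - w q^k)`. Expanding at `w =
∞`, the coefficient of `w^(-(j+1))` is, up to sign, the moment `∑ h_k q^(-k(j+1)) = H(q^(-(j+1)))`.
The vanishing hypothesis removes these terms as long as the points lie in the disc of convergence,
so the rate of decay is limited only by the radius `R`. -/
theorem exists_entire_of_analytic_coeff (hq0 : 0 < q) (hq1 : q < 1) {H : ℂ → ℂ} {R : ℝ}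
    (hR : 1 < R) (hH : DifferentiableOn ℂ H (Metric.ball 0 R)) :
    ∃ E : ℂ → ℂ, Differentiable ℂ E ∧
      (∀ w, ‖w‖ < 1 → E w = qPoch q w * ∑' n, w ^ n * H ((q : ℂ) ^ n)) ∧
      ((∀ j : ℕ, (q ^ (j + 1))⁻¹ < R → H (((q : ℂ) ^ (j + 1))⁻¹) = 0) →
        ∀ κ : ℝ, R⁻¹ < κ → κ ≤ 1 → ∀ K : Set ℂ, IsCompact K →
          (∀ w ∈ K, w ≠ 0 ∧ qTheta q w ≠ 0) →
          ∃ C : ℝ, 0 ≤ C ∧ ∀ w ∈ K, ∀ M : ℕ,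
            ‖E (w * ((q : ℂ) ^ M)⁻¹)‖ ≤ C * κ ^ M * ‖qPoch q (w * ((q : ℂ) ^ M)⁻¹)‖) := by
  have hq := ofReal_q_ne_zero hq0
  obtain ⟨h, hs, hsum⟩ := exists_taylor_coeff hH
  have hs1 : Summable fun k => ‖h k‖ := by simpa using hs 1 zero_le_one hR
  refine ⟨pfSeries q h, differentiable_pfSeries hq0 hq1 hs1, fun w hw => ?_, ?_⟩
  · rw [pfSeries_eq hq0 hq1 hs1 hw]
    congr 1
    refine tsum_congr fun n => ?_
    rw [hsum]
    rw [norm_pow, norm_ofReal_q hq0]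
    exact (pow_le_one₀ hq0.le hq1.le).trans_lt hR
  intro hvan κ hκR hκ1 K hK hK0
  have hR0 : 0 < R := zero_lt_one.trans hR
  have hκ0 : 0 < κ := (inv_pos.2 hR0).trans hκR
  -- Here `q^(J+1) < κ ≤ q^J`, so `κ = q^J τ` with `q ≤ τ ≤ 1`. The `J` vanishing moments supply
  -- `(q^J)^M`, and the distance bound supplies `τ^M`.
  obtain ⟨J, hJ1, hJ2⟩ := exists_nat_pow_near_of_lt_one hκ0 hκ1 hq0 hq1
  have hκR' : κ⁻¹ < R := by rwa [inv_lt_comm₀ hκ0 hR0]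
  have hsκ : Summable fun k => ‖h k‖ * (κ⁻¹) ^ k := hs _ (by positivity) hκR'
  obtain ⟨c, hc0, hc⟩ := exists_dist_bound hq0 hq1 hK hK0
  obtain ⟨D, hD⟩ := hK.exists_bound_of_continuousOn (f := fun w : ℂ => (w⁻¹) ^ J)
    (fun w hw => ((continuousAt_inv₀ (hK0 w hw).1).pow J).continuousWithinAt)
  refine ⟨|D| * c * ∑' k, ‖h k‖ * (κ⁻¹) ^ k, by positivity, fun w hw M => ?_⟩
  set W : ℂ := w * ((q : ℂ) ^ M)⁻¹ with hW
  obtain ⟨hw0, hwθ⟩ := hK0 w hw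
  have hW0 : W ≠ 0 := mul_ne_zero hw0 (by positivity)
  have hqJ : 0 < q ^ J := by positivity
  set τ : ℝ := κ / q ^ J with hτ
  have hτq : q ≤ τ := by
    rw [hτ, le_div_iff₀ hqJ, ← pow_succ']; exact hJ1.le
  have hτ1 : τ ≤ 1 := by rw [hτ, div_le_one hqJ]; exact hJ2
  have hτ0 : 0 < τ := hq0.trans_le hτq
  have hd := fun k => hc w hw τ hτq hτ1 k M
  have hne : ∀ k : ℕ, 1 - W * (q : ℂ) ^ k ≠ 0 := by
    intro k h0
    have := hd k
    rw [← hW, h0, norm_zero, mul_zero] at this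
    exact absurd this (not_le.2 (by positivity))
  have hbd : ∀ k : ℕ, ‖(1 - W * (q : ℂ) ^ k)⁻¹‖ ≤ c * τ ^ M * (τ⁻¹) ^ k := by
    intro k
    rw [norm_inv, inv_pow, ← div_eq_mul_inv, le_div_iff₀ (by positivity), inv_mul_le_iff₀
      (norm_pos_iff.2 (hne k)), mul_comm]
    exact hd k
  set g : ℕ → ℂ := fun k => h k * ((((q : ℂ) ^ k)⁻¹) ^ J * (1 - W * (q : ℂ) ^ k)⁻¹) with hg
  have hgb : ∀ k, ‖g k‖ ≤ c * τ ^ M * (‖h k‖ * (κ⁻¹) ^ k) := by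
    intro k
    simp only [hg]
    rw [norm_mul, norm_mul, norm_pow, norm_inv, norm_pow, norm_ofReal_q hq0]
    calc ‖h k‖ * (((q ^ k)⁻¹) ^ J * ‖(1 - W * (q : ℂ) ^ k)⁻¹‖)
        ≤ ‖h k‖ * (((q ^ k)⁻¹) ^ J * (c * τ ^ M * (τ⁻¹) ^ k)) := by gcongr; exact hbd k
      _ = c * τ ^ M * (‖h k‖ * (κ⁻¹) ^ k) := by
        have : (κ⁻¹) ^ k = ((q ^ k)⁻¹) ^ J * (τ⁻¹) ^ k := by
          rw [hτ, inv_div, div_pow, inv_pow, inv_pow, ← pow_mul, ← pow_mul, mul_comm J k]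
          field_simp
        rw [this]; ring
  have hgs : Summable g := Summable.of_norm_bounded (hsκ.mul_left (c * τ ^ M)) hgb
  -- The moments with `j + 1 ≤ J` are values of `H` inside the disc, because `q^(-(j+1)) ≤ κ⁻¹ < R`.
  have hvan' : ∀ j ∈ Finset.range J, HasSum (fun k => h k * ((((q : ℂ) ^ k)⁻¹) ^ (j + 1))) 0 := by
    intro j hj
    have hjJ : j + 1 ≤ J := Finset.mem_range.1 hj
    have h1 : (q ^ (j + 1))⁻¹ < R := by
      refine lt_of_le_of_lt ?_ hκR'
      refine inv_anti₀ hκ0 (hJ2.trans (pow_le_pow_of_le_one hq0.le hq1.le hjJ))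
    have h2 : ‖((q : ℂ) ^ (j + 1))⁻¹‖ < R := by
      rwa [norm_inv, norm_pow, norm_ofReal_q hq0]
    have h3 := hsum _ h2
    rw [hvan j h1] at h3
    have e : ∀ k, h k * ((((q : ℂ) ^ k)⁻¹) ^ (j + 1)) = h k * (((q : ℂ) ^ (j + 1))⁻¹) ^ k := by
      intro k
      rw [inv_pow, inv_pow, ← pow_mul, ← pow_mul, mul_comm k]
    simp only [e]
    rw [h3]
    refine Summable.hasSum (Summable.of_norm ?_)
    refine (hs _ (norm_nonneg _) h2).congr fun k => ?_
    rw [norm_mul, norm_pow]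
  have key : ∀ k, h k * qPunct q k W = qPoch q W * ((W⁻¹) ^ J * g k -
      ∑ j ∈ Finset.range J, (W⁻¹) ^ (j + 1) * (h k * ((((q : ℂ) ^ k)⁻¹) ^ (j + 1)))) := by
    intro k
    have hu0 : W * (q : ℂ) ^ k ≠ 0 := by positivity
    have h1 := inv_one_sub_eq hu0 (hne k) J
    have h2 : qPunct q k W = qPoch q W * (1 - W * (q : ℂ) ^ k)⁻¹ := by
      rw [← one_sub_mul_qPunct hq0 hq1 k W]
      field_simp [hne k]
    rw [h2, h1]
    simp only [hg, mul_inv, mul_pow]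
    rw [mul_left_comm, mul_sub, Finset.mul_sum]
    congr 2
    · ring
    · exact Finset.sum_congr rfl fun j _ => by ring
  have e1 : HasSum (fun k => h k * qPunct q k W) (qPoch q W * ((W⁻¹) ^ J * (∑' k, g k) - 0)) := by
    simp only [key]
    refine HasSum.mul_left _ ((hgs.hasSum.mul_left _).sub ?_)
    have := hasSum_sum fun j hj => (hvan' j hj).mul_left ((W⁻¹) ^ (j + 1))
    simpa using this
  rw [pfSeries, e1.tsum_eq, sub_zero, norm_mul, norm_mul, mul_comm]
  refine mul_le_mul_of_nonneg_right ?_ (norm_nonneg _)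
  have hgn : ‖∑' k, g k‖ ≤ c * τ ^ M * ∑' k, ‖h k‖ * (κ⁻¹) ^ k := by
    rw [← tsum_mul_left]
    exact tsum_of_norm_bounded (hsκ.mul_left _).hasSum hgb
  have hWJ : ‖W⁻¹ ^ J‖ ≤ |D| * (q ^ J) ^ M := by
    rw [hW, mul_inv, inv_inv, mul_pow, norm_mul, norm_pow ((q : ℂ) ^ M), norm_pow (q : ℂ),
      norm_ofReal_q hq0, ← pow_mul, ← pow_mul, mul_comm M J]
    gcongr
    exact (hD w hw).trans (le_abs_self _)
  calc ‖W⁻¹ ^ J‖ * ‖∑' k, g k‖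
      ≤ (|D| * (q ^ J) ^ M) * (c * τ ^ M * ∑' k, ‖h k‖ * (κ⁻¹) ^ k) := by gcongr
    _ = |D| * c * (∑' k, ‖h k‖ * (κ⁻¹) ^ k) * κ ^ M := by
      have : κ ^ M = (q ^ J) ^ M * τ ^ M := by
        rw [← mul_pow, hτ]; congr 1; field_simp
      rw [this]; ring

/-! ### The regularized `₂φ₁` -/

theorem phiSeries_eq (a b c z : ℂ) :
    phiSeries q a b c z =
      ∑' n, z ^ n * (qFin q a n * qFin q b n / (qFin q c n * qFin q q n)) := by
  simp only [phiSeries, qFin, Finset.prod_div_distrib, Finset.prod_mul_distrib, pow_succ']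

/-- The coefficients are values at `q^n` of a function of `t` that may have poles in the unit disc.
Dropping the first `N` terms replaces `a, b` by `a q^N, b q^N`, which pushes the poles beyond `|t| =
2`; `exists_entire_of_analytic_coeff` then extends the shifted series, and the dropped terms form a
polynomial. -/
theorem exists_entireExtension (hq0 : 0 < q) (hq1 : q < 1) (a b : ℂ) {c : ℂ}
    (hc : qPoch q c ≠ 0) : ∃ G, IsEntireExtension q a b c G := by
  have hq := ofReal_q_ne_zero hq0
  have hlim : ∀ x : ℂ, ∀ᶠ N : ℕ in atTop, ‖x * (q : ℂ) ^ N‖ < 1 / 2 := fun x =>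
    (tendsto_pow_mul_zero hq0 hq1 x).norm.eventually (gt_mem_nhds (by simp))
  obtain ⟨N, hNa, hNb⟩ := ((hlim a).and (hlim b)).exists
  set A := a * (q : ℂ) ^ N with hA
  set B := b * (q : ℂ) ^ N with hB
  set C := c * (q : ℂ) ^ N with hC
  set Q := (q : ℂ) * (q : ℂ) ^ N with hQ
  have half : ∀ {x t : ℂ}, ‖x‖ < 1 / 2 → ‖t‖ < 2 → ‖x * t‖ < 1 := by
    intro x t hx ht
    rw [norm_mul]
    nlinarith [norm_nonneg x, norm_nonneg t]
  set H : ℂ → ℂ := fun t => qPoch q (C * t) * qPoch q (Q * t) / (qPoch q (A * t) * qPoch q (B * t))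
    with hH
  have dP : ∀ x : ℂ, Differentiable ℂ fun t => qPoch q (x * t) := fun x =>
    (differentiable_qPoch hq0 hq1).comp (by fun_prop)
  have hHd : DifferentiableOn ℂ H (Metric.ball 0 2) := by
    refine DifferentiableOn.div ((dP C).mul (dP Q)).differentiableOn
      ((dP A).mul (dP B)).differentiableOn fun t ht => ?_
    have ht : ‖t‖ < 2 := by simpa using ht
    exact mul_ne_zero (qPoch_ne_zero_of_norm_lt_one hq0 hq1 (half hNa ht))
      (qPoch_ne_zero_of_norm_lt_one hq0 hq1 (half hNb ht))
  obtain ⟨E, hE, hE1, -⟩ := exists_entire_of_analytic_coeff hq0 hq1 one_lt_two hHd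
  set t : ℕ → ℂ := fun n => qFin q a n * qFin q b n / (qFin q c n * qFin q q n) with ht
  have hqq := qPoch_q_ne_zero hq0 hq1
  set κ : ℂ := t N * (qPoch q A * qPoch q B / (qPoch q C * qPoch q Q)) with hκ
  have e0 : ∀ n, t (n + N) = κ * H ((q : ℂ) ^ n) := by
    intro n
    have fin : ∀ x : ℂ, qPoch q (x * (q : ℂ) ^ N) =
        qFin q (x * (q : ℂ) ^ N) n * qPoch q (x * (q : ℂ) ^ N * (q : ℂ) ^ n) := fun x =>
      qPoch_eq_qFin_mul hq0 hq1 _ n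
    have hC0 : qPoch q C ≠ 0 := by
      rw [qPoch_eq_qFin_mul hq0 hq1 c N] at hc; exact right_ne_zero_of_mul hc
    have hQ0 : qPoch q Q ≠ 0 := by
      rw [qPoch_eq_qFin_mul hq0 hq1 q N] at hqq; exact right_ne_zero_of_mul hqq
    have hA0 : qPoch q A ≠ 0 := qPoch_ne_zero_of_norm_lt_one hq0 hq1 (by linarith)
    have hB0 : qPoch q B ≠ 0 := qPoch_ne_zero_of_norm_lt_one hq0 hq1 (by linarith)
    have h1 := qFin_ne_zero hq0 hq1 hc N
    have h2 := qFin_ne_zero hq0 hq1 hqq N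
    simp only [ht, hκ, hH, add_comm n N, qFin_add]
    rw [← hA, ← hB, ← hC, ← hQ]
    have fA := fin a
    have fB := fin b
    have fC := fin c
    have fQ := fin q
    rw [← hA] at fA
    rw [← hB] at fB
    rw [← hC] at fC
    rw [← hQ] at fQ
    rw [fA] at hA0 ⊢
    rw [fB] at hB0 ⊢
    rw [fC] at hC0 ⊢
    rw [fQ] at hQ0 ⊢
    have := left_ne_zero_of_mul hA0
    have := left_ne_zero_of_mul hB0
    have := left_ne_zero_of_mul hC0
    have := left_ne_zero_of_mul hQ0
    have := right_ne_zero_of_mul hA0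
    have := right_ne_zero_of_mul hB0
    have := right_ne_zero_of_mul hC0
    have := right_ne_zero_of_mul hQ0
    generalize qPoch q (A * (q : ℂ) ^ n) = vA at *
    generalize qPoch q (B * (q : ℂ) ^ n) = vB at *
    generalize qPoch q (C * (q : ℂ) ^ n) = vC at *
    generalize qPoch q (Q * (q : ℂ) ^ n) = vQ at *
    field_simp
  have htb : ∀ n, ‖t n‖ ≤ qExpBound q ‖a‖ * qExpBound q ‖b‖ *
      ((qExpBound q ‖c‖ / ‖qPoch q c‖) * qInvBound q) := by
    intro n
    simp only [ht, div_eq_mul_inv (qFin q a n * qFin q b n), mul_inv]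
    exact norm_mul_le_of_le' (norm_mul_le_of_le' (norm_qFin_le hq0 hq1 a n)
      (norm_qFin_le hq0 hq1 b n)) (norm_mul_le_of_le' (norm_inv_qFin_le hq0 hq1 hc n)
      (norm_inv_qFin_q_le hq0 hq1 n))
  refine ⟨fun z => qPoch q z * ∑ n ∈ Finset.range N, z ^ n * t n + κ * z ^ N * E z, ?_, ?_⟩
  · have := differentiable_qPoch hq0 hq1
    fun_prop
  · intro z hz
    beta_reduce
    rw [phiSeries_eq, ← (summable_pow_mul htb hz).sum_add_tsum_nat_add N, mul_add, hE1 z hz]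
    congr 1
    rw [mul_left_comm, ← tsum_mul_left]
    congr 1
    refine tsum_congr fun n => ?_
    rw [e0, pow_add]
    ring

theorem isEntireExtension_phiReg (hq0 : 0 < q) (hq1 : q < 1) (a b : ℂ) {c : ℂ}
    (hc : qPoch q c ≠ 0) : IsEntireExtension q a b c (phiReg q a b c) :=
  Classical.epsilon_spec (exists_entireExtension hq0 hq1 a b hc)

theorem qPoch_mul_phiSeries (hq0 : 0 < q) (hq1 : q < 1) (a b : ℂ) {c : ℂ}
    (hc : qPoch q c ≠ 0) (z : ℂ) :
    qPoch q c * (qPoch q z * phiSeries q a b c z) = heineSeries q a b c z := by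
  rw [phiSeries_eq, heineSeries, mul_left_comm, ← tsum_mul_left]
  congr 1
  refine tsum_congr fun n => ?_
  have h := inv_qFin hq0 hq1 hc n
  have h1 := qFin_ne_zero hq0 hq1 hc n
  have h2 : qPoch q (c * (q : ℂ) ^ n) = (qFin q c n)⁻¹ * qPoch q c := by
    rw [h]; field_simp
  rw [h2]
  field_simp

/-! ### Continuation of Heine's transformation -/

/-- The differences, divided by `q ^ n`, of consecutive coefficients of `heineSeries`. -/
def heineDiff (q : ℝ) (a b c : ℂ) (n : ℕ) : ℂ :=
  qFin q a n * qFin q b n / qFin q q (n + 1) * qPoch q (c * (q : ℂ) ^ (n + 1)) *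
    (-a - b + a * b * (q : ℂ) ^ n + q + c - c * (q : ℂ) ^ (n + 1))

/-- The continuation of `heineSeries q a b c z` in `z` to the disc of radius `1 / q`. -/
def heineExt (q : ℝ) (a b c z : ℂ) : ℂ :=
  qPoch q (q * z) * (qPoch q c + z * ∑' n, (q * z) ^ n * heineDiff q a b c n)

theorem norm_heineDiff_le (hq0 : 0 < q) (hq1 : q < 1) {a b c : ℂ} {A B C : ℝ} (ha : ‖a‖ ≤ A)
    (hb : ‖b‖ ≤ B) (hc : ‖c‖ ≤ C) (n : ℕ) :
    ‖heineDiff q a b c n‖ ≤ qExpBound q A * qExpBound q B * qInvBound q * qExpBound q C *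
      (A + B + A * B + 1 + C + C) := by
  have hqn : ∀ n : ℕ, ‖(q : ℂ) ^ n‖ ≤ 1 := fun n => by
    rw [norm_pow, norm_ofReal_q hq0]; exact pow_le_one₀ hq0.le hq1.le
  have hA : 0 ≤ A := (norm_nonneg _).trans ha
  have hB : 0 ≤ B := (norm_nonneg _).trans hb
  have hC : 0 ≤ C := (norm_nonneg _).trans hc
  have h1 : ‖-a - b + a * b * (q : ℂ) ^ n + q + c - c * (q : ℂ) ^ (n + 1)‖ ≤
      A + B + A * B + 1 + C + C := by
    refine norm_sub_le_of_le (norm_add_le_of_le (norm_add_le_of_le (norm_add_le_of_le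
      (norm_sub_le_of_le (by rwa [norm_neg]) hb) ?_) ?_) hc) ?_
    · simpa using norm_mul_le_of_le' (norm_mul_le_of_le' ha hb) (hqn n)
    · rw [norm_ofReal_q hq0]; exact hq1.le
    · simpa using norm_mul_le_of_le' hc (hqn (n + 1))
  unfold heineDiff
  rw [div_eq_mul_inv]
  exact norm_mul_le_of_le' (norm_mul_le_of_le' (norm_mul_le_of_le' (norm_mul_le_of_le'
    ((norm_qFin_le hq0 hq1 a n).trans (qExpBound_mono hq1 ha))
    ((norm_qFin_le hq0 hq1 b n).trans (qExpBound_mono hq1 hb)))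
    (norm_inv_qFin_q_le hq0 hq1 _))
    ((norm_qPoch_mul_pow_le hq0 hq1 c _).trans (qExpBound_mono hq1 hc))) h1

/-- Summation by parts: the factor `1 - z` of `(z;q)_∞` turns coefficients into their differences,
which carry an additional `q^n`. The larger disc is needed because the variable `β/(qγ)` of `𝔉_0` is
only known to have modulus less than `1/q`. -/
theorem heineExt_eq (hq0 : 0 < q) (hq1 : q < 1) (a b c : ℂ) {z : ℂ} (hz : ‖z‖ < 1) :
    heineSeries q a b c z = heineExt q a b c z := by
  set t : ℕ → ℂ := fun n =>
    qFin q a n * qFin q b n / qFin q q n * qPoch q (c * (q : ℂ) ^ n) with ht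
  have hs : Summable fun n => z ^ n * t n := summable_pow_mul (norm_heine_coeff_le hq0 hq1 a b c) hz
  have hd : ∀ n, t (n + 1) - t n = (q : ℂ) ^ n * heineDiff q a b c n := by
    intro n
    have h2 := qFin_ne_zero hq0 hq1 (qPoch_q_ne_zero hq0 hq1) n
    have h1 := one_sub_pow_succ_ne_zero hq0 hq1 n
    have e : qPoch q (c * (q : ℂ) ^ n) =
        (1 - c * (q : ℂ) ^ n) * qPoch q (c * (q : ℂ) ^ (n + 1)) := by
      rw [qPoch_eq_mul hq0 hq1, pow_succ]; congr 2; ring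
    simp only [ht, heineDiff, qFin_succ]
    rw [e]
    generalize qPoch q (c * (q : ℂ) ^ (n + 1)) = V
    simp only [pow_succ]
    generalize (q : ℂ) ^ n = Q at h1 ⊢
    rw [mul_comm] at h1
    field_simp
    ring
  have h0 : t 0 = qPoch q c := by simp [ht, qFin]
  have e1 : (1 - z) * ∑' n, z ^ n * t n =
      qPoch q c + z * ∑' n, (q * z) ^ n * heineDiff q a b c n := by
    have e2 : ∑' n, (q * z) ^ n * heineDiff q a b c n =
        ∑' n, (z ^ n * t (n + 1) - z ^ n * t n) := by
      refine tsum_congr fun n => ?_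
      rw [← mul_sub, hd, mul_pow]; ring
    have hs' : Summable fun n => z ^ n * t (n + 1) :=
      summable_pow_mul (fun n => norm_heine_coeff_le hq0 hq1 a b c (n + 1)) hz
    rw [e2, hs'.tsum_sub hs, sub_mul, one_mul, mul_sub, ← tsum_mul_left (f := fun n => z ^ n * t (n + 1))]
    nth_rewrite 1 [hs.tsum_eq_zero_add]
    simp only [pow_zero, one_mul, h0, pow_succ', mul_assoc]
    ring
  rw [heineSeries, heineExt, ← e1, qPoch_eq_mul hq0 hq1 z]
  simp only [ht]
  ring

theorem differentiableOn_heineExt (hq0 : 0 < q) (hq1 : q < 1) (a b c : ℂ) :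
    DifferentiableOn ℂ (heineExt q a b c) (Metric.ball 0 q⁻¹) := by
  have h1 := differentiableOn_tsum_pow_mul (norm_heineDiff_le hq0 hq1 (le_refl ‖a‖) (le_refl ‖b‖)
    (le_refl ‖c‖))
  have h2 : DifferentiableOn ℂ (fun z : ℂ => ∑' n, ((q : ℂ) * z) ^ n * heineDiff q a b c n)
      (Metric.ball 0 q⁻¹) := by
    refine h1.comp (f := fun z : ℂ => (q : ℂ) * z) (by fun_prop) fun z hz => ?_
    rw [mem_ball_zero_iff] at hz ⊢
    rw [norm_mul, norm_ofReal_q hq0]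
    calc q * ‖z‖ < q * q⁻¹ := by gcongr
      _ = 1 := mul_inv_cancel₀ hq0.ne'
  have h3 : Differentiable ℂ fun z : ℂ => qPoch q (q * z) :=
    (differentiable_qPoch hq0 hq1).comp (by fun_prop)
  exact h3.differentiableOn.mul ((differentiableOn_const _).add (differentiableOn_id.mul h2))

theorem differentiable_heineExt_comp (hq0 : 0 < q) (hq1 : q < 1) (a k l : ℂ) {z : ℂ}
    (hz : ‖(q : ℂ) * z‖ < 1) : Differentiable ℂ fun w => heineExt q a (k * w) (l * w) z := by
  have dq := differentiable_qPoch hq0 hq1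
  have h1 : Differentiable ℂ fun w =>
      ∑' n, ((q : ℂ) * z) ^ n * heineDiff q a (k * w) (l * w) n := by
    refine differentiable_tsum_pow_mul (fun n => ?_) (fun r => ?_) hz
    · unfold heineDiff
      have e1 : Differentiable ℂ fun w => qFin q (k * w) n :=
        (differentiable_qFin n).comp (by fun_prop)
      have e2 : Differentiable ℂ fun w => qPoch q (l * w * (q : ℂ) ^ (n + 1)) :=
        dq.comp (by fun_prop)
      exact ((((differentiable_const _).mul e1).div_const _).mul e2).mul (by fun_prop)
    · refine ⟨_, fun n w hw => norm_heineDiff_le hq0 hq1 le_rfl (B := ‖k‖ * r) (C := ‖l‖ * r)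
        ?_ ?_ n⟩
      · rw [norm_mul]; gcongr
      · rw [norm_mul]; gcongr
  have h2 : Differentiable ℂ fun w => qPoch q (l * w) := dq.comp (by fun_prop)
  unfold heineExt
  exact (h2.add (h1.const_mul z)).const_mul _

theorem qPoch_mul_phiReg_eq_heineExt (hq0 : 0 < q) (hq1 : q < 1) (a b : ℂ) {c z : ℂ}
    (hc : qPoch q c ≠ 0) (hz : ‖z‖ < q⁻¹) :
    qPoch q c * phiReg q a b c z = heineExt q a b c z := by
  obtain ⟨h1, h2⟩ := isEntireExtension_phiReg hq0 hq1 a b hc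
  have hU : IsOpen (Metric.ball (0 : ℂ) q⁻¹) := Metric.isOpen_ball
  refine AnalyticOnNhd.eqOn_of_preconnected_of_eventuallyEq (U := Metric.ball 0 q⁻¹)
    (f := fun z => qPoch q c * phiReg q a b c z)
    ((h1.const_mul _).differentiableOn.analyticOnNhd hU)
    ((differentiableOn_heineExt hq0 hq1 a b c).analyticOnNhd hU)
    (convex_ball _ _).isPreconnected (z₀ := 0) (by simpa using hq0) ?_ (by simpa using hz)
  filter_upwards [Metric.ball_mem_nhds (0 : ℂ) one_pos] with x hx
  have hx : ‖x‖ < 1 := by simpa using hx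
  rw [h2 x hx, qPoch_mul_phiSeries hq0 hq1 a b hc, heineExt_eq hq0 hq1 a b c hx]

/-- On the right `z` occurs only in the parameters, so that side is entire in `z`, and the identity
theorem on the disc of radius `1/q` applies. -/
theorem heineExt_symm (hq0 : 0 < q) (hq1 : q < 1) (a k : ℂ) {z w : ℂ} (hz : ‖z‖ < q⁻¹)
    (hw : ‖w‖ < 1) (hw0 : w ≠ 0) :
    heineExt q a (k * a * w) (a * w) z = heineSeries q (k * a * z) a (a * z) w := by
  have hU : IsOpen (Metric.ball (0 : ℂ) q⁻¹) := Metric.isOpen_ball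
  refine AnalyticOnNhd.eqOn_of_preconnected_of_eventuallyEq (U := Metric.ball 0 q⁻¹)
    (g := fun z => heineSeries q (k * a * z) a (a * z) w)
    ((differentiableOn_heineExt hq0 hq1 _ _ _).analyticOnNhd hU)
    ((differentiable_heineSeries_comp hq0 hq1 (by fun_prop) (by fun_prop) (by fun_prop)
      hw).differentiableOn.analyticOnNhd hU)
    (convex_ball _ _).isPreconnected (z₀ := 0) (by simpa using hq0) ?_ (by simpa using hz)
  filter_upwards [Metric.ball_mem_nhds (0 : ℂ) one_pos] with x hx
  have hx : ‖x‖ < 1 := by simpa using hx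
  rw [← heineExt_eq hq0 hq1 _ _ _ hx, heineSeries_symm hq0 hq1 a k hx hw hw0]

/-- Heine's transformation, with both sides continued: `w` is arbitrary. -/
theorem qPoch_mul_phiReg (hq0 : 0 < q) (hq1 : q < 1) (a k : ℂ) {z w : ℂ} (hz : ‖z‖ < q⁻¹)
    (hc : qPoch q (a * w) ≠ 0) (haz : qPoch q (a * z) ≠ 0) {Ψ : ℂ → ℂ} (hΨ : Differentiable ℂ Ψ)
    (hΨ1 : ∀ w, ‖w‖ < 1 → Ψ w = qPoch q w * phiSeries q (k * a * z) a (a * z) w) :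
    qPoch q (a * w) * phiReg q a (k * a * w) (a * w) z = qPoch q (a * z) * Ψ w := by
  have hz' : ‖(q : ℂ) * z‖ < 1 := by
    rw [norm_mul, norm_ofReal_q hq0]
    calc q * ‖z‖ < q * q⁻¹ := by gcongr
      _ = 1 := mul_inv_cancel₀ hq0.ne'
  rw [qPoch_mul_phiReg_eq_heineExt hq0 hq1 _ _ hc hz]
  -- Now `z` is fixed and `w` varies: both sides are entire in `w` and agree near `1/2`, where
  -- `heineExt_symm` is available.
  have h := eq_of_eventuallyEq_of_differentiable (z₀ := (1 / 2 : ℂ))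
    (differentiable_heineExt_comp hq0 hq1 a (k * a) a hz') (hΨ.const_mul (qPoch q (a * z))) ?_
  · exact congrFun h w
  have h1 : ∀ᶠ a : ℂ in 𝓝 (1 / 2 : ℂ), ‖a‖ < 1 :=
    continuous_norm.continuousAt.eventually_lt continuousAt_const (by norm_num)
  have h2 : ∀ᶠ a : ℂ in 𝓝 (1 / 2 : ℂ), a ≠ 0 := eventually_ne_nhds (by norm_num)
  filter_upwards [h1, h2] with x hx hx0
  rw [heineExt_symm hq0 hq1 a k hz hx hx0, hΨ1 x hx, qPoch_mul_phiSeries hq0 hq1 _ _ haz]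

/-! ### Expansion of `₂φ₁` for a large variable -/

/-- The condition on `dslope` covers two distinct zeros and a double zero at once; the second case
serves `γ = δ`. -/
theorem exists_eq_sub_mul_sub_mul {f : ℂ → ℂ} (hf : Differentiable ℂ f) {a b : ℂ} (ha : f a = 0)
    (hb : dslope f a b = 0) :
    ∃ g : ℂ → ℂ, Differentiable ℂ g ∧ ∀ t, f t = (t - a) * (t - b) * g t := by
  have d : ∀ {f : ℂ → ℂ} (c : ℂ), Differentiable ℂ f → Differentiable ℂ (dslope f c) := by
    intro f c hf
    rw [← differentiableOn_univ] at hf ⊢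
    exact (Complex.differentiableOn_dslope univ_mem).2 hf
  refine ⟨dslope (dslope f a) b, d b (d a hf), fun t => ?_⟩
  have h1 := sub_smul_dslope f a t
  have h2 := sub_smul_dslope (dslope f a) b t
  rw [smul_eq_mul, ha, sub_zero] at h1
  rw [smul_eq_mul, hb, sub_zero] at h2
  rw [← h1, ← h2]
  ring

/-- `E` is negligible, for a large variable, compared with `(w; q)_∞ |w| ^ log_q (q m)`: on
compact sets of `w`, one has `E (w q ^ (-M)) = O(κ ^ M (w q ^ (-M); q)_∞)` if `κ > q m`. -/
def HasTailBound (q m : ℝ) (E : ℂ → ℂ) : Prop :=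
  ∀ κ : ℝ, q * m < κ → κ ≤ 1 → ∀ K : Set ℂ, IsCompact K →
    (∀ w ∈ K, w ≠ 0 ∧ qTheta q w ≠ 0) →
    ∃ C : ℝ, 0 ≤ C ∧ ∀ w ∈ K, ∀ M : ℕ,
      ‖E (w * ((q : ℂ) ^ M)⁻¹)‖ ≤ C * κ ^ M * ‖qPoch q (w * ((q : ℂ) ^ M)⁻¹)‖

theorem eq_one_of_qPoch_eq_zero (hq0 : 0 < q) (hq1 : q < 1) {a : ℂ} (ha : q * ‖a‖ < 1) {n : ℕ}
    (h : qPoch q (a * (q : ℂ) ^ n) = 0) : n = 0 ∧ a = 1 := by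
  by_contra hne
  refine absurd h (qPoch_ne_zero hq0 hq1 fun i hi => ?_)
  rw [mul_assoc, ← pow_add] at hi
  rcases Nat.eq_zero_or_pos (n + i) with h0 | h0
  · rw [h0, pow_zero, mul_one] at hi
    exact hne ⟨by omega, hi⟩
  · obtain ⟨j, hj⟩ := Nat.exists_eq_add_of_lt h0
    rw [hj, zero_add, pow_succ', ← mul_assoc] at hi
    have h1 := norm_mul_pow_le hq0 hq1 (a * q) j
    rw [hi, norm_one, norm_mul, norm_ofReal_q hq0] at h1
    linarith

/-- With `t = q^n`, the difference `c n - μ n` is `N(t)` divided by `(At;q)_∞ (Bt;q)_∞ (q;q)_n`. The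
zeros of `N` cancel the poles at `1/A` and `1/B`; every other pole has modulus at least `R = 1/(qm)
> 1`. Writing `1/(q;q)_n = (qt;q)_∞ / (q;q)_∞` provides the zeros at `q⁻¹, q⁻², …` required by
`exists_entire_of_analytic_coeff`. If `A = 1` or `B = 1`, the quotient at `n = 0` is `0/0`, and `h0`
supplies that coefficient separately. -/
theorem exists_tail (hq0 : 0 < q) (hq1 : q < 1) {A B : ℂ} {m : ℝ} (hm : 0 < m) (hqm : q * m < 1)
    (hA : ‖A‖ ≤ m) (hB : ‖B‖ ≤ m) {N g : ℂ → ℂ} (hg : Differentiable ℂ g)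
    (hN : ∀ t, N t = (1 - A * t) * (1 - B * t) * g t) {c μ : ℕ → ℂ} {Kc Kμ : ℝ}
    (hc : ∀ n, ‖c n‖ ≤ Kc) (hμ : ∀ n, ‖μ n‖ ≤ Kμ)
    (h0 : A = 1 ∨ B = 1 → g = 0 ∧ c 0 = μ 0)
    (h : ∀ n, qPoch q (A * (q : ℂ) ^ n) ≠ 0 → qPoch q (B * (q : ℂ) ^ n) ≠ 0 →
      (c n - μ n) * (qPoch q (A * (q : ℂ) ^ n) * qPoch q (B * (q : ℂ) ^ n)) =
        N ((q : ℂ) ^ n) / qFin q q n) :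
    ∃ E : ℂ → ℂ, Differentiable ℂ E ∧ HasTailBound q m E ∧
      ∀ w, ‖w‖ < 1 → E w = qPoch q w * (∑' n, w ^ n * c n - ∑' n, w ^ n * μ n) := by
  have hq := ofReal_q_ne_zero hq0
  have hqq := qPoch_q_ne_zero hq0 hq1
  set R : ℝ := (q * m)⁻¹ with hR
  have hR1 : 1 < R := (one_lt_inv₀ (by positivity)).2 hqm
  set H : ℂ → ℂ := fun t =>
    qPoch q (q * t) / qPoch q q * (g t / (qPoch q (A * q * t) * qPoch q (B * q * t))) with hH
  have dP : ∀ x : ℂ, Differentiable ℂ fun t => qPoch q (x * t) := fun x =>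
    (differentiable_qPoch hq0 hq1).comp (by fun_prop)
  have hne : ∀ {x t : ℂ}, ‖x‖ ≤ m → ‖t‖ < R → qPoch q (x * q * t) ≠ 0 := by
    intro x t hx ht
    refine qPoch_ne_zero_of_norm_lt_one hq0 hq1 ?_
    rw [norm_mul, norm_mul, norm_ofReal_q hq0]
    calc ‖x‖ * q * ‖t‖ ≤ m * q * ‖t‖ := by gcongr
      _ < m * q * R := by gcongr
      _ = 1 := by rw [hR]; field_simp
  have hHd : DifferentiableOn ℂ H (Metric.ball 0 R) := by
    refine ((dP q).div_const _).differentiableOn.mul (DifferentiableOn.div hg.differentiableOn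
      ((dP _).mul (dP _)).differentiableOn fun t ht => ?_)
    have ht : ‖t‖ < R := by simpa using ht
    exact mul_ne_zero (hne hA ht) (hne hB ht)
  obtain ⟨E, hE, hE1, hE2⟩ := exists_entire_of_analytic_coeff hq0 hq1 hR1 hHd
  refine ⟨E, hE, ?_, fun w hw => ?_⟩
  · intro κ hκ
    refine hE2 (fun j _ => ?_) κ (by rwa [hR, inv_inv])
    have : qPoch q ((q : ℂ) * ((q : ℂ) ^ (j + 1))⁻¹) = 0 :=
      qPoch_eq_zero hq0 hq1 j (by rw [pow_succ]; field_simp)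
    simp only [hH, this, zero_div, zero_mul]
  · rw [hE1 w hw, ← (summable_pow_mul hc hw).tsum_sub (summable_pow_mul hμ hw)]
    congr 1
    refine tsum_congr fun n => ?_
    rw [← mul_sub]
    congr 1
    by_cases hcase : qPoch q (A * (q : ℂ) ^ n) = 0 ∨ qPoch q (B * (q : ℂ) ^ n) = 0
    · have h1 : n = 0 ∧ (A = 1 ∨ B = 1) := by
        rcases hcase with h1 | h1
        · have := eq_one_of_qPoch_eq_zero hq0 hq1 (lt_of_le_of_lt (by gcongr) hqm) h1
          exact ⟨this.1, Or.inl this.2⟩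
        · have := eq_one_of_qPoch_eq_zero hq0 hq1 (lt_of_le_of_lt (by gcongr) hqm) h1
          exact ⟨this.1, Or.inr this.2⟩
      obtain ⟨hg0, hcμ⟩ := h0 h1.2
      rw [h1.1, hcμ, sub_self]
      simp only [hH, hg0, Pi.zero_apply, zero_div, mul_zero]
    · push Not at hcase
      obtain ⟨h1, h2⟩ := hcase
      have h3 := h n h1 h2
      have e : ∀ x : ℂ, qPoch q (x * (q : ℂ) ^ n) =
          (1 - x * (q : ℂ) ^ n) * qPoch q (x * q * (q : ℂ) ^ n) := by
        intro x; rw [qPoch_eq_mul hq0 hq1]; congr 2; ring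
      have h4 := qFin_ne_zero hq0 hq1 hqq n
      have h5 : qPoch q ((q : ℂ) * (q : ℂ) ^ n) ≠ 0 := by
        rw [qPoch_eq_qFin_mul hq0 hq1 q n] at hqq; exact right_ne_zero_of_mul hqq
      rw [← eq_div_iff (mul_ne_zero h1 h2), hN, e A, e B] at h3
      rw [e A] at h1
      rw [e B] at h2
      have h6 := left_ne_zero_of_mul h1
      have h7 := left_ne_zero_of_mul h2
      have h8 := right_ne_zero_of_mul h1
      have h9 := right_ne_zero_of_mul h2
      rw [h3]
      simp only [hH]
      rw [qPoch_eq_qFin_mul hq0 hq1 q n]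
      generalize qPoch q (A * q * (q : ℂ) ^ n) = vA at *
      generalize qPoch q (B * q * (q : ℂ) ^ n) = vB at *
      generalize qPoch q ((q : ℂ) * (q : ℂ) ^ n) = vQ at *
      generalize 1 - A * (q : ℂ) ^ n = uA at *
      generalize 1 - B * (q : ℂ) ^ n = uB at *
      field_simp

/-- The connection coefficient `(B, C / A; q)_∞ / (C, B / A; q)_∞`. -/
def connCoeff (q : ℝ) (A B C : ℂ) : ℂ :=
  qPoch q B * qPoch q (C / A) / (qPoch q C * qPoch q (B / A))

theorem norm_phi_coeff_le (hq0 : 0 < q) (hq1 : q < 1) (a b : ℂ) {c : ℂ} (hc : qPoch q c ≠ 0)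
    (n : ℕ) : ‖qFin q a n * qFin q b n / (qFin q c n * qFin q q n)‖ ≤
      qExpBound q ‖a‖ * qExpBound q ‖b‖ * ((qExpBound q ‖c‖ / ‖qPoch q c‖) * qInvBound q) := by
  rw [div_eq_mul_inv, mul_inv]
  exact norm_mul_le_of_le' (norm_mul_le_of_le' (norm_qFin_le hq0 hq1 a n)
    (norm_qFin_le hq0 hq1 b n)) (norm_mul_le_of_le' (norm_inv_qFin_le hq0 hq1 hc n)
    (norm_inv_qFin_q_le hq0 hq1 n))

/-- The `q`-analogue of the connection formula between `0` and `∞`, with its leading terms. -/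
theorem exists_phi_expansion (hq0 : 0 < q) (hq1 : q < 1) {A B C : ℂ} {m : ℝ} (hA0 : A ≠ 0)
    (hB0 : B ≠ 0) (hqm : q * m < 1) (hA : ‖A‖ ≤ m) (hB : ‖B‖ ≤ m) (hC : qPoch q C ≠ 0)
    (hBA : qPoch q (B / A) ≠ 0) (hAB : qPoch q (A / B) ≠ 0) :
    ∃ E : ℂ → ℂ, Differentiable ℂ E ∧ HasTailBound q m E ∧ ∀ w, ‖w‖ < 1 →
      connCoeff q A B C * qPoch q (A * w) + connCoeff q B A C * qPoch q (B * w) + E w =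
        qPoch q w * phiSeries q A B C w := by
  have hm : 0 < m := (norm_pos_iff.2 hA0).trans_le hA
  have hne : A ≠ B := by
    rintro rfl
    rw [div_self hA0, qPoch_one hq0 hq1] at hAB
    exact hAB rfl
  set r₁ := connCoeff q A B C with hr₁
  set r₂ := connCoeff q B A C with hr₂
  -- Up to `(At;q)_∞ (Bt;q)_∞ (q;q)_n`, this is the difference of coefficients at `t = q^n`, by
  -- `(A;q)_n = (A;q)_∞ / (At;q)_∞`. The connection coefficients are chosen to make it vanish at
  -- `1/A` and `1/B`.
  set N : ℂ → ℂ := fun t => qPoch q A * qPoch q B * qPoch q (C * t) / qPoch q C -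
    r₁ * (qPoch q A * qPoch q (B * t)) - r₂ * (qPoch q B * qPoch q (A * t)) with hN
  have dP : ∀ x : ℂ, Differentiable ℂ fun t => qPoch q (x * t) := fun x =>
    (differentiable_qPoch hq0 hq1).comp (by fun_prop)
  have hNd : Differentiable ℂ N :=
    ((((dP C).const_mul _).div_const _).sub (((dP B).const_mul _).const_mul _)).sub
      (((dP A).const_mul _).const_mul _)
  have hNA : N A⁻¹ = 0 := by
    simp only [hN, hr₁, connCoeff, ← div_eq_mul_inv, div_self hA0, qPoch_one hq0 hq1]
    field_simp
    ring
  have hNB : N B⁻¹ = 0 := by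
    simp only [hN, hr₂, connCoeff, ← div_eq_mul_inv, div_self hB0, qPoch_one hq0 hq1]
    field_simp
    ring
  have hex : ∃ g : ℂ → ℂ, Differentiable ℂ g ∧ (∀ t, N t = (1 - A * t) * (1 - B * t) * g t) ∧
      (N = 0 → g = 0) := by
    by_cases h0 : N = 0
    · exact ⟨0, differentiable_const _, fun t => by simp [h0], fun _ => rfl⟩
    obtain ⟨g, hg, hg'⟩ := exists_eq_sub_mul_sub_mul hNd (a := A⁻¹) (b := B⁻¹) hNA (by
      rw [dslope_of_ne _ (fun h => hne (inv_injective h).symm), slope_def_field, hNA, hNB]; simp)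
    refine ⟨fun t => g t / (A * B), hg.div_const _, fun t => ?_, fun h => absurd h h0⟩
    rw [hg']
    field_simp
    ring
  obtain ⟨g, hg, hNg, hg0⟩ := hex
  have hsA := fun w (hw : ‖w‖ < 1) => (hasSum_qBinomial hq0 hq1 A (z := w) hw)
  have hsB := fun w (hw : ‖w‖ < 1) => (hasSum_qBinomial hq0 hq1 B (z := w) hw)
  set μ : ℕ → ℂ := fun n =>
    r₁ * (qFin q A n / qFin q q n) + r₂ * (qFin q B n / qFin q q n) with hμ
  have tail := exists_tail hq0 hq1 hm hqm hA hB hg hNg (c := fun n =>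
    qFin q A n * qFin q B n / (qFin q C n * qFin q q n)) (μ := μ)
    (norm_phi_coeff_le hq0 hq1 A B hC)
    (fun n => norm_add_le_of_le (norm_mul_le_of_le' le_rfl (norm_qFin_div_le hq0 hq1 A n))
      (norm_mul_le_of_le' le_rfl (norm_qFin_div_le hq0 hq1 B n)))
  obtain ⟨E, hE, hE1, hE2⟩ := tail (by
    intro hcase
    -- If `A = 1` or `B = 1`, the series `₂φ₁` reduces to `1`: one connection coefficient is `1`,
    -- the other is `0`, and there is no remainder.
    have hzero : N = 0 ∧ r₁ + r₂ = 1 := by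
      rcases hcase with h | h
      · subst h
        have e1 : r₁ = 1 := by
          rw [hr₁, connCoeff]
          rw [div_one] at hBA ⊢
          rw [div_one]
          field_simp
        have e2 : r₂ = 0 := by rw [hr₂, connCoeff, qPoch_one hq0 hq1]; simp
        refine ⟨funext fun t => ?_, by rw [e1, e2, add_zero]⟩
        simp only [hN, e2, qPoch_one hq0 hq1]
        simp
      · subst h
        have e1 : r₂ = 1 := by
          rw [hr₂, connCoeff]
          rw [div_one] at hAB ⊢
          rw [div_one]
          field_simp
        have e2 : r₁ = 0 := by rw [hr₁, connCoeff, qPoch_one hq0 hq1]; simp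
        refine ⟨funext fun t => ?_, by rw [e1, e2, zero_add]⟩
        simp only [hN, e2, qPoch_one hq0 hq1]
        simp
    refine ⟨hg0 hzero.1, ?_⟩
    simp [hμ, qFin, hzero.2]) (by
    intro n h1 h2
    have hqn := qFin_ne_zero hq0 hq1 (qPoch_q_ne_zero hq0 hq1) n
    have hCn := qFin_ne_zero hq0 hq1 hC n
    have hC' : qPoch q (C * (q : ℂ) ^ n) ≠ 0 := by
      rw [qPoch_eq_qFin_mul hq0 hq1 C n] at hC; exact right_ne_zero_of_mul hC
    simp only [hN, hμ]
    rw [qPoch_eq_qFin_mul hq0 hq1 A n, qPoch_eq_qFin_mul hq0 hq1 B n,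
      qPoch_eq_qFin_mul hq0 hq1 C n]
    generalize qPoch q (A * (q : ℂ) ^ n) = vA at *
    generalize qPoch q (B * (q : ℂ) ^ n) = vB at *
    generalize qPoch q (C * (q : ℂ) ^ n) = vC at *
    field_simp
    ring)
  refine ⟨E, hE, hE1, fun w hw => ?_⟩
  have h1 : ∑' n, w ^ n * μ n =
      r₁ * (qPoch q (A * w) / qPoch q w) + r₂ * (qPoch q (B * w) / qPoch q w) := by
    rw [← ((hsA w hw).mul_left r₁).tsum_eq, ← ((hsB w hw).mul_left r₂).tsum_eq,
      ← ((hsA w hw).mul_left r₁).summable.tsum_add ((hsB w hw).mul_left r₂).summable]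
    refine tsum_congr fun n => ?_
    simp only [hμ]; ring
  have := qPoch_ne_zero_of_norm_lt_one hq0 hq1 hw
  rw [hE2 w hw, h1, phiSeries_eq]
  field_simp
  ring

/-! ### The confluent case -/

theorem differentiable_deriv_qPoch (hq0 : 0 < q) (hq1 : q < 1) :
    Differentiable ℂ (deriv (qPoch q)) := by
  have := (differentiable_qPoch hq0 hq1).differentiableOn (s := Set.univ)
  exact differentiableOn_univ.1 (this.deriv isOpen_univ)

theorem deriv_qPoch_one (hq0 : 0 < q) (hq1 : q < 1) : deriv (qPoch q) 1 = -qPoch q q := by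
  have h2 : HasDerivAt (fun z : ℂ => qPoch q ((q : ℂ) * z)) (deriv (qPoch q) (q * 1) * (q * 1)) 1 :=
    HasDerivAt.comp (h₂ := qPoch q) (h := fun z : ℂ => (q : ℂ) * z) 1
      (differentiable_qPoch hq0 hq1 _).hasDerivAt ((hasDerivAt_id (1 : ℂ)).const_mul _)
  have h1 : HasDerivAt (fun z : ℂ => (1 - z) * qPoch q (q * z))
      (-1 * qPoch q (q * 1) + (1 - 1) * (deriv (qPoch q) (q * 1) * (q * 1))) 1 :=
    ((hasDerivAt_id (1 : ℂ)).const_sub 1).mul h2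
  rw [← funext (qPoch_eq_mul hq0 hq1)] at h1
  simpa using h1.deriv

/-- The coefficients in the confluent connection formula: of `(A w; q)_∞`. -/
def confCoeff (q : ℝ) (A C : ℂ) : ℂ :=
  (-(qPoch q A * (C / A) * deriv (qPoch q) (C / A)) - A * deriv (qPoch q) A * qPoch q (C / A) +
      qPoch q A * qPoch q (C / A) -
      qPoch q A * qPoch q (C / A) * deriv (deriv (qPoch q)) 1 / qPoch q q) /
    (qPoch q C * qPoch q q)

/-- The coefficients in the confluent connection formula: of `A w (A w; q)_∞'`. -/
def confCoeff' (q : ℝ) (A C : ℂ) : ℂ := qPoch q A * qPoch q (C / A) / (qPoch q C * qPoch q q)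

/-- The `q`-binomial theorem differentiated termwise in `a`. -/
theorem hasSum_deriv_qBinomial (hq0 : 0 < q) (hq1 : q < 1) (a : ℂ) {z : ℂ} (hz : ‖z‖ < 1) :
    HasSum (fun n => z ^ n * (deriv (fun a => qFin q a n) a / qFin q q n))
      (z * deriv (qPoch q) (a * z) / qPoch q z) := by
  have hd := fun n => differentiable_qFin (q := q) n
  have h := Complex.hasSum_deriv_of_summable_norm (z := a)
    (F := fun n a => z ^ n * (qFin q a n / qFin q q n)) (U := Metric.ball 0 (‖a‖ + 1))
    ((summable_geometric_of_lt_one (norm_nonneg z) hz).mul_right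
      (qExpBound q (‖a‖ + 1) * qInvBound q))
    (fun n => (((hd n).div_const _).const_mul _).differentiableOn) Metric.isOpen_ball
    (fun n w hw => ?_) (by simp)
  · have e : (fun w : ℂ => ∑' n, z ^ n * (qFin q w n / qFin q q n)) =
        fun w => qPoch q (w * z) / qPoch q z :=
      funext fun w => (hasSum_qBinomial hq0 hq1 w hz).tsum_eq
    have e2 : (fun n => deriv (fun a => z ^ n * (qFin q a n / qFin q q n)) a) =
        fun n => z ^ n * (deriv (fun a => qFin q a n) a / qFin q q n) := by
      funext n
      rw [deriv_const_mul _ ((hd n _).div_const _), deriv_div_const]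
    have h1 : HasDerivAt (fun w : ℂ => qPoch q (w * z)) (deriv (qPoch q) (a * z) * (1 * z)) a :=
      HasDerivAt.comp (h₂ := qPoch q) (h := fun w : ℂ => w * z) a
        (differentiable_qPoch hq0 hq1 _).hasDerivAt ((hasDerivAt_id a).mul_const z)
    rw [e, e2, (h1.div_const (qPoch q z)).deriv, one_mul, mul_comm _ z] at h
    exact h
  · rw [norm_mul, norm_pow]
    gcongr
    refine (norm_qFin_div_le hq0 hq1 w n).trans ?_
    have := qInvBound_nonneg (q := q)
    gcongr
    exact qExpBound_mono hq1 (by simpa using (mem_ball_zero_iff.1 hw).le)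

theorem norm_deriv_qFin_le (hq0 : 0 < q) (hq1 : q < 1) (a : ℂ) (n : ℕ) :
    ‖deriv (fun a => qFin q a n) a‖ ≤ qExpBound q (‖a‖ + 1) := by
  have := Complex.norm_deriv_le_of_forall_mem_sphere_norm_le (c := a) (R := 1)
    (f := fun a => qFin q a n) (C := qExpBound q (‖a‖ + 1)) one_pos
    (differentiable_qFin n).diffContOnCl fun z hz => ?_
  · simpa using this
  · refine (norm_qFin_le hq0 hq1 z n).trans (qExpBound_mono hq1 ?_)
    have h1 : ‖z - a‖ = 1 := by simpa [dist_eq_norm] using hz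
    have := norm_le_norm_add_norm_sub' z a
    linarith

theorem deriv_qFin_mul (hq0 : 0 < q) (hq1 : q < 1) (a : ℂ) (n : ℕ) :
    deriv (fun a => qFin q a n) a * qPoch q (a * (q : ℂ) ^ n) =
      deriv (qPoch q) a - qFin q a n * ((q : ℂ) ^ n * deriv (qPoch q) (a * (q : ℂ) ^ n)) := by
  have h1 : HasDerivAt (fun w : ℂ => qPoch q (w * (q : ℂ) ^ n))
      (deriv (qPoch q) (a * (q : ℂ) ^ n) * (1 * (q : ℂ) ^ n)) a :=
    HasDerivAt.comp (h₂ := qPoch q) (h := fun w : ℂ => w * (q : ℂ) ^ n) a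
      (differentiable_qPoch hq0 hq1 _).hasDerivAt ((hasDerivAt_id a).mul_const _)
  have h2 := (differentiable_qFin (q := q) n a).hasDerivAt.mul h1
  have e : (fun a => qFin q a n) * (fun w : ℂ => qPoch q (w * (q : ℂ) ^ n)) = qPoch q :=
    funext fun w => (qPoch_eq_qFin_mul hq0 hq1 w n).symm
  rw [e] at h2
  rw [h2.deriv]
  ring

/-- When `A = B` the two leading terms merge, and the second is replaced by the derivative of
`(Aw;q)_∞` in `A`. The numerator must now have a double zero at `1/A`: its vanishing there dictates
`confCoeff'`, and the vanishing of its derivative dictates `confCoeff`. -/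
theorem exists_phi_expansion_conf (hq0 : 0 < q) (hq1 : q < 1) {A C : ℂ} {m : ℝ} (hA0 : A ≠ 0)
    (hqm : q * m < 1) (hA : ‖A‖ ≤ m) (hC : qPoch q C ≠ 0) :
    ∃ E : ℂ → ℂ, Differentiable ℂ E ∧ HasTailBound q m E ∧ ∀ w, ‖w‖ < 1 →
      confCoeff q A C * qPoch q (A * w) +
        confCoeff' q A C * (A * w * deriv (qPoch q) (A * w)) + E w =
        qPoch q w * phiSeries q A A C w := by
  have hm : 0 < m := (norm_pos_iff.2 hA0).trans_le hA
  have hqq := qPoch_q_ne_zero hq0 hq1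
  set r₁ := confCoeff q A C with hr₁
  set r₂ := confCoeff' q A C with hr₂
  set N : ℂ → ℂ := fun t => qPoch q A * qPoch q A * qPoch q (C * t) / qPoch q C -
    r₁ * (qPoch q A * qPoch q (A * t)) -
    A * r₂ * (deriv (qPoch q) A * qPoch q (A * t) -
      qPoch q A * (t * deriv (qPoch q) (A * t))) with hN
  have dP' := differentiable_qPoch hq0 hq1
  have dP'' := differentiable_deriv_qPoch hq0 hq1
  have dP : ∀ x : ℂ, Differentiable ℂ fun t => qPoch q (x * t) := fun x => dP'.comp (by fun_prop)
  have dD : Differentiable ℂ fun t => deriv (qPoch q) (A * t) := dP''.comp (by fun_prop)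
  have hNd : Differentiable ℂ N :=
    ((((dP C).const_mul _).div_const _).sub (((dP A).const_mul _).const_mul _)).sub
      ((((dP A).const_mul _).sub ((differentiable_id.mul dD).const_mul _)).const_mul _)
  have e1 : A * A⁻¹ = 1 := mul_inv_cancel₀ hA0
  have hNA : N A⁻¹ = 0 := by
    simp only [hN, hr₂, confCoeff', e1, qPoch_one hq0 hq1, deriv_qPoch_one hq0 hq1,
      ← div_eq_mul_inv]
    field_simp
    ring
  have hNA' : deriv N A⁻¹ = 0 := by
    have hP : ∀ x : ℂ, HasDerivAt (fun t => qPoch q (x * t))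
        (deriv (qPoch q) (x * A⁻¹) * (x * 1)) A⁻¹ := fun x =>
      HasDerivAt.comp (h₂ := qPoch q) (h := fun t : ℂ => x * t) A⁻¹ (dP' _).hasDerivAt
        ((hasDerivAt_id (A⁻¹ : ℂ)).const_mul x)
    have hD : HasDerivAt (fun t => deriv (qPoch q) (A * t))
        (deriv (deriv (qPoch q)) (A * A⁻¹) * (A * 1)) A⁻¹ :=
      HasDerivAt.comp (h₂ := deriv (qPoch q)) (h := fun t : ℂ => A * t) A⁻¹ (dP'' _).hasDerivAt
        ((hasDerivAt_id (A⁻¹ : ℂ)).const_mul A)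
    have hder := ((((hP C).const_mul (qPoch q A * qPoch q A)).div_const (qPoch q C)).sub
      (((hP A).const_mul (qPoch q A)).const_mul r₁)).sub
      ((((hP A).const_mul (deriv (qPoch q) A)).sub
        (((hasDerivAt_id (A⁻¹ : ℂ)).mul hD).const_mul (qPoch q A))).const_mul (A * r₂))
    have := hder.deriv
    refine Eq.trans this ?_
    simp only [hr₁, hr₂, confCoeff, confCoeff', e1, deriv_qPoch_one hq0 hq1,
      ← div_eq_mul_inv, id]
    field_simp
    ring
  have hex : ∃ g : ℂ → ℂ, Differentiable ℂ g ∧ (∀ t, N t = (1 - A * t) * (1 - A * t) * g t) ∧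
      (N = 0 → g = 0) := by
    by_cases h0 : N = 0
    · exact ⟨0, differentiable_const _, fun t => by simp [h0], fun _ => rfl⟩
    obtain ⟨g, hg, hg'⟩ := exists_eq_sub_mul_sub_mul hNd (a := A⁻¹) (b := A⁻¹) hNA (by
      rw [dslope_same, hNA'])
    refine ⟨fun t => g t / (A * A), hg.div_const _, fun t => ?_, fun h => absurd h h0⟩
    rw [hg']
    field_simp
    ring
  obtain ⟨g, hg, hNg, hg0⟩ := hex
  have hsA := fun w (hw : ‖w‖ < 1) => (hasSum_qBinomial hq0 hq1 A (z := w) hw)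
  have hsB := fun w (hw : ‖w‖ < 1) => (hasSum_deriv_qBinomial hq0 hq1 A (z := w) hw)
  set μ : ℕ → ℂ := fun n => r₁ * (qFin q A n / qFin q q n) +
    A * r₂ * (deriv (fun a => qFin q a n) A / qFin q q n) with hμ
  have tail := exists_tail hq0 hq1 hm hqm hA hA hg hNg (c := fun n =>
    qFin q A n * qFin q A n / (qFin q C n * qFin q q n)) (μ := μ)
    (norm_phi_coeff_le hq0 hq1 A A hC)
    (fun n => norm_add_le_of_le (norm_mul_le_of_le' le_rfl (norm_qFin_div_le hq0 hq1 A n))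
      (norm_mul_le_of_le' le_rfl (by
        rw [div_eq_mul_inv]
        exact norm_mul_le_of_le' (norm_deriv_qFin_le hq0 hq1 A n)
          (norm_inv_qFin_q_le hq0 hq1 n))))
  obtain ⟨E, hE, hE1, hE2⟩ := tail (by
    intro hcase
    have hA1 : A = 1 := or_self_iff.1 hcase
    subst hA1
    have e1 : r₁ = 1 := by
      rw [hr₁, confCoeff, deriv_qPoch_one hq0 hq1, qPoch_one hq0 hq1, div_one]
      field_simp
      ring
    have e2 : r₂ = 0 := by rw [hr₂, confCoeff', qPoch_one hq0 hq1]; simp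
    refine ⟨hg0 (funext fun t => ?_), ?_⟩
    · simp only [hN, e2, qPoch_one hq0 hq1]
      simp
    · simp [hμ, qFin, e1, e2]) (by
    intro n h1 _
    have hqn := qFin_ne_zero hq0 hq1 (qPoch_q_ne_zero hq0 hq1) n
    have hCn := qFin_ne_zero hq0 hq1 hC n
    have hC' : qPoch q (C * (q : ℂ) ^ n) ≠ 0 := by
      rw [qPoch_eq_qFin_mul hq0 hq1 C n] at hC; exact right_ne_zero_of_mul hC
    have hder := deriv_qFin_mul hq0 hq1 A n
    rw [← eq_div_iff h1] at hder
    simp only [hN, hμ]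
    rw [hder, qPoch_eq_qFin_mul hq0 hq1 A n, qPoch_eq_qFin_mul hq0 hq1 C n]
    generalize qPoch q (A * (q : ℂ) ^ n) = vA at *
    generalize qPoch q (C * (q : ℂ) ^ n) = vC at *
    generalize deriv (qPoch q) (A * (q : ℂ) ^ n) = dA at *
    generalize deriv (qPoch q) A = dA' at *
    field_simp
    ring)
  refine ⟨E, hE, hE1, fun w hw => ?_⟩
  have h1 : ∑' n, w ^ n * μ n = r₁ * (qPoch q (A * w) / qPoch q w) +
      A * r₂ * (w * deriv (qPoch q) (A * w) / qPoch q w) := by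
    rw [← ((hsA w hw).mul_left r₁).tsum_eq, ← ((hsB w hw).mul_left (A * r₂)).tsum_eq,
      ← ((hsA w hw).mul_left r₁).summable.tsum_add ((hsB w hw).mul_left (A * r₂)).summable]
    refine tsum_congr fun n => ?_
    simp only [hμ]; ring
  have := qPoch_ne_zero_of_norm_lt_one hq0 hq1 hw
  rw [hE2 w hw, h1, phiSeries_eq]
  field_simp
  ring

/-! ### Families of functions of at most exponential growth -/

/-- `f M` grows on `K` at most like `L ^ M`. -/
def GrowthOn (K : Set ℂ) (L : ℝ) (f : ℕ → ℂ → ℂ) : Prop :=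
  ∃ C : ℝ, 0 ≤ C ∧ ∀ M, ∀ s ∈ K, ‖f M s‖ ≤ C * L ^ M

theorem GrowthOn.mono {K : Set ℂ} {L L' : ℝ} {f : ℕ → ℂ → ℂ} (h : GrowthOn K L f) (hL : 0 ≤ L)
    (hLL : L ≤ L') : GrowthOn K L' f := by
  obtain ⟨C, hC, h⟩ := h
  exact ⟨C, hC, fun M s hs => (h M s hs).trans (by gcongr)⟩

theorem GrowthOn.add {K : Set ℂ} {L : ℝ} {f g : ℕ → ℂ → ℂ} (hf : GrowthOn K L f)
    (hg : GrowthOn K L g) : GrowthOn K L fun M s => f M s + g M s := by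
  obtain ⟨C, hC, hf⟩ := hf
  obtain ⟨D, hD, hg⟩ := hg
  exact ⟨C + D, add_nonneg hC hD, fun M s hs => by
    rw [add_mul]; exact norm_add_le_of_le (hf M s hs) (hg M s hs)⟩

theorem GrowthOn.neg {K : Set ℂ} {L : ℝ} {f : ℕ → ℂ → ℂ} (hf : GrowthOn K L f) :
    GrowthOn K L fun M s => -f M s := by
  obtain ⟨C, hC, hf⟩ := hf
  exact ⟨C, hC, fun M s hs => by rw [norm_neg]; exact hf M s hs⟩

theorem GrowthOn.mul {K : Set ℂ} {L L' : ℝ} {f g : ℕ → ℂ → ℂ} (hf : GrowthOn K L f)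
    (hg : GrowthOn K L' g) : GrowthOn K (L * L') fun M s => f M s * g M s := by
  obtain ⟨C, hC, hf⟩ := hf
  obtain ⟨D, hD, hg⟩ := hg
  refine ⟨C * D, mul_nonneg hC hD, fun M s hs => ?_⟩
  rw [mul_pow, mul_mul_mul_comm]
  exact norm_mul_le_of_le' (hf M s hs) (hg M s hs)

theorem growthOn_of_continuousOn {K : Set ℂ} (hK : IsCompact K) {f : ℂ → ℂ}
    (hf : ContinuousOn f K) : GrowthOn K 1 fun _ => f := by
  obtain ⟨C, hC⟩ := hK.exists_bound_of_continuousOn hf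
  exact ⟨|C|, abs_nonneg C, fun M s hs => by simpa using (hC s hs).trans (le_abs_self C)⟩

theorem growthOn_const (K : Set ℂ) (c : ℂ) : GrowthOn K 1 fun _ _ => c :=
  ⟨‖c‖, norm_nonneg c, fun _ _ _ => by simp⟩

theorem growthOn_pow (K : Set ℂ) (c : ℂ) : GrowthOn K ‖c‖ fun M _ => c ^ M :=
  ⟨1, zero_le_one, fun _ _ _ => by simp⟩

theorem GrowthOn.const_mul {K : Set ℂ} {L : ℝ} {f : ℕ → ℂ → ℂ} (hf : GrowthOn K L f) (c : ℂ) :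
    GrowthOn K L fun M s => c * f M s := by
  simpa using (growthOn_const K c).mul hf

/-- Bernoulli's inequality. It absorbs the linear factor `M` of the confluent case into any rate
greater than `1`. -/
theorem growthOn_natCast (K : Set ℂ) {L : ℝ} (hL : 1 < L) : GrowthOn K L fun M _ => (M : ℂ) := by
  refine ⟨(L - 1)⁻¹, inv_nonneg.2 (by linarith), fun M s _ => ?_⟩
  rw [Complex.norm_natCast, ← div_eq_inv_mul, le_div_iff₀ (by linarith)]
  have := one_add_mul_le_pow (a := L - 1) (by linarith) M
  rw [add_sub_cancel] at this
  linarith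

theorem growthOn_inv_qPoch (hq0 : 0 < q) (hq1 : q < 1) {K : Set ℂ} (hK : IsCompact K) {f : ℂ → ℂ}
    (hf : ContinuousOn f K) (h0 : ∀ s ∈ K, qPoch q (f s) ≠ 0) (j : ℕ) :
    GrowthOn K 1 fun M s => (qPoch q ((q : ℂ) ^ (M + j) * f s))⁻¹ := by
  have hc : ContinuousOn (fun s => (qPoch q (f s))⁻¹) K :=
    ((continuous_qPoch hq0 hq1).comp_continuousOn hf).inv₀ h0
  obtain ⟨C, hC⟩ := hK.exists_bound_of_continuousOn hc
  obtain ⟨D, hD⟩ := hK.exists_bound_of_continuousOn hf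
  refine ⟨qExpBound q D * |C|, mul_nonneg (qExpBound_pos _).le (abs_nonneg C), fun M s hs => ?_⟩
  have h1 := qPoch_eq_qFin_mul hq0 hq1 (f s) (M + j)
  have h2 := h0 s hs
  have e : (qPoch q ((q : ℂ) ^ (M + j) * f s))⁻¹ = qFin q (f s) (M + j) * (qPoch q (f s))⁻¹ := by
    rw [mul_comm _ (f s)]
    rw [h1] at h2 ⊢
    have := left_ne_zero_of_mul h2
    have := right_ne_zero_of_mul h2
    field_simp
  beta_reduce
  rw [e, one_pow, mul_one]
  exact norm_mul_le_of_le' ((norm_qFin_le hq0 hq1 _ _).trans (qExpBound_mono hq1 (hD s hs)))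
    ((hC s hs).trans (le_abs_self C))

theorem growthOn_qPoch_sub_one (hq0 : 0 < q) (hq1 : q < 1) {K : Set ℂ} (hK : IsCompact K)
    {f : ℂ → ℂ} (hf : ContinuousOn f K) (j : ℕ) :
    GrowthOn K q fun M s => qPoch q ((q : ℂ) ^ (M + j) * f s) - 1 := by
  obtain ⟨D, hD⟩ := hK.exists_bound_of_continuousOn hf
  have h1q : 0 < 1 - q := by linarith
  refine ⟨|D| / (1 - q) * qExpBound q |D|, by have := (qExpBound_pos (q := q) |D|).le; positivity,
    fun M s hs => ?_⟩
  refine (norm_qPoch_sub_one_le hq0 hq1 _).trans ?_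
  set u : ℝ := ‖(q : ℂ) ^ (M + j) * f s‖ with hu
  have hu1 : u ≤ q ^ M * |D| := by
    rw [hu, norm_mul, norm_pow, norm_ofReal_q hq0]
    exact mul_le_mul (pow_le_pow_of_le_one hq0.le hq1.le (Nat.le_add_right _ _))
      ((hD s hs).trans (le_abs_self D)) (norm_nonneg _) (by positivity)
  have hu2 : u ≤ |D| := hu1.trans (mul_le_of_le_one_left (abs_nonneg D)
    (pow_le_one₀ hq0.le hq1.le))
  have h2 : qExpBound q u - 1 ≤ u / (1 - q) * qExpBound q u := by
    unfold qExpBound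
    have h3 := Real.add_one_le_exp (-(u / (1 - q)))
    rw [Real.exp_neg] at h3
    have h4 := Real.exp_pos (u / (1 - q))
    have h5 := mul_le_mul_of_nonneg_right h3 h4.le
    rw [inv_mul_cancel₀ h4.ne'] at h5
    linarith
  calc qExpBound q u - 1 ≤ u / (1 - q) * qExpBound q u := h2
    _ ≤ (q ^ M * |D|) / (1 - q) * qExpBound q |D| := by
      have := (qExpBound_pos (q := q) u).le
      have := qExpBound_mono hq1 hu2
      gcongr
    _ = _ := by ring

theorem growthOn_inv_qPoch_sub_one (hq0 : 0 < q) (hq1 : q < 1) {K : Set ℂ} (hK : IsCompact K)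
    {f : ℂ → ℂ} (hf : ContinuousOn f K) (h0 : ∀ s ∈ K, qPoch q (f s) ≠ 0) (j : ℕ) :
    GrowthOn K q fun M s => (qPoch q ((q : ℂ) ^ (M + j) * f s))⁻¹ - 1 := by
  have h := ((growthOn_qPoch_sub_one hq0 hq1 hK hf j).mul
    (growthOn_inv_qPoch hq0 hq1 hK hf h0 j)).neg
  rw [mul_one] at h
  obtain ⟨C, hC, h⟩ := h
  refine ⟨C, hC, fun M s hs => ?_⟩
  have h1 : qPoch q ((q : ℂ) ^ (M + j) * f s) ≠ 0 := by
    have h2 := h0 s hs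
    rw [qPoch_eq_qFin_mul hq0 hq1 (f s) (M + j), mul_comm (f s)] at h2
    exact right_ne_zero_of_mul h2
  convert h M s hs using 2
  field_simp
  ring

/-! ### Determinants of asymptotically two-dimensional pairs -/

/-- The leading functions may grow like `L^M`, but by `hW` their antisymmetric product does not
depend on `M`. A leading function against an error costs `(Lη)^M`; two errors cost no more, because
`η ≤ L`. -/
theorem growthOn_wronskian {K : Set ℂ} {L η : ℝ} (hL : 1 ≤ L) (hη : 0 ≤ η) (hLη : L * η < 1)
    {B₀ B₁ e₁ e₂ ε₀ ε₁ : ℕ → ℂ → ℂ} {a₀ a₁ b₀ b₁ : ℂ} {W : ℂ → ℂ → ℂ}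
    (h0 : ∀ M, ∀ s ∈ K, B₀ M s = a₀ * e₁ M s + b₀ * e₂ M s + ε₀ M s)
    (h1 : ∀ M, ∀ s ∈ K, B₁ M s = a₁ * e₁ M s + b₁ * e₂ M s + ε₁ M s)
    (he₁ : GrowthOn K L e₁) (he₂ : GrowthOn K L e₂) (hε₀ : GrowthOn K η ε₀)
    (hε₁ : GrowthOn K η ε₁)
    (hW : ∀ M, ∀ s ∈ K, ∀ t ∈ K, e₁ M s * e₂ M t - e₂ M s * e₁ M t = W s t) :
    ∃ C : ℝ, ∀ M, ∀ s ∈ K, ∀ t ∈ K,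
      ‖B₀ M s * B₁ M t - B₁ M s * B₀ M t - (a₀ * b₁ - b₀ * a₁) * W s t‖ ≤ C * (L * η) ^ M := by
  obtain ⟨C₀, hC₀, hm₀⟩ := (he₁.const_mul a₀).add (he₂.const_mul b₀)
  obtain ⟨C₁, hC₁, hm₁⟩ := (he₁.const_mul a₁).add (he₂.const_mul b₁)
  obtain ⟨D₀, hD₀, hε₀⟩ := hε₀
  obtain ⟨D₁, hD₁, hε₁⟩ := hε₁
  have hηL : η ^ 1 ≤ L := by nlinarith
  refine ⟨C₀ * D₁ + D₀ * C₁ + D₀ * D₁ + (C₁ * D₀ + D₁ * C₀ + D₁ * D₀), fun M s hs t ht => ?_⟩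
  rw [h0 M s hs, h1 M t ht, h1 M s hs, h0 M t ht, ← hW M s hs t ht]
  have hηM : η ^ M ≤ L ^ M := by
    rw [pow_one] at hηL
    exact pow_le_pow_left₀ hη hηL M
  have p1 : ∀ {x y : ℂ} {C D : ℝ}, 0 ≤ D → ‖x‖ ≤ C * L ^ M → ‖y‖ ≤ D * η ^ M →
      ‖x * y‖ ≤ C * D * (L * η) ^ M := by
    intro x y C D _ hx hy
    refine (norm_mul_le_of_le' hx hy).trans (le_of_eq ?_)
    rw [mul_pow]; ring
  have p2 : ∀ {x y : ℂ} {C D : ℝ}, 0 ≤ D → ‖x‖ ≤ D * η ^ M → ‖y‖ ≤ C * L ^ M →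
      ‖x * y‖ ≤ D * C * (L * η) ^ M := by
    intro x y C D hD hx hy
    rw [mul_comm x, mul_comm D]
    exact p1 hD hy hx
  have p3 : ∀ {x y : ℂ} {C D : ℝ}, 0 ≤ D → 0 ≤ C → ‖x‖ ≤ C * η ^ M → ‖y‖ ≤ D * η ^ M →
      ‖x * y‖ ≤ C * D * (L * η) ^ M := by
    intro x y C D hD hC hx hy
    exact p1 hD (hx.trans (by gcongr)) hy
  set u₀ := a₀ * e₁ M s + b₀ * e₂ M s
  set u₁ := a₁ * e₁ M s + b₁ * e₂ M s
  set v₀ := a₀ * e₁ M t + b₀ * e₂ M t with hv₀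
  set v₁ := a₁ * e₁ M t + b₁ * e₂ M t with hv₁
  have e : (u₀ + ε₀ M s) * (v₁ + ε₁ M t) - (u₁ + ε₁ M s) * (v₀ + ε₀ M t) -
      (a₀ * b₁ - b₀ * a₁) * (e₁ M s * e₂ M t - e₂ M s * e₁ M t) =
      (u₀ * ε₁ M t + ε₀ M s * v₁ + ε₀ M s * ε₁ M t) -
      (u₁ * ε₀ M t + ε₁ M s * v₀ + ε₁ M s * ε₀ M t) := by
    simp only [u₀, u₁, v₀, v₁]; ring
  have ec : (C₀ * D₁ + D₀ * C₁ + D₀ * D₁ + (C₁ * D₀ + D₁ * C₀ + D₁ * D₀)) * (L * η) ^ M =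
      (C₀ * D₁ * (L * η) ^ M + D₀ * C₁ * (L * η) ^ M + D₀ * D₁ * (L * η) ^ M) +
      (C₁ * D₀ * (L * η) ^ M + D₁ * C₀ * (L * η) ^ M + D₁ * D₀ * (L * η) ^ M) := by ring
  rw [e, ec]
  refine norm_sub_le_of_le (norm_add_le_of_le (norm_add_le_of_le ?_ ?_) ?_)
    (norm_add_le_of_le (norm_add_le_of_le ?_ ?_) ?_)
  · exact p1 hD₁ (hm₀ M s hs) (hε₁ M t ht)
  · exact p2 hD₀ (hε₀ M s hs) (hm₁ M t ht)
  · exact p3 hD₁ hD₀ (hε₀ M s hs) (hε₁ M t ht)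
  · exact p1 hD₀ (hm₁ M s hs) (hε₀ M t ht)
  · exact p2 hD₁ (hε₁ M s hs) (hm₀ M t ht)
  · exact p3 hD₀ hD₁ (hε₁ M s hs) (hε₀ M t ht)

/-! ### The scaled functions -/

/-- The factor that normalizes the functions in the kernel at `q ^ M s`. -/
def scaleFactor (q g : ℝ) (M : ℕ) (s : ℂ) : ℂ := (-((g : ℂ) * s)) ^ M * (q : ℂ) ^ (M * (M - 1) / 2)

/-- The function `x ↦ (-x) ^ j Ψ(q / (α x))` at `x = q ^ M s`, normalized. -/
def scaledFun (q g : ℝ) (α : ℂ) (Ψ : ℂ → ℂ) (j M : ℕ) (s : ℂ) : ℂ :=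
  scaleFactor q g M s * (-((q : ℂ) ^ M * s)) ^ j * Ψ ((q : ℂ) / (α * s) * ((q : ℂ) ^ M)⁻¹)

/-- The scale factor is inverse to the quasi-period factor of `θ(ys)` under a shift by `q^M`, up to
`(g/y)^M`. The extra `(-q^M s)^j` accounts for the shift by `M + j`: for `j = 1` the triangular
exponent grows by exactly `M`. -/
theorem scaleFactor_mul (hq0 : 0 < q) {g : ℝ} {s y : ℂ} (hs : s ≠ 0) (hy : y ≠ 0) {j : ℕ}
    (hj : j ≤ 1) (M : ℕ) :
    scaleFactor q g M s * (-((q : ℂ) ^ M * s)) ^ j *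
      ((-1) ^ (M + j) * ((y * s)⁻¹) ^ (M + j) *
        ((q : ℂ) ^ ((M + j) * (M + j - 1) / 2))⁻¹) = (g / y) ^ M / y ^ j := by
  have hq := ofReal_q_ne_zero hq0
  have h1 : ((-1 : ℂ) ^ M) * (-1) ^ M = 1 := by rw [← mul_pow]; simp
  have key : scaleFactor q g M s * ((-1) ^ M * ((y * s)⁻¹) ^ M *
        ((q : ℂ) ^ (M * (M - 1) / 2))⁻¹) = (g / y) ^ M := by
    rw [scaleFactor, neg_eq_neg_one_mul, mul_pow, div_pow, mul_pow, inv_pow, mul_pow]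
    field_simp
    linear_combination (g : ℂ) ^ M * h1
  interval_cases j
  · simpa using key
  · have e : (M + 1) * (M + 1 - 1) / 2 = M * (M - 1) / 2 + M := by
      have := Nat.triangle_succ M
      simpa using this
    rw [e, pow_one, pow_one, pow_succ, pow_succ, pow_add, ← key]
    field_simp

theorem arg_eq (hq0 : 0 < q) {α s y : ℂ} (hα : α ≠ 0) (hs : s ≠ 0) (hy : y ≠ 0) (j M : ℕ) :
    α / ((q : ℂ) ^ j * y) * ((q : ℂ) / (α * s) * ((q : ℂ) ^ M)⁻¹) =
      (q : ℂ) / ((q : ℂ) ^ (M + j) * (y * s)) := by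
  have hq := ofReal_q_ne_zero hq0
  rw [pow_add]
  field_simp

theorem qPoch_pow_mul_ne_zero (hq0 : 0 < q) (hq1 : q < 1) {z : ℂ} (h : qTheta q z ≠ 0) (N : ℕ) :
    qPoch q ((q : ℂ) ^ N * z) ≠ 0 := by
  have h2 := left_ne_zero_of_mul h
  rw [qPoch_eq_qFin_mul hq0 hq1 z N, mul_comm z] at h2
  exact right_ne_zero_of_mul h2

/-- The argument on the left is `q/z` with `z = q^(M+j) y s`, and `(q/z;q)_∞ = θ(z)/(z;q)_∞`. Thus
each leading term is a theta function up to a factor tending to `1`. -/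
theorem scaleFactor_mul_qPoch (hq0 : 0 < q) (hq1 : q < 1) {g : ℝ} {α s y : ℂ} (hα : α ≠ 0)
    (hs : s ≠ 0) (hy : y ≠ 0) (hθ : qTheta q (y * s) ≠ 0) {j : ℕ} (hj : j ≤ 1) (M : ℕ) :
    scaleFactor q g M s * (-((q : ℂ) ^ M * s)) ^ j *
      qPoch q (α / ((q : ℂ) ^ j * y) * ((q : ℂ) / (α * s) * ((q : ℂ) ^ M)⁻¹)) =
      (g / y) ^ M / y ^ j * qTheta q (y * s) * (qPoch q ((q : ℂ) ^ (M + j) * (y * s)))⁻¹ := by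
  have h1 := qPoch_pow_mul_ne_zero hq0 hq1 hθ (M + j)
  have h2 := qTheta_pow_mul hq0 hq1 (mul_ne_zero hy hs) (M + j)
  rw [qTheta] at h2
  rw [arg_eq hq0 hα hs hy, ← scaleFactor_mul hq0 hs hy hj M, mul_assoc _ _ (qTheta q (y * s)),
    ← h2]
  generalize qPoch q ((q : ℂ) ^ (M + j) * (y * s)) = u at *
  field_simp

/-- The tail bound compares `E(w)` with `(w;q)_∞`, whose size under the scaling is given by
`scaleFactor_mul_qPoch` with `y = α`; the power `(-q^M s)^j` adds `q^(jM)`. -/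
theorem growthOn_scaled_tail (hq0 : 0 < q) (hq1 : q < 1) {g : ℝ} (hg : 0 < g) {α : ℂ}
    (hα : α ≠ 0) {K : Set ℂ} (hK : IsCompact K) (hK0 : ∀ s ∈ K, s ≠ 0)
    (hKα : ∀ s ∈ K, qTheta q (α * s) ≠ 0) {E : ℂ → ℂ} {m κ : ℝ} (hE : HasTailBound q m E)
    (hκ0 : 0 ≤ κ) (hκ : q * m < κ) (hκ1 : κ ≤ 1) (j : ℕ) :
    GrowthOn K (κ * (q ^ j * (g / ‖α‖))) fun M s => scaledFun q g α E j M s := by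
  have hq := ofReal_q_ne_zero hq0
  have hcont : ContinuousOn (fun s : ℂ => (q : ℂ) / (α * s)) K := fun s hs =>
    (continuousAt_const.div (continuousAt_const.mul continuousAt_id)
      (mul_ne_zero hα (hK0 s hs))).continuousWithinAt
  obtain ⟨C, hC, hb⟩ := hE κ hκ hκ1 _ (hK.image_of_continuousOn hcont) (by
    rintro _ ⟨s, hs, rfl⟩
    have h0 := hK0 s hs
    have e : (q : ℂ) / ((q : ℂ) / (α * s)) = α * s := by field_simp
    refine ⟨by positivity, ?_⟩
    rw [qTheta, e, mul_comm]
    exact hKα s hs)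
  have hαs : ContinuousOn (fun s : ℂ => α * s) K := by fun_prop
  have hθ : ContinuousOn (fun s : ℂ => qTheta q (α * s)) K := fun s hs =>
    (ContinuousAt.comp (f := fun s : ℂ => α * s)
      (differentiableAt_qTheta hq0 hq1 (mul_ne_zero hα (hK0 s hs))).continuousAt
      (by fun_prop)).continuousWithinAt
  have hid : ContinuousOn (fun s : ℂ => (-s) ^ j) K := by fun_prop
  have G := (((growthOn_of_continuousOn hK hθ).mul (growthOn_inv_qPoch hq0 hq1 hK hαs
    (fun s hs => left_ne_zero_of_mul (hKα s hs)) 0)).mul (growthOn_of_continuousOn hK hid)).mul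
    ((growthOn_pow K ((g : ℂ) / α)).mul (growthOn_pow K ((q : ℂ) ^ j)))
  obtain ⟨D, hD, G⟩ := G
  refine ⟨C * D, mul_nonneg hC hD, fun M s hs => ?_⟩
  have hs0 := hK0 s hs
  have h1 := scaleFactor_mul_qPoch (g := g) hq0 hq1 hα hs0 hα (hKα s hs) (j := 0) zero_le_one M
  have h2 := hb _ ⟨s, hs, rfl⟩ M
  have e1 : α / ((q : ℂ) ^ 0 * α) = 1 := by field_simp
  rw [e1, one_mul, pow_zero, mul_one, pow_zero, div_one] at h1
  have h3 := G M s hs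
  simp only [one_mul, norm_div, norm_pow, norm_ofReal_q hq0, Complex.norm_real, Real.norm_eq_abs,
    abs_of_pos hg] at h3
  have e2 : ‖scaleFactor q g M s * (-((q : ℂ) ^ M * s)) ^ j‖ *
      ‖qPoch q ((q : ℂ) / (α * s) * ((q : ℂ) ^ M)⁻¹)‖ ≤ D * (g / ‖α‖ * q ^ j) ^ M := by
    refine le_trans (le_of_eq ?_) h3
    rw [← norm_mul, mul_right_comm, h1]
    congr 1
    rw [neg_mul_eq_mul_neg, mul_pow ((q : ℂ) ^ M), ← pow_mul, ← pow_mul, mul_comm M j]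
    ring
  beta_reduce
  unfold scaledFun
  rw [norm_mul]
  calc _ ≤ ‖scaleFactor q g M s * (-((q : ℂ) ^ M * s)) ^ j‖ *
        (C * κ ^ M * ‖qPoch q ((q : ℂ) / (α * s) * ((q : ℂ) ^ M)⁻¹)‖) := by gcongr
    _ = C * κ ^ M * (‖scaleFactor q g M s * (-((q : ℂ) ^ M * s)) ^ j‖ *
        ‖qPoch q ((q : ℂ) / (α * s) * ((q : ℂ) ^ M)⁻¹)‖) := by ring
    _ ≤ C * κ ^ M * (D * (g / ‖α‖ * q ^ j) ^ M) := by gcongr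
    _ = _ := by rw [mul_comm (g / ‖α‖), mul_pow κ]; ring

/-! ### Asymptotics of the scaled functions -/

theorem continuousOn_qTheta_mul (hq0 : 0 < q) (hq1 : q < 1) {y : ℂ} (hy : y ≠ 0) {K : Set ℂ}
    (hK0 : ∀ s ∈ K, s ≠ 0) : ContinuousOn (fun s : ℂ => qTheta q (y * s)) K := fun s hs =>
  (ContinuousAt.comp (f := fun s : ℂ => y * s)
    (differentiableAt_qTheta hq0 hq1 (mul_ne_zero hy (hK0 s hs))).continuousAt
    (by fun_prop)).continuousWithinAt

/-- The hypotheses on the scale `g`, the parameter `α` and the bound `l` under which the tail of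
the expansion is negligible for the scaled functions. -/
structure ScaleData (q g l : ℝ) (α : ℂ) : Prop where
  hg : 0 < g
  hα : α ≠ 0
  hl : 1 ≤ l
  hql : q * l * l < 1
  hαl : ‖α‖ * l / g < 1

theorem ScaleData.bound_lt (hq0 : 0 < q) (hq1 : q < 1) {g l : ℝ} {α : ℂ}
    (h : ScaleData q g l α) {j : ℕ} (hj : j ≤ 1) : q * (‖α‖ / (q ^ j * g) * l) < 1 := by
  have h1 := h.hαl
  have hg := h.hg
  interval_cases j
  · rw [pow_zero, one_mul, div_mul_eq_mul_div]
    have : 0 ≤ ‖α‖ * l / g := by have := h.hl; positivity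
    nlinarith
  · convert h1 using 1
    field_simp

theorem ScaleData.norm_le (hq0 : 0 < q) {g l : ℝ} {α y : ℂ} (h : ScaleData q g l α)
    (hy : y ≠ 0) (hyl : ‖(g : ℂ) / y‖ ≤ l) (j : ℕ) :
    ‖α / ((q : ℂ) ^ j * y)‖ ≤ ‖α‖ / (q ^ j * g) * l := by
  have hg := h.hg
  have hy' := norm_pos_iff.2 hy
  rw [norm_div, Complex.norm_real, Real.norm_eq_abs, abs_of_pos hg] at hyl
  rw [norm_div, norm_mul, norm_pow, norm_ofReal_q hq0]
  calc ‖α‖ / (q ^ j * ‖y‖) = ‖α‖ / (q ^ j * g) * (g / ‖y‖) := by field_simp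
    _ ≤ _ := by gcongr

theorem ScaleData.growthOn_tail (hq0 : 0 < q) (hq1 : q < 1) {g l : ℝ} {α : ℂ}
    (h : ScaleData q g l α) {j : ℕ} (hj : j ≤ 1) {η : ℝ} (hη : q * l < η) {K : Set ℂ}
    (hK : IsCompact K) (hK0 : ∀ s ∈ K, s ≠ 0) (hKα : ∀ s ∈ K, qTheta q (α * s) ≠ 0) {E : ℂ → ℂ}
    (hE : HasTailBound q (‖α‖ / (q ^ j * g) * l) E) :
    GrowthOn K η fun M s => scaledFun q g α E j M s := by
  have hg := h.hg
  have hα := norm_pos_iff.2 h.hα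
  have hl := h.hl
  set μ := ‖α‖ / (q ^ j * g) with hμ
  have hμ0 : 0 < μ := by positivity
  have hη0 : 0 < η := lt_trans (by positivity) hη
  -- The rate used for the tail is `κ = min (ημ) 1`. Since the scaling multiplies rates by `1/μ`,
  -- the result is at most `η`.
  have h1 : q * (μ * l) < min (η * μ) 1 := by
    refine lt_min ?_ (h.bound_lt hq0 hq1 hj)
    nlinarith
  refine (growthOn_scaled_tail hq0 hq1 hg h.hα hK hK0 hKα hE (by positivity) h1
    (min_le_right _ _) j).mono (by positivity) ?_
  calc min (η * μ) 1 * (q ^ j * (g / ‖α‖)) ≤ η * μ * (q ^ j * (g / ‖α‖)) := by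
        gcongr; exact min_le_left _ _
    _ = η := by rw [hμ]; field_simp

/-- Besides the tail, the error comes from replacing `1/(q^(M+j) y s;q)_∞` by `1`, for `y = γ, δ`.
This costs `O(q^M)` against a term of size `|g/y|^M ≤ l^M`, so both errors are `O(η^M)` for every `η
> ql`. -/
theorem exists_scaledFun_expansion (hq0 : 0 < q) (hq1 : q < 1) {g l : ℝ} {α γ δ C : ℂ}
    (h : ScaleData q g l α) (hγ : γ ≠ 0) (hδ : δ ≠ 0) (hγl : ‖(g : ℂ) / γ‖ ≤ l)
    (hδl : ‖(g : ℂ) / δ‖ ≤ l) (hγδ : qPoch q (γ / δ) ≠ 0) (hδγ : qPoch q (δ / γ) ≠ 0)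
    (hC : qPoch q C ≠ 0) {j : ℕ} (hj : j ≤ 1) :
    ∃ Ψ : ℂ → ℂ, Differentiable ℂ Ψ ∧
      (∀ w, ‖w‖ < 1 → Ψ w =
        qPoch q w * phiSeries q (α / ((q : ℂ) ^ j * γ)) (α / ((q : ℂ) ^ j * δ)) C w) ∧
      ∀ K : Set ℂ, IsCompact K → (∀ s ∈ K, s ≠ 0) → (∀ s ∈ K, qTheta q (α * s) ≠ 0) →
        (∀ s ∈ K, qTheta q (γ * s) ≠ 0) → (∀ s ∈ K, qTheta q (δ * s) ≠ 0) →
        ∀ η, q * l < η → ∃ ε : ℕ → ℂ → ℂ, GrowthOn K η ε ∧ ∀ M, ∀ s ∈ K,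
          scaledFun q g α Ψ j M s =
            connCoeff q (α / ((q : ℂ) ^ j * γ)) (α / ((q : ℂ) ^ j * δ)) C / γ ^ j *
              ((g / γ) ^ M * qTheta q (γ * s)) +
            connCoeff q (α / ((q : ℂ) ^ j * δ)) (α / ((q : ℂ) ^ j * γ)) C / δ ^ j *
              ((g / δ) ^ M * qTheta q (δ * s)) + ε M s := by
  have hq := ofReal_q_ne_zero hq0
  have hα := h.hα
  set A := α / ((q : ℂ) ^ j * γ) with hA
  set B := α / ((q : ℂ) ^ j * δ) with hB
  have hA0 : A ≠ 0 := by positivity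
  have hB0 : B ≠ 0 := by positivity
  have hBA : B / A = γ / δ := by rw [hA, hB]; field_simp
  have hAB : A / B = δ / γ := by rw [hA, hB]; field_simp
  obtain ⟨E, hE, hE1, hE2⟩ := exists_phi_expansion hq0 hq1 hA0 hB0 (h.bound_lt hq0 hq1 hj)
    (h.norm_le hq0 hγ hγl j) (h.norm_le hq0 hδ hδl j) hC (by rwa [hBA]) (by rwa [hAB])
  have dP : ∀ x : ℂ, Differentiable ℂ fun t => qPoch q (x * t) := fun x =>
    (differentiable_qPoch hq0 hq1).comp (by fun_prop)
  refine ⟨fun w => connCoeff q A B C * qPoch q (A * w) + connCoeff q B A C * qPoch q (B * w) + E w,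
    (((dP A).const_mul _).add ((dP B).const_mul _)).add hE, hE2, ?_⟩
  intro K hK hK0 hKα hKγ hKδ η hη
  have hl := h.hl
  have part : ∀ {y : ℂ} (c : ℂ), y ≠ 0 → (∀ s ∈ K, qTheta q (y * s) ≠ 0) → ‖(g : ℂ) / y‖ ≤ l →
      GrowthOn K η fun M s => c / y ^ j * ((g / y) ^ M * qTheta q (y * s)) *
        ((qPoch q ((q : ℂ) ^ (M + j) * (y * s)))⁻¹ - 1) := by
    intro y c hy hKy hyl
    have hys : ContinuousOn (fun s : ℂ => y * s) K := by fun_prop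
    have G := ((((growthOn_pow K ((g : ℂ) / y)).mul (growthOn_of_continuousOn hK
      (continuousOn_qTheta_mul hq0 hq1 hy hK0))).const_mul (c / y ^ j))).mul
      (growthOn_inv_qPoch_sub_one hq0 hq1 hK hys (fun s hs => left_ne_zero_of_mul (hKy s hs)) j)
    refine G.mono (by positivity) (le_trans ?_ hη.le)
    rw [mul_one, mul_comm]
    gcongr
  refine ⟨_, ((part (connCoeff q A B C) hγ hKγ hγl).add (part (connCoeff q B A C) hδ hKδ hδl)).add
    (h.growthOn_tail hq0 hq1 hj hη hK hK0 hKα hE1), fun M s hs => ?_⟩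
  have h1 := scaleFactor_mul_qPoch (g := g) hq0 hq1 hα (hK0 s hs) hγ (hKγ s hs) hj M
  have h2 := scaleFactor_mul_qPoch (g := g) hq0 hq1 hα (hK0 s hs) hδ (hKδ s hs) hj M
  rw [← hA] at h1
  rw [← hB] at h2
  simp only [scaledFun]
  linear_combination connCoeff q A B C * h1 + connCoeff q B A C * h2

/-- The product rule for `θ(z) = (z;q)_∞ (q/z;q)_∞`, solved for the derivative at the large argument
`q/z`. -/
theorem qPoch_div_mul_deriv (hq0 : 0 < q) (hq1 : q < 1) {z : ℂ} (hz : z ≠ 0) :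
    q / z * deriv (qPoch q) (q / z) * qPoch q z =
      z * deriv (qPoch q) z * qPoch q (q / z) - z * deriv (qTheta q) z := by
  have dP := differentiable_qPoch hq0 hq1
  have h1 : HasDerivAt (fun z : ℂ => (q : ℂ) / z) ((0 * z - q * 1) / z ^ 2) z :=
    (hasDerivAt_const z (q : ℂ)).div (hasDerivAt_id z) hz
  have h2 : HasDerivAt (fun z : ℂ => qPoch q ((q : ℂ) / z))
      (deriv (qPoch q) (q / z) * ((0 * z - q * 1) / z ^ 2)) z :=
    HasDerivAt.comp (h₂ := qPoch q) (h := fun z : ℂ => (q : ℂ) / z) z (dP _).hasDerivAt h1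
  have h3 := ((dP z).hasDerivAt.mul h2).deriv
  have h4 : deriv (qTheta q) z = _ := h3
  rw [h4]
  field_simp
  ring

/-- Quasi-periodicity differentiated in `y`; the factor `y^(-N)` produces the term `-N θ(y)`, the
source of the linear growth in the confluent case. -/
theorem pow_mul_deriv_qTheta (hq0 : 0 < q) (hq1 : q < 1) {y : ℂ} (hy : y ≠ 0) (N : ℕ) :
    (q : ℂ) ^ N * y * deriv (qTheta q) ((q : ℂ) ^ N * y) =
      (-1) ^ N * (y⁻¹) ^ N * ((q : ℂ) ^ (N * (N - 1) / 2))⁻¹ *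
        (y * deriv (qTheta q) y - N * qTheta q y) := by
  have hq := ofReal_q_ne_zero hq0
  have h1 : HasDerivAt (fun y : ℂ => qTheta q ((q : ℂ) ^ N * y))
      (deriv (qTheta q) ((q : ℂ) ^ N * y) * ((q : ℂ) ^ N * 1)) y :=
    HasDerivAt.comp (h₂ := qTheta q) (h := fun y : ℂ => (q : ℂ) ^ N * y) y
      (differentiableAt_qTheta hq0 hq1 (by positivity)).hasDerivAt
      ((hasDerivAt_id y).const_mul _)
  have h2 : HasDerivAt (fun y : ℂ => (-1) ^ N * (y⁻¹) ^ N * ((q : ℂ) ^ (N * (N - 1) / 2))⁻¹ *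
      qTheta q y) _ y :=
    ((((hasDerivAt_inv hy).fun_pow N).const_mul ((-1) ^ N)).mul_const
      (((q : ℂ) ^ (N * (N - 1) / 2))⁻¹)).mul (differentiableAt_qTheta hq0 hq1 hy).hasDerivAt
  have h3 : (fun y : ℂ => qTheta q ((q : ℂ) ^ N * y)) =ᶠ[𝓝 y]
      fun y : ℂ => (-1) ^ N * (y⁻¹) ^ N * ((q : ℂ) ^ (N * (N - 1) / 2))⁻¹ * qTheta q y := by
    filter_upwards [eventually_ne_nhds hy] with x hx
    exact qTheta_pow_mul hq0 hq1 hx N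
  have h4 := h1.unique (h2.congr_of_eventuallyEq h3)
  have h5 : (N : ℂ) * (y⁻¹) ^ (N - 1) * (-(y ^ 2)⁻¹) * y = -(N * (y⁻¹) ^ N) := by
    rcases N with _ | N
    · simp
    · rw [Nat.add_sub_cancel, pow_succ (y⁻¹) N]
      generalize (y⁻¹) ^ N = v
      field_simp
  rw [mul_one] at h4
  linear_combination y * h4 + (-1) ^ N * ((q : ℂ) ^ (N * (N - 1) / 2))⁻¹ * qTheta q y * h5

theorem growthOn_comp_pow (hq0 : 0 < q) (hq1 : q < 1) {K : Set ℂ} (hK : IsCompact K) {F f : ℂ → ℂ}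
    (hF : Continuous F) (hf : ContinuousOn f K) (j : ℕ) :
    GrowthOn K 1 fun M s => F ((q : ℂ) ^ (M + j) * f s) := by
  obtain ⟨D, hD⟩ := hK.exists_bound_of_continuousOn hf
  obtain ⟨C, hC⟩ := (isCompact_closedBall (0 : ℂ) D).exists_bound_of_continuousOn hF.continuousOn
  refine ⟨|C|, abs_nonneg C, fun M s hs => ?_⟩
  rw [one_pow, mul_one]
  refine (hC _ ?_).trans (le_abs_self C)
  rw [mem_closedBall_zero_iff, mul_comm]
  exact (norm_mul_pow_le hq0 hq1 _ _).trans (hD s hs)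

/-- The term linear in `M` is kept inside the second leading function, where it drops out of the
antisymmetric product. The part of it coming from the shift by `j` is a constant and joins the
coefficient of `θ(γs)`. -/
theorem exists_scaledFun_expansion_conf (hq0 : 0 < q) (hq1 : q < 1) {g : ℝ} {α γ C : ℂ}
    (h : ScaleData q g 1 α) (hγ : γ ≠ 0) (hγl : ‖(g : ℂ) / γ‖ = 1)
    (hC : qPoch q C ≠ 0) {j : ℕ} (hj : j ≤ 1) :
    ∃ Ψ : ℂ → ℂ, Differentiable ℂ Ψ ∧
      (∀ w, ‖w‖ < 1 → Ψ w =
        qPoch q w * phiSeries q (α / ((q : ℂ) ^ j * γ)) (α / ((q : ℂ) ^ j * γ)) C w) ∧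
      ∀ K : Set ℂ, IsCompact K → (∀ s ∈ K, s ≠ 0) → (∀ s ∈ K, qTheta q (α * s) ≠ 0) →
        (∀ s ∈ K, qTheta q (γ * s) ≠ 0) →
        ∀ η, q < η → ∃ ε : ℕ → ℂ → ℂ, GrowthOn K η ε ∧ ∀ M, ∀ s ∈ K,
          scaledFun q g α Ψ j M s =
            (confCoeff q (α / ((q : ℂ) ^ j * γ)) C +
              confCoeff' q (α / ((q : ℂ) ^ j * γ)) C * j) / γ ^ j *
              ((g / γ) ^ M * qTheta q (γ * s)) +
            (-confCoeff' q (α / ((q : ℂ) ^ j * γ)) C) / γ ^ j *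
              ((g / γ) ^ M * (γ * s * deriv (qTheta q) (γ * s) - M * qTheta q (γ * s))) + ε M s := by
  have hq := ofReal_q_ne_zero hq0
  have hα := h.hα
  have dP' := differentiable_qPoch hq0 hq1
  have dP'' := differentiable_deriv_qPoch hq0 hq1
  set A := α / ((q : ℂ) ^ j * γ) with hA
  have hA0 : A ≠ 0 := by positivity
  obtain ⟨E, hE, hE1, hE2⟩ := exists_phi_expansion_conf hq0 hq1 hA0 (h.bound_lt hq0 hq1 hj)
    (h.norm_le hq0 hγ hγl.le j) hC
  set r := confCoeff q A C with hr
  set R := confCoeff' q A C with hR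
  refine ⟨fun w => r * qPoch q (A * w) + R * (A * w * deriv (qPoch q) (A * w)) + E w,
    ?_, hE2, ?_⟩
  · have e1 : Differentiable ℂ fun w => qPoch q (A * w) := dP'.comp (by fun_prop)
    have e2 : Differentiable ℂ fun w => deriv (qPoch q) (A * w) := dP''.comp (by fun_prop)
    fun_prop
  intro K hK hK0 hKα hKγ η hη
  have hys : ContinuousOn (fun s : ℂ => γ * s) K := by fun_prop
  have hθ := growthOn_of_continuousOn hK (continuousOn_qTheta_mul hq0 hq1 hγ hK0)
  have hθ' : ContinuousOn (fun s : ℂ => γ * s * deriv (qTheta q) (γ * s)) K := by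
    have hd : DifferentiableOn ℂ (qTheta q) {0}ᶜ := fun z hz =>
      (differentiableAt_qTheta hq0 hq1 hz).differentiableWithinAt
    have hd2 := (hd.deriv isOpen_compl_singleton).continuousOn
    exact hys.mul (hd2.comp hys fun s hs => mul_ne_zero hγ (hK0 s hs))
  -- The room between `q` and `η` absorbs the factors linear in `M` that multiply errors of size
  -- `q^M`.
  have hL : 1 < η / q := (one_lt_div hq0).2 hη
  have hp0 : ∀ s ∈ K, qPoch q (γ * s) ≠ 0 := fun s hs => left_ne_zero_of_mul (hKγ s hs)
  have Gpow := growthOn_pow K ((g : ℂ) / γ)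
  rw [hγl] at Gpow
  have Ginv := growthOn_inv_qPoch hq0 hq1 hK hys hp0 j
  have Gsub := growthOn_inv_qPoch_sub_one hq0 hq1 hK hys hp0 j
  have GM : GrowthOn K (η / q) fun M _ => ((M : ℂ) + j) :=
    (growthOn_natCast K hL).add ((growthOn_const K (j : ℂ)).mono zero_le_one hL.le)
  have G1 : GrowthOn K (η / q) fun M s => (r + R * ((M : ℂ) + j)) * qTheta q (γ * s) +
      -(R * (γ * s * deriv (qTheta q) (γ * s))) := by
    have a1 := (((growthOn_const K r).mono zero_le_one hL.le).add (GM.const_mul R)).mul hθ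
    rw [mul_one] at a1
    exact a1.add (((growthOn_of_continuousOn hK hθ').const_mul R).neg.mono zero_le_one hL.le)
  have G2 : GrowthOn K q fun M s => (q : ℂ) ^ (M + j) * (γ * s) := by
    have a1 := (growthOn_pow K (q : ℂ)).mul (growthOn_of_continuousOn hK
      (hys.const_mul ((q : ℂ) ^ j)))
    rw [norm_ofReal_q hq0, mul_one] at a1
    convert a1 using 3
    rw [pow_add]; ring
  have G3 := growthOn_comp_pow hq0 hq1 hK dP''.continuous hys j
  have Gmain : GrowthOn K η fun M s => (1 / γ ^ j) * ((g / γ) ^ M *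
      (((r + R * ((M : ℂ) + j)) * qTheta q (γ * s) + -(R * (γ * s * deriv (qTheta q) (γ * s)))) *
        ((qPoch q ((q : ℂ) ^ (M + j) * (γ * s)))⁻¹ - 1))) := by
    have a1 := (Gpow.mul (G1.mul Gsub)).const_mul (1 / γ ^ j)
    rw [one_mul, div_mul_cancel₀ _ hq0.ne'] at a1
    exact a1
  have Gsec : GrowthOn K η fun M s => (R / γ ^ j) * ((g / γ) ^ M * ((((q : ℂ) ^ (M + j) * (γ * s)) *
      deriv (qPoch q) ((q : ℂ) ^ (M + j) * (γ * s))) * (qTheta q (γ * s) *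
      ((qPoch q ((q : ℂ) ^ (M + j) * (γ * s)))⁻¹ * (qPoch q ((q : ℂ) ^ (M + j) * (γ * s)))⁻¹)))) := by
    have a1 := (Gpow.mul ((G2.mul G3).mul (hθ.mul (Ginv.mul Ginv)))).const_mul (R / γ ^ j)
    simp only [one_mul, mul_one] at a1
    exact a1.mono hq0.le hη.le
  refine ⟨_, (Gmain.add Gsec).add (h.growthOn_tail hq0 hq1 hj (by rwa [mul_one]) hK hK0 hKα hE1),
    fun M s hs => ?_⟩
  have hs0 := hK0 s hs
  have hy0 := mul_ne_zero hγ hs0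
  have h1 := scaleFactor_mul_qPoch (g := g) hq0 hq1 hα hs0 hγ (hKγ s hs) hj M
  have h2 := qPoch_div_mul_deriv hq0 hq1 (z := (q : ℂ) ^ (M + j) * (γ * s)) (by positivity)
  have h3 := pow_mul_deriv_qTheta hq0 hq1 hy0 (M + j)
  have h4 := scaleFactor_mul (g := g) hq0 hs0 hγ hj M
  have h5 := qPoch_pow_mul_ne_zero hq0 hq1 (hKγ s hs) (M + j)
  rw [← hA, arg_eq hq0 hα hs0 hγ] at h1
  simp only [scaledFun]
  rw [arg_eq hq0 hα hs0 hγ]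
  rw [h3] at h2
  set z := (q : ℂ) ^ (M + j) * (γ * s) with hz
  generalize qTheta q (γ * s) = θ at *
  generalize deriv (qTheta q) (γ * s) = θ' at *
  generalize qPoch q z = p at *
  generalize deriv (qPoch q) z = p' at *
  generalize qPoch q ((q : ℂ) / z) = u at *
  generalize (q : ℂ) / z * deriv (qPoch q) ((q : ℂ) / z) = v at *
  have hu : v = (z * p' * u - (-1) ^ (M + j) * ((γ * s)⁻¹) ^ (M + j) *
      ((q : ℂ) ^ ((M + j) * (M + j - 1) / 2))⁻¹ * (γ * s * θ' - ((M + j : ℕ) : ℂ) * θ)) * p⁻¹ := by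
    rw [← h2]; field_simp
  rw [hu]
  push_cast
  linear_combination (r + R * z * p' * p⁻¹) * h1 -
    R * (γ * s * θ' - ((M : ℂ) + j) * θ) * p⁻¹ * h4

/-! ### Integrable kernels -/

theorem integrableKernel_self (c : ℂ) (A B : ℝ → ℂ) (x : ℝ) :
    integrableKernel c A B x x = c * (deriv A x * B x - deriv B x * A x) := if_pos rfl

theorem integrableKernel_of_ne (c : ℂ) (A B : ℝ → ℂ) {x y : ℝ} (h : x ≠ y) :
    integrableKernel c A B x y = c * ((A x * B y - B x * A y) / ((x : ℂ) - (y : ℂ))) := if_neg h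

/-- On the diagonal the terms containing `Λ'` cancel by antisymmetry. -/
theorem integrableKernel_mul {c : ℂ} {Λ A B : ℝ → ℂ} {x : ℝ} (y : ℝ)
    (hΛ : DifferentiableAt ℝ Λ x) (hA : DifferentiableAt ℝ A x) (hB : DifferentiableAt ℝ B x) :
    integrableKernel c (fun s => Λ s * A s) (fun s => Λ s * B s) x y =
      Λ x * Λ y * integrableKernel c A B x y := by
  by_cases h : x = y
  · subst h
    rw [integrableKernel_self, integrableKernel_self, deriv_fun_mul hΛ hA, deriv_fun_mul hΛ hB]
    ring
  · rw [integrableKernel_of_ne _ _ _ h, integrableKernel_of_ne _ _ _ h]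
    ring

theorem integrableKernel_congr (c : ℂ) {A B A' B' : ℝ → ℂ} {x y : ℝ} (hA : A =ᶠ[𝓝 x] A')
    (hB : B =ᶠ[𝓝 x] B') (hAy : A y = A' y) (hBy : B y = B' y) :
    integrableKernel c A B x y = integrableKernel c A' B' x y := by
  by_cases h : x = y
  · subst h
    rw [integrableKernel_self, integrableKernel_self, hA.deriv_eq, hB.deriv_eq, hAy, hBy]
  · rw [integrableKernel_of_ne _ _ _ h, integrableKernel_of_ne _ _ _ h, hAy, hBy, hA.eq_of_nhds,
      hB.eq_of_nhds]

theorem integrableKernel_scale (c : ℂ) (A B : ℝ → ℂ) {ρ : ℝ} (hρ : ρ ≠ 0) (x y : ℝ) :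
    integrableKernel c A B (ρ * x) (ρ * y) =
      (ρ : ℂ)⁻¹ * integrableKernel c (fun s => A (ρ * s)) (fun s => B (ρ * s)) x y := by
  have hρ' : (ρ : ℂ) ≠ 0 := by exact_mod_cast hρ
  by_cases h : x = y
  · subst h
    rw [integrableKernel_self, integrableKernel_self, deriv_comp_mul_left ρ A,
      deriv_comp_mul_left ρ B, Complex.real_smul, Complex.real_smul]
    field_simp
  · have h' : ρ * x ≠ ρ * y := fun h2 => h (mul_left_cancel₀ hρ h2)
    rw [integrableKernel_of_ne _ _ _ h, integrableKernel_of_ne _ _ _ h']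
    have : (x : ℂ) - y ≠ 0 := sub_ne_zero.2 (by exact_mod_cast h)
    push_cast
    rw [← mul_sub]
    field_simp

theorem integrableKernel_swap (c : ℂ) (A B : ℝ → ℂ) (x y : ℝ) :
    integrableKernel (-c) A B x y = integrableKernel c B A x y := by
  by_cases h : x = y
  · subst h
    rw [integrableKernel_self, integrableKernel_self]; ring
  · rw [integrableKernel_of_ne _ _ _ h, integrableKernel_of_ne _ _ _ h]; ring

theorem integrableKernel_smul_right (c a : ℂ) (A B : ℝ → ℂ) {x : ℝ} (y : ℝ)
    (hB : DifferentiableAt ℝ B x) :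
    integrableKernel c A (fun s => a * B s) x y = integrableKernel (c * a) A B x y := by
  by_cases h : x = y
  · subst h
    rw [integrableKernel_self, integrableKernel_self, deriv_const_mul _ hB]; ring
  · rw [integrableKernel_of_ne _ _ _ h, integrableKernel_of_ne _ _ _ h]; ring

/-- With the second argument frozen at `x`, the diagonal value is the derivative of a single
holomorphic function, which makes convergence of derivatives applicable. -/
theorem integrableKernel_self_ofReal (c : ℂ) {F G : ℂ → ℂ} {x : ℝ}
    (hF : DifferentiableAt ℂ F x) (hG : DifferentiableAt ℂ G x) :
    integrableKernel c (fun s : ℝ => F s) (fun s : ℝ => G s) x x =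
      c * deriv (fun s => F s * G x - G s * F x) x := by
  have hd : deriv (fun s => F s * G x - G s * F x) (x : ℂ) = _ :=
    ((hF.hasDerivAt.mul_const (G x)).sub (hG.hasDerivAt.mul_const (F x))).deriv
  rw [integrableKernel_self, hF.hasDerivAt.comp_ofReal.deriv, hG.hasDerivAt.comp_ofReal.deriv, hd]

theorem tendsto_of_norm_sub_le {f : ℕ → ℂ} {a : ℂ} {C ρ : ℝ} (h0 : 0 ≤ ρ) (h1 : ρ < 1)
    (h : ∀ M, ‖f M - a‖ ≤ C * ρ ^ M) : Tendsto f atTop (𝓝 a) := by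
  rw [tendsto_iff_norm_sub_tendsto_zero]
  refine squeeze_zero (fun _ => norm_nonneg _) h ?_
  simpa using (tendsto_pow_atTop_nhds_zero_of_lt_one h0 h1).const_mul C

/-- Off the diagonal the bound at the two points suffices. On the diagonal uniform convergence on a
complex disc implies convergence of derivatives; this is why the estimates are made for complex `s`.
-/
theorem tendsto_integrableKernel {Ω : Set ℂ} (hΩ : IsOpen Ω) {B₀ B₁ : ℕ → ℂ → ℂ} {u v : ℂ → ℂ}
    (c c' : ℂ) (hB₀ : ∀ M, DifferentiableOn ℂ (B₀ M) Ω) (hB₁ : ∀ M, DifferentiableOn ℂ (B₁ M) Ω)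
    (hu : DifferentiableOn ℂ u Ω) (hv : DifferentiableOn ℂ v Ω)
    (hK : ∀ K ⊆ Ω, IsCompact K → ∃ C ρ : ℝ, 0 ≤ ρ ∧ ρ < 1 ∧ ∀ M, ∀ s ∈ K, ∀ t ∈ K,
      ‖B₀ M s * B₁ M t - B₁ M s * B₀ M t - c' * (u s * v t - v s * u t)‖ ≤ C * ρ ^ M)
    {x y : ℝ} (hx : (x : ℂ) ∈ Ω) (hy : (y : ℂ) ∈ Ω) :
    Tendsto (fun M => integrableKernel c (fun s : ℝ => B₀ M s) (fun s : ℝ => B₁ M s) x y) atTop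
      (𝓝 (integrableKernel (c * c') (fun s : ℝ => u s) (fun s : ℝ => v s) x y)) := by
  by_cases h : x = y
  · subst h
    have hd : ∀ {f : ℂ → ℂ}, DifferentiableOn ℂ f Ω → DifferentiableAt ℂ f x := fun hf =>
      hf.differentiableAt (hΩ.mem_nhds hx)
    simp only [integrableKernel_self_ofReal c (hd (hB₀ _)) (hd (hB₁ _)),
      integrableKernel_self_ofReal (c * c') (hd hu) (hd hv)]
    obtain ⟨r, hr, hrΩ⟩ := Metric.nhds_basis_closedBall.mem_iff.1 (hΩ.mem_nhds hx)
    obtain ⟨C, ρ, h0, h1, hb⟩ := hK _ hrΩ (isCompact_closedBall _ _)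
    have hxr : (x : ℂ) ∈ Metric.closedBall (x : ℂ) r := Metric.mem_closedBall_self hr.le
    have hsub : Metric.ball (x : ℂ) r ⊆ Ω := Metric.ball_subset_closedBall.trans hrΩ
    have hunif : TendstoUniformlyOn (fun M s => B₀ M s * B₁ M x - B₁ M s * B₀ M x)
        (fun s => c' * (u s * v x - v s * u x)) atTop (Metric.ball (x : ℂ) r) := by
      rw [Metric.tendstoUniformlyOn_iff]
      intro ε hε
      have hlim : Tendsto (fun M : ℕ => C * ρ ^ M) atTop (𝓝 0) := by
        simpa using (tendsto_pow_atTop_nhds_zero_of_lt_one h0 h1).const_mul C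
      filter_upwards [hlim.eventually (gt_mem_nhds hε)] with M hM s hs
      rw [dist_comm, dist_eq_norm]
      exact (hb M s (Metric.ball_subset_closedBall hs) x hxr).trans_lt hM
    have hder := (hunif.tendstoLocallyUniformlyOn.deriv (Eventually.of_forall fun M =>
      (((hB₀ M).mono hsub).mul_const _).sub (((hB₁ M).mono hsub).mul_const _))
      Metric.isOpen_ball).tendsto_at (Metric.mem_ball_self hr)
    have e : deriv (fun s => c' * (u s * v x - v s * u x)) (x : ℂ) =
        c' * deriv (fun s => u s * v x - v s * u x) x :=
      deriv_const_mul _ (((hd hu).mul_const _).sub ((hd hv).mul_const _))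
    rw [e] at hder
    rw [mul_assoc]
    exact hder.const_mul c
  · simp only [integrableKernel_of_ne _ _ _ h]
    have hsub : ({(x : ℂ), (y : ℂ)} : Set ℂ) ⊆ Ω := by
      rintro z (rfl | rfl) <;> assumption
    obtain ⟨C, ρ, h0, h1, hb⟩ := hK _ hsub (Set.toFinite _).isCompact
    have hlim := tendsto_of_norm_sub_le h0 h1 fun M => hb M x (by simp) y (by simp)
    rw [mul_assoc, ← mul_div_assoc]
    exact (hlim.div_const _).const_mul c

/-! ### Square roots -/

theorem csqrt_ofReal {r : ℝ} (hr : 0 ≤ r) : csqrt (r : ℂ) = (Real.sqrt r : ℂ) := by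
  rw [csqrt, Real.sqrt_eq_rpow, Complex.ofReal_cpow hr]
  norm_num

/-- A positive factor does not change the argument, so the principal branch is multiplicative here.
-/
theorem csqrt_ofReal_mul {r : ℝ} (hr : 0 < r) (u : ℂ) :
    csqrt ((r : ℂ) * u) = (Real.sqrt r : ℂ) * csqrt u := by
  rw [← csqrt_ofReal hr.le]
  have hr' : (r : ℂ) ≠ 0 := by exact_mod_cast hr.ne'
  rcases eq_or_ne u 0 with rfl | hu
  · simp [csqrt]
  · rw [csqrt, csqrt, csqrt, Complex.cpow_def_of_ne_zero (mul_ne_zero hr' hu),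
      Complex.cpow_def_of_ne_zero hr', Complex.cpow_def_of_ne_zero hu, Complex.log_ofReal_mul hr hu,
      ← Complex.exp_add, ← Complex.ofReal_log hr.le, add_mul]

theorem differentiableAt_csqrt {w : ℂ} (hw : w ∈ Complex.slitPlane) :
    DifferentiableAt ℂ csqrt w :=
  differentiableAt_id.cpow_const hw

theorem differentiableAt_csqrt_comp {f : ℝ → ℂ} {x : ℝ} (hf : DifferentiableAt ℝ f x)
    (hx : f x ∈ Complex.slitPlane) : DifferentiableAt ℝ (fun s => csqrt (f s)) x :=
  ((differentiableAt_csqrt hx).restrictScalars ℝ).comp x hf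

theorem differentiableAt_ofReal_abs_mul {c x : ℝ} (h : c * x ≠ 0) :
    DifferentiableAt ℝ (fun s : ℝ => ((|c * s| : ℝ) : ℂ)) x := by
  have h1 : DifferentiableAt ℝ (fun s : ℝ => |c * s|) x :=
    (differentiableAt_abs h).comp x (by fun_prop : DifferentiableAt ℝ (fun s : ℝ => c * s) x)
  exact (Complex.ofRealCLM.differentiableAt (x := |c * x|)).comp x h1

/-! ### Parameters -/

/-- The properties of the parameters at a point of the lattice on which the limit depends. -/
structure GoodPoint (q : ℝ) (α γ δ : ℂ) (x : ℝ) : Prop where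
  ne_zero : x ≠ 0
  hα : qTheta q (α * x) ≠ 0
  hγ : qTheta q (γ * x) ≠ 0
  hδ : qTheta q (δ * x) ≠ 0
  pos : ∃ ρ : ℝ, 0 < ρ ∧ qTheta q (x * γ) * qTheta q (x * δ) = ρ

/-- The properties of an admissible quadruple on which the limit depends. -/
structure GoodParams (q g : ℝ) (α β γ δ : ℂ) : Prop where
  hg : 0 < g
  hγδ : γ * δ = (g : ℂ) ^ 2
  hα : α ≠ 0
  hβ : β ≠ 0
  hγ : γ ≠ 0
  hδ : δ ≠ 0
  hαγ : ‖α / γ‖ < 1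
  hαδ : ‖α / δ‖ < 1
  hβγ : ‖β / γ‖ < 1
  hβδ : ‖β / δ‖ < 1
  hαβ : ‖α * β / ((q : ℂ) ^ 2 * (γ * δ))‖ < 1
  hqγ : q * ‖γ‖ < ‖δ‖
  hqδ : q * ‖δ‖ < ‖γ‖

/-- From `|γ||δ| = g²`: the numbers `|g/γ|` and `|g/δ|` have product `1`, so their maximum `l` is at
least `1`, and `l²` is the larger of `|δ/γ|` and `|γ/δ|`. Likewise `|α| l / g` is `|α/γ|` or
`|α/δ|`. -/
theorem GoodParams.scaleData {g : ℝ} {α β γ δ : ℂ} (h : GoodParams q g α β γ δ) :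
    ScaleData q g (max ‖(g : ℂ) / γ‖ ‖(g : ℂ) / δ‖) α := by
  have hg := h.hg
  have hγ := norm_pos_iff.2 h.hγ
  have hδ := norm_pos_iff.2 h.hδ
  have hαγ := h.hαγ
  have hαδ := h.hαδ
  have h1 : ‖γ‖ * ‖δ‖ = g ^ 2 := by
    rw [← norm_mul, h.hγδ, norm_pow, Complex.norm_real, Real.norm_eq_abs, abs_of_pos hg]
  have e : ∀ y : ℂ, ‖(g : ℂ) / y‖ = g / ‖y‖ := fun y => by
    rw [norm_div, Complex.norm_real, Real.norm_eq_abs, abs_of_pos hg]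
  have e1 : g / ‖γ‖ * (g / ‖γ‖) = ‖δ‖ / ‖γ‖ := by
    field_simp; rw [← h1]
  have e2 : g / ‖δ‖ * (g / ‖δ‖) = ‖γ‖ / ‖δ‖ := by
    field_simp; rw [← h1, mul_comm]
  have e3 : g / ‖γ‖ * (g / ‖δ‖) = 1 := by
    field_simp; rw [← h1]
  rw [norm_div] at hαγ hαδ
  rw [e, e]
  refine ⟨hg, h.hα, ?_, ?_, ?_⟩
  · by_contra hlt
    push Not at hlt
    obtain ⟨ha, hb⟩ := max_lt_iff.1 hlt
    have : g / ‖γ‖ * (g / ‖δ‖) < 1 := mul_lt_one_of_nonneg_of_lt_one_left (by positivity) ha hb.le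
    exact absurd e3 this.ne
  · rw [mul_assoc]
    rcases max_choice (g / ‖γ‖) (g / ‖δ‖) with hm | hm <;> rw [hm]
    · rw [e1, ← mul_div_assoc, div_lt_one hγ]; exact h.hqδ
    · rw [e2, ← mul_div_assoc, div_lt_one hδ]; exact h.hqγ
  · rcases max_choice (g / ‖γ‖) (g / ‖δ‖) with hm | hm <;> rw [hm]
    · refine lt_of_eq_of_lt ?_ hαγ; field_simp
    · refine lt_of_eq_of_lt ?_ hαδ; field_simp

theorem norm_div_pow_lt_one (hq0 : 0 < q) (hq1 : q < 1) {u : ℂ} (hu : ‖u / (q : ℂ) ^ 2‖ < 1)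
    {n : ℕ} (hn : n ≤ 2) : ‖u / (q : ℂ) ^ n‖ < 1 := by
  refine lt_of_le_of_lt ?_ hu
  rw [norm_div, norm_div, norm_pow, norm_pow, norm_ofReal_q hq0]
  have := pow_le_pow_of_le_one hq0.le hq1.le hn
  gcongr

theorem GoodParams.norm_C_lt_one (hq0 : 0 < q) (hq1 : q < 1) {g : ℝ} {α β γ δ : ℂ}
    (h : GoodParams q g α β γ δ) {n : ℕ} (hn : n ≤ 2) :
    ‖α * β / ((q : ℂ) ^ n * (γ * δ))‖ < 1 := by
  have h1 := h.hαβ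
  have e : ∀ k : ℕ, α * β / ((q : ℂ) ^ k * (γ * δ)) = α * β / (γ * δ) / (q : ℂ) ^ k := fun k => by
    rw [div_div, mul_comm (γ * δ)]
  rw [e] at h1 ⊢
  exact norm_div_pow_lt_one hq0 hq1 h1 hn

theorem GoodParams.qPoch_div_ne_zero (hq0 : 0 < q) (hq1 : q < 1) {g : ℝ} {α β γ δ : ℂ}
    (h : GoodParams q g α β γ δ) (hne : γ ≠ δ) :
    qPoch q (γ / δ) ≠ 0 ∧ qPoch q (δ / γ) ≠ 0 := by
  have aux : ∀ {x y : ℂ}, x ≠ 0 → y ≠ 0 → x ≠ y → q * ‖x‖ < ‖y‖ → qPoch q (x / y) ≠ 0 := by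
    intro x y hx hy hxy hq
    refine qPoch_ne_zero hq0 hq1 fun i hi => ?_
    rcases i with _ | i
    · rw [pow_zero, mul_one, div_eq_one_iff_eq hy] at hi
      exact hxy hi
    · have h1 : ‖x‖ * q ^ (i + 1) = ‖y‖ := by
        have := congrArg (‖·‖) hi
        rw [norm_mul, norm_div, norm_pow, norm_ofReal_q hq0, norm_one] at this
        have hy' := norm_pos_iff.2 hy
        field_simp at this
        linarith
      have h2 : ‖x‖ * q ^ (i + 1) ≤ ‖x‖ * q := by
        gcongr
        exact pow_le_of_le_one hq0.le hq1.le (by omega)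
      linarith
  exact ⟨aux h.hγ h.hδ hne h.hqγ, aux h.hδ h.hγ hne.symm h.hqδ⟩

/-! ### Evaluation of the limiting constants -/

theorem qPoch_div_q (hq0 : 0 < q) (hq1 : q < 1) (x : ℂ) :
    qPoch q (x / q) = (1 - x / q) * qPoch q x := by
  have hq := ofReal_q_ne_zero hq0
  rw [qPoch_eq_mul hq0 hq1, mul_div_cancel₀ _ hq]

/-- Once `(x/q;q)_∞ = (1 - x/q)(x;q)_∞` has been applied, all infinite products match and there
remains `δ(1 - α/(qδ))(1 - β/(qδ)) - γ(1 - α/(qγ))(1 - β/(qγ)) = (δ - γ)(1 - αβ/(q²γδ))`. -/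
theorem basicConst_mul_connCoeff (hq0 : 0 < q) (hq1 : q < 1) (ζm ζp : ℝ) {g : ℝ} {α β γ δ : ℂ}
    (h : GoodParams q g α β γ δ) (hne : γ ≠ δ) :
    basicConst q ζm ζp α β γ δ *
      (connCoeff q (α / ((q : ℂ) ^ 0 * γ)) (α / ((q : ℂ) ^ 0 * δ))
          (α * β / ((q : ℂ) ^ 0 * (γ * δ))) / γ ^ 0 *
        (connCoeff q (α / ((q : ℂ) ^ 1 * δ)) (α / ((q : ℂ) ^ 1 * γ))
          (α * β / ((q : ℂ) ^ 2 * (γ * δ))) / δ ^ 1) -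
      connCoeff q (α / ((q : ℂ) ^ 0 * δ)) (α / ((q : ℂ) ^ 0 * γ))
          (α * β / ((q : ℂ) ^ 0 * (γ * δ))) / δ ^ 0 *
        (connCoeff q (α / ((q : ℂ) ^ 1 * γ)) (α / ((q : ℂ) ^ 1 * δ))
          (α * β / ((q : ℂ) ^ 2 * (γ * δ))) / γ ^ 1)) =
      -ellipticConst q ζm ζp γ δ := by
  have hq := ofReal_q_ne_zero hq0
  have hα := h.hα
  have hγ := h.hγ
  have hδ := h.hδ
  have nz : ∀ {x : ℂ}, ‖x‖ < 1 → qPoch q x ≠ 0 := fun hx =>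
    qPoch_ne_zero_of_norm_lt_one hq0 hq1 hx
  have nC := nz (h.norm_C_lt_one hq0 hq1 (n := 2) le_rfl)
  have nC1 := nz (h.norm_C_lt_one hq0 hq1 (n := 1) one_le_two)
  have nC0 := nz (h.norm_C_lt_one hq0 hq1 (n := 0) zero_le_two)
  obtain ⟨n1, n2⟩ := h.qPoch_div_ne_zero hq0 hq1 hne
  have n3 := nz h.hαγ
  have n4 := nz h.hαδ
  have n5 := nz h.hβγ
  have n6 := nz h.hβδ
  have nq := qPoch_q_ne_zero hq0 hq1
  have a1 : α * β / (γ * δ) / (α / γ) = β / δ := by field_simp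
  have a2 : α * β / (γ * δ) / (α / δ) = β / γ := by field_simp
  have a3 : α / γ / (α / δ) = δ / γ := by field_simp
  have a4 : α / δ / (α / γ) = γ / δ := by field_simp
  have b1 : α * β / ((q : ℂ) ^ 2 * (γ * δ)) / (α / (q * γ)) = β / δ / q := by field_simp
  have b2 : α * β / ((q : ℂ) ^ 2 * (γ * δ)) / (α / (q * δ)) = β / γ / q := by field_simp
  have b3 : α / (q * γ) / (α / (q * δ)) = δ / γ := by field_simp
  have b4 : α / (q * δ) / (α / (q * γ)) = γ / δ := by field_simp
  have b5 : α / (q * γ) = α / γ / q := by field_simp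
  have b6 : α / (q * δ) = α / δ / q := by field_simp
  have c1 : α * β / (q * γ * δ) = α * β / (γ * δ) / q := by field_simp
  have c2 : α * β / ((q : ℂ) ^ 2 * (γ * δ)) = α * β / (γ * δ) / q / q := by field_simp
  simp only [connCoeff, pow_zero, pow_one, one_mul, div_one, a1, a2, a3, a4, b1, b2, b3, b4]
  rw [c2, qPoch_div_q hq0 hq1 (_ / _), qPoch_div_q hq0 hq1 (α * β / (γ * δ))] at nC
  rw [pow_zero, one_mul] at nC0
  rw [basicConst, ellipticConst, ellipticPrefactor, b5, b6, c1, c2]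
  rw [qPoch_div_q hq0 hq1 (α * β / (γ * δ) / q), qPoch_div_q hq0 hq1 (α * β / (γ * δ)),
    qPoch_div_q hq0 hq1 (α / γ), qPoch_div_q hq0 hq1 (α / δ), qPoch_div_q hq0 hq1 (β / γ),
    qPoch_div_q hq0 hq1 (β / δ)]
  have f1 := left_ne_zero_of_mul nC
  have f2 := left_ne_zero_of_mul (right_ne_zero_of_mul nC)
  generalize qPoch q (α / γ) = p1 at *
  generalize qPoch q (α / δ) = p2 at *
  generalize qPoch q (β / γ) = p3 at *
  generalize qPoch q (β / δ) = p4 at *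
  generalize qPoch q (γ / δ) = p5 at *
  generalize qPoch q (δ / γ) = p6 at *
  generalize qPoch q (α * β / (γ * δ)) = p7 at *
  generalize qPoch q (q : ℂ) = p8 at *
  generalize qTheta q (γ * ζm) * qTheta q (γ * ζp) * qTheta q (δ * ζm) * qTheta q (δ * ζp) /
    (ζp * (qTheta q ((ζm : ℂ) / ζp) * qTheta q (γ * δ * ζm * ζp))) = P
  have e : (1 - α / δ / q) * (1 - β / δ / q) / γ - (1 - α / γ / q) * (1 - β / γ / q) / δ =
      (δ - γ) / (γ * δ) * (1 - α * β / (γ * δ) / q / q) := by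
    field_simp
    ring
  generalize 1 - α * β / (γ * δ) / q / q = G1 at *
  generalize 1 - α * β / (γ * δ) / q = G2 at *
  have e2 : (1 - α / δ / q) * (1 - β / δ / q) * δ - (1 - α / γ / q) * (1 - β / γ / q) * γ =
      (δ - γ) * G1 := by
    have := congrArg (· * (γ * δ)) e
    field_simp at this ⊢
    linear_combination this
  generalize (1 - α / δ / q) = g1 at *
  generalize (1 - β / δ / q) = g2 at *
  generalize (1 - α / γ / q) = g3 at *
  generalize (1 - β / γ / q) = g4 at *
  field_simp
  linear_combination (-P) * e2

theorem deriv_qPoch_div_q (hq0 : 0 < q) (hq1 : q < 1) (x : ℂ) :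
    deriv (qPoch q) (x / q) = -qPoch q x + (q - x) * deriv (qPoch q) x := by
  have hq := ofReal_q_ne_zero hq0
  have dP := differentiable_qPoch hq0 hq1
  have h1 : HasDerivAt (fun x : ℂ => qPoch q (x / q)) (deriv (qPoch q) (x / q) * (1 / q)) x :=
    HasDerivAt.comp (h₂ := qPoch q) (h := fun x : ℂ => x / q) x (dP _).hasDerivAt
      ((hasDerivAt_id x).div_const _)
  have h2 : HasDerivAt (fun x : ℂ => (1 - x / q) * qPoch q x)
      (-(1 / q) * qPoch q x + (1 - x / q) * deriv (qPoch q) x) x :=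
    (((hasDerivAt_id x).div_const _).const_sub 1).mul (dP x).hasDerivAt
  rw [funext (qPoch_div_q hq0 hq1)] at h1
  have h3 := h1.unique h2
  field_simp at h3
  linear_combination h3

/-- The second derivative at `1` enters both `confCoeff`s as the same multiple of `confCoeff'` and
drops out of the determinant. The logarithmic derivatives for `j = 0` and `j = 1` differ by
elementary fractions, and with `u = α/(qγ)`, `v = β/(qγ)` there remains `1 + u/(1-u) + v/(1-v) =
(1-uv)/((1-u)(1-v))`. -/
theorem basicConst_mul_confCoeff (hq0 : 0 < q) (hq1 : q < 1) (ζm ζp : ℝ) {g : ℝ} {α β γ : ℂ}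
    (h : GoodParams q g α β γ γ) :
    basicConst q ζm ζp α β γ γ *
      ((confCoeff q (α / ((q : ℂ) ^ 0 * γ)) (α * β / ((q : ℂ) ^ 0 * (γ * γ))) +
          confCoeff' q (α / ((q : ℂ) ^ 0 * γ)) (α * β / ((q : ℂ) ^ 0 * (γ * γ))) *
            ((0 : ℕ) : ℂ)) / γ ^ 0 *
        ((-confCoeff' q (α / ((q : ℂ) ^ 1 * γ)) (α * β / ((q : ℂ) ^ 2 * (γ * γ)))) / γ ^ 1) -
      (-confCoeff' q (α / ((q : ℂ) ^ 0 * γ)) (α * β / ((q : ℂ) ^ 0 * (γ * γ)))) / γ ^ 0 *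
        ((confCoeff q (α / ((q : ℂ) ^ 1 * γ)) (α * β / ((q : ℂ) ^ 2 * (γ * γ))) +
          confCoeff' q (α / ((q : ℂ) ^ 1 * γ)) (α * β / ((q : ℂ) ^ 2 * (γ * γ))) *
            ((1 : ℕ) : ℂ)) / γ ^ 1)) =
      ellipticPrefactor q ζm ζp γ γ / qPoch q q ^ 4 * γ⁻¹ := by
  have hq := ofReal_q_ne_zero hq0
  have hα := h.hα
  have hγ := h.hγ
  have nz : ∀ {x : ℂ}, ‖x‖ < 1 → qPoch q x ≠ 0 := fun hx =>
    qPoch_ne_zero_of_norm_lt_one hq0 hq1 hx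
  have nC := nz (h.norm_C_lt_one hq0 hq1 (n := 2) le_rfl)
  have nC0 := nz (h.norm_C_lt_one hq0 hq1 (n := 0) zero_le_two)
  have n3 := nz h.hαγ
  have n5 := nz h.hβγ
  have nq := qPoch_q_ne_zero hq0 hq1
  have a1 : α * β / (γ * γ) / (α / γ) = β / γ := by field_simp
  have b1 : α * β / ((q : ℂ) ^ 2 * (γ * γ)) / (α / (q * γ)) = β / γ / q := by field_simp
  have b5 : α / (q * γ) = α / γ / q := by field_simp
  have c1 : α * β / (q * γ * γ) = α * β / (γ * γ) / q := by field_simp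
  have c2 : α * β / ((q : ℂ) ^ 2 * (γ * γ)) = α * β / (γ * γ) / q / q := by field_simp
  have e : (1 - α / γ / q) * (1 - β / γ / q) = 1 - α / γ / q - β / γ / q + α * β / (γ * γ) / q / q := by
    field_simp
    ring
  simp only [confCoeff, confCoeff', pow_zero, pow_one, one_mul, div_one, a1, b1]
  rw [c2, qPoch_div_q hq0 hq1 (_ / _), qPoch_div_q hq0 hq1 (α * β / (γ * γ))] at nC
  rw [pow_zero, one_mul] at nC0
  rw [basicConst, ellipticPrefactor, b5, c1, c2]
  rw [qPoch_div_q hq0 hq1 (α * β / (γ * γ) / q), qPoch_div_q hq0 hq1 (α * β / (γ * γ)),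
    qPoch_div_q hq0 hq1 (α / γ), qPoch_div_q hq0 hq1 (β / γ), deriv_qPoch_div_q hq0 hq1 (α / γ),
    deriv_qPoch_div_q hq0 hq1 (β / γ)]
  have f1 := left_ne_zero_of_mul nC
  have f2 := left_ne_zero_of_mul (right_ne_zero_of_mul nC)
  generalize qPoch q (α / γ) = p1 at *
  generalize qPoch q (β / γ) = p3 at *
  generalize deriv (qPoch q) (α / γ) = d1 at *
  generalize deriv (qPoch q) (β / γ) = d3 at *
  generalize deriv (deriv (qPoch q)) 1 = d at *
  generalize qPoch q (α * β / (γ * γ)) = p7 at *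
  generalize qPoch q (q : ℂ) = p8 at *
  generalize qTheta q (γ * ζm) * qTheta q (γ * ζp) * qTheta q (γ * ζm) * qTheta q (γ * ζp) /
    (ζp * (qTheta q ((ζm : ℂ) / ζp) * qTheta q (γ * γ * ζm * ζp))) = P
  have e2 : (q - α / γ) * (q - β / γ) = q ^ 2 - q * (α / γ) - q * (β / γ) + q ^ 2 * (α * β / (γ * γ) / q / q) := by
    field_simp
    ring
  have eG : α * β / (γ * γ) / q / q = 1 - (1 - α * β / (γ * γ) / q / q) := by ring
  rw [eG] at e2
  generalize 1 - α * β / (γ * γ) / q / q = G1 at *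
  generalize 1 - α * β / (γ * γ) / q = G2 at *
  generalize α / γ = x at *
  generalize β / γ = y at *
  have eG1 : q ^ 2 * G1 = q ^ 2 - x * y := by linear_combination e2
  field_simp
  push_cast
  linear_combination (-(P*p1*p3*p8)) * eG1

/-- The set of points at which the scaled functions have a limit. -/
def regularSet (q : ℝ) (α γ δ : ℂ) : Set ℂ :=
  {s | s ≠ 0 ∧ qTheta q (α * s) ≠ 0 ∧ qTheta q (γ * s) ≠ 0 ∧ qTheta q (δ * s) ≠ 0}

theorem isOpen_regularSet (hq0 : 0 < q) (hq1 : q < 1) {α γ δ : ℂ} (hα : α ≠ 0) (hγ : γ ≠ 0)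
    (hδ : δ ≠ 0) : IsOpen (regularSet q α γ δ) := by
  have h : ∀ y : ℂ, y ≠ 0 → IsOpen ({0}ᶜ ∩ (fun s : ℂ => qTheta q (y * s)) ⁻¹' {0}ᶜ) := fun y hy =>
    (continuousOn_qTheta_mul hq0 hq1 hy fun s hs => hs).isOpen_inter_preimage
      isOpen_compl_singleton isOpen_compl_singleton
  convert ((h α hα).inter (h γ hγ)).inter (h δ hδ) using 1
  ext s
  simp only [regularSet, Set.mem_ofPred_eq, Set.mem_inter_iff, Set.mem_compl_iff,
    Set.mem_singleton_iff, Set.mem_preimage]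
  tauto

theorem GoodPoint.mem_regularSet {α γ δ : ℂ} {x : ℝ} (h : GoodPoint q α γ δ x) :
    (x : ℂ) ∈ regularSet q α γ δ :=
  ⟨by exact_mod_cast h.ne_zero, h.hα, h.hγ, h.hδ⟩

theorem differentiableAt_scaledFun (g : ℝ) {α : ℂ} (hα : α ≠ 0) {Ψ : ℂ → ℂ}
    (hΨ : Differentiable ℂ Ψ) (j M : ℕ) {s : ℂ} (hs : s ≠ 0) :
    DifferentiableAt ℂ (scaledFun q g α Ψ j M) s := by
  have h1 : DifferentiableAt ℂ (fun s : ℂ => (q : ℂ) / (α * s) * ((q : ℂ) ^ M)⁻¹) s :=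
    ((differentiableAt_const _).div (by fun_prop) (mul_ne_zero hα hs)).mul_const _
  have h2 : DifferentiableAt ℂ (fun s : ℂ => Ψ ((q : ℂ) / (α * s) * ((q : ℂ) ^ M)⁻¹)) s :=
    DifferentiableAt.comp s (hΨ _) h1
  unfold scaledFun scaleFactor
  fun_prop

theorem differentiableAt_qTheta_mul (hq0 : 0 < q) (hq1 : q < 1) {y s : ℂ} (hy : y ≠ 0)
    (hs : s ≠ 0) : DifferentiableAt ℂ (fun s : ℂ => qTheta q (y * s)) s :=
  DifferentiableAt.comp (f := fun s : ℂ => y * s) s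
    (differentiableAt_qTheta hq0 hq1 (mul_ne_zero hy hs)) (by fun_prop)

theorem differentiableAt_deriv_qTheta_mul (hq0 : 0 < q) (hq1 : q < 1) {y s : ℂ} (hy : y ≠ 0)
    (hs : s ≠ 0) : DifferentiableAt ℂ (fun s : ℂ => deriv (qTheta q) (y * s)) s := by
  have hd : DifferentiableOn ℂ (qTheta q) {0}ᶜ := fun z hz =>
    (differentiableAt_qTheta hq0 hq1 hz).differentiableWithinAt
  have hd2 := (hd.deriv isOpen_compl_singleton).differentiableAt
    (isOpen_compl_singleton.mem_nhds (mul_ne_zero hy hs))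
  exact DifferentiableAt.comp (f := fun s : ℂ => y * s) s hd2 (by fun_prop)

/-- The common factor of the functions in the elliptic kernel. -/
def ellipticFactor (q : ℝ) (γ δ : ℂ) (x : ℝ) : ℂ :=
  csqrt ((|x| : ℝ) : ℂ) * (csqrt (qTheta q (x * γ) * qTheta q (x * δ)))⁻¹

theorem thetaNormalized_eq (q : ℝ) (γ δ : ℂ) (u : ℝ → ℂ) :
    thetaNormalized q γ δ u = fun x => ellipticFactor q γ δ x * u x := by
  funext x
  rw [thetaNormalized, ellipticFactor]
  ring

theorem csqrt_ne_zero {r : ℝ} (hr : 0 < r) : csqrt (r : ℂ) ≠ 0 := by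
  rw [csqrt_ofReal hr.le]
  exact_mod_cast (Real.sqrt_pos.2 hr).ne'

theorem differentiableAt_csqrt_abs {x : ℝ} (hx : x ≠ 0) :
    DifferentiableAt ℝ (fun s : ℝ => csqrt ((|s| : ℝ) : ℂ)) x := by
  refine differentiableAt_csqrt_comp ?_ ?_
  · simpa using differentiableAt_ofReal_abs_mul (c := 1) (x := x) (by simpa using hx)
  · exact Complex.ofReal_mem_slitPlane.2 (abs_pos.2 hx)

theorem differentiableAt_qTheta_ofReal_mul (hq0 : 0 < q) (hq1 : q < 1) {y : ℂ} {x : ℝ} (hy : y ≠ 0)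
    (hx : x ≠ 0) : DifferentiableAt ℝ (fun s : ℝ => qTheta q (s * y)) x := by
  have h := (differentiableAt_qTheta_mul hq0 hq1 hy
    (s := (x : ℂ)) (by exact_mod_cast hx)).hasDerivAt.comp_ofReal.differentiableAt
  simpa only [mul_comm y] using h

theorem differentiableAt_ellipticFactor (hq0 : 0 < q) (hq1 : q < 1) {α γ δ : ℂ} (hγ : γ ≠ 0)
    (hδ : δ ≠ 0) {x : ℝ} (hx : GoodPoint q α γ δ x) :
    DifferentiableAt ℝ (ellipticFactor q γ δ) x := by
  obtain ⟨ρ, hρ, hxρ⟩ := hx.pos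
  refine (differentiableAt_csqrt_abs hx.ne_zero).mul (DifferentiableAt.inv ?_ ?_)
  · refine differentiableAt_csqrt_comp
      ((differentiableAt_qTheta_ofReal_mul hq0 hq1 hγ hx.ne_zero).mul
        (differentiableAt_qTheta_ofReal_mul hq0 hq1 hδ hx.ne_zero)) ?_
    rw [hxρ]
    exact Complex.ofReal_mem_slitPlane.2 hρ
  · rw [hxρ]
    exact csqrt_ne_zero hρ

/-- The limit of the kernel stripped of its square roots. `Ψ₀` and `Ψ₁` belong to `𝔉_1` and `𝔉_0`,
the index being the power of `-x`. The limit `E` is left unnamed because its form differs for `γ =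
δ` and `γ ≠ δ`. -/
theorem exists_tendsto_integrableKernel_scaledFun (hq0 : 0 < q) (hq1 : q < 1) (ζm ζp : ℝ) {g : ℝ}
    {α β γ δ : ℂ} (h : GoodParams q g α β γ δ) :
    ∃ Ψ₀ Ψ₁ : ℂ → ℂ, Differentiable ℂ Ψ₀ ∧ Differentiable ℂ Ψ₁ ∧
      (∀ w, ‖w‖ < 1 → Ψ₀ w = qPoch q w * phiSeries q (α / ((q : ℂ) ^ 0 * γ))
        (α / ((q : ℂ) ^ 0 * δ)) (α * β / ((q : ℂ) ^ 0 * (γ * δ))) w) ∧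
      (∀ w, ‖w‖ < 1 → Ψ₁ w = qPoch q w * phiSeries q (α / ((q : ℂ) ^ 1 * γ))
        (α / ((q : ℂ) ^ 1 * δ)) (α * β / ((q : ℂ) ^ 2 * (γ * δ))) w) ∧
      ∀ x y, GoodPoint q α γ δ x → GoodPoint q α γ δ y → ∃ E : ℂ,
        Tendsto (fun M => integrableKernel (basicConst q ζm ζp α β γ δ)
          (fun s : ℝ => scaledFun q g α Ψ₀ 0 M s) (fun s : ℝ => scaledFun q g α Ψ₁ 1 M s) x y)
          atTop (𝓝 E) ∧
        ellipticKernel q ζm ζp γ δ x y =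
          ellipticFactor q γ δ x * ellipticFactor q γ δ y * E := by
  have hα := h.hα
  have hγ := h.hγ
  have hδ := h.hδ
  have hS := h.scaleData
  have nz : ∀ {x : ℂ}, ‖x‖ < 1 → qPoch q x ≠ 0 := fun hx =>
    qPoch_ne_zero_of_norm_lt_one hq0 hq1 hx
  have nC1 := nz (h.norm_C_lt_one hq0 hq1 (n := 2) le_rfl)
  have nC0 := nz (h.norm_C_lt_one hq0 hq1 (n := 0) zero_le_two)
  have hΩ := isOpen_regularSet hq0 hq1 hα hγ hδ
  have dθ : ∀ {y : ℂ}, y ≠ 0 → DifferentiableOn ℂ (fun s : ℂ => qTheta q (y * s))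
      (regularSet q α γ δ) := fun hy s hs =>
    (differentiableAt_qTheta_mul hq0 hq1 hy hs.1).differentiableWithinAt
  have dS : ∀ {Ψ : ℂ → ℂ}, Differentiable ℂ Ψ → ∀ j M,
      DifferentiableOn ℂ (scaledFun q g α Ψ j M) (regularSet q α γ δ) := fun hΨ j M s hs =>
    (differentiableAt_scaledFun g hα hΨ j M hs.1).differentiableWithinAt
  by_cases hne : γ = δ
  · subst hne
    have hgγ : ‖(g : ℂ) / γ‖ = 1 := by
      have := congrArg (‖·‖) h.hγδ
      rw [norm_mul, norm_pow, ← sq, sq_eq_sq₀ (norm_nonneg _) (norm_nonneg _)] at this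
      rw [norm_div, ← this, div_self (norm_ne_zero_iff.2 hγ)]
    rw [max_self, hgγ] at hS
    obtain ⟨Ψ₀, d0, i0, k0⟩ :=
      exists_scaledFun_expansion_conf hq0 hq1 hS hγ hgγ nC0 (j := 0) zero_le_one
    obtain ⟨Ψ₁, d1, i1, k1⟩ := exists_scaledFun_expansion_conf hq0 hq1 hS hγ hgγ nC1 (j := 1) le_rfl
    have dv : DifferentiableOn ℂ (fun s => γ * s * deriv (qTheta q) (γ * s))
        (regularSet q α γ γ) := fun s hs =>
      ((by fun_prop : DifferentiableAt ℂ (fun s : ℂ => γ * s) s).mul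
        (differentiableAt_deriv_qTheta_mul hq0 hq1 hγ hs.1)).differentiableWithinAt
    obtain ⟨c', key, hc⟩ : ∃ c' : ℂ, (∀ K ⊆ regularSet q α γ γ, IsCompact K →
        ∃ C ρ : ℝ, 0 ≤ ρ ∧ ρ < 1 ∧ ∀ M, ∀ s ∈ K, ∀ t ∈ K,
          ‖scaledFun q g α Ψ₀ 0 M s * scaledFun q g α Ψ₁ 1 M t -
            scaledFun q g α Ψ₁ 1 M s * scaledFun q g α Ψ₀ 0 M t -
            c' * (qTheta q (γ * s) * (γ * t * deriv (qTheta q) (γ * t)) -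
              γ * s * deriv (qTheta q) (γ * s) * qTheta q (γ * t))‖ ≤ C * ρ ^ M) ∧
        basicConst q ζm ζp α β γ γ * c' = ellipticPrefactor q ζm ζp γ γ / qPoch q q ^ 4 * γ⁻¹ := by
      refine ⟨_, ?_, basicConst_mul_confCoeff hq0 hq1 ζm ζp h⟩
      intro K hKΩ hK
      -- Since `|g/γ| = 1`, any error rate `η` in `(q, 1)` is available, and any `L` in `(1, 1/η)`
      -- dominates the linear growth while keeping `Lη < 1`.
      obtain ⟨η, h1, h2⟩ := exists_between hq1
      have hη0 : 0 < η := hq0.trans h1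
      obtain ⟨L, h3, h4⟩ := exists_between ((one_lt_div hη0).2 h2)
      obtain ⟨ε₀, e0, f0⟩ := k0 K hK (fun s hs => (hKΩ hs).1) (fun s hs => (hKΩ hs).2.1)
        (fun s hs => (hKΩ hs).2.2.1) η h1
      obtain ⟨ε₁, e1, f1⟩ := k1 K hK (fun s hs => (hKΩ hs).1) (fun s hs => (hKΩ hs).2.1)
        (fun s hs => (hKΩ hs).2.2.1) η h1
      have hρ : L * η < 1 := (lt_div_iff₀ hη0).1 h4
      have Gp := growthOn_pow K ((g : ℂ) / γ)
      rw [hgγ] at Gp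
      have Gθ := growthOn_of_continuousOn hK ((dθ hγ).continuousOn.mono hKΩ)
      have Gv := growthOn_of_continuousOn hK (dv.continuousOn.mono hKΩ)
      have Ge1 := (Gp.mul Gθ).mono (by norm_num) (by linarith : 1 * 1 ≤ L)
      have Ge2 := Gp.mul ((Gv.mono zero_le_one h3.le).add (((growthOn_natCast K h3).mul Gθ).mono
        (by linarith) (mul_one L).le).neg)
      rw [one_mul] at Ge2
      obtain ⟨C, hC⟩ := growthOn_wronskian h3.le hη0.le hρ f0 f1 Ge1 Ge2 e0 e1
        (W := fun s t => qTheta q (γ * s) * (γ * t * deriv (qTheta q) (γ * t)) -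
              γ * s * deriv (qTheta q) (γ * s) * qTheta q (γ * t)) (by
          intro M s hs t ht
          have hM : ((g : ℂ) / γ) ^ M * ((g : ℂ) / γ) ^ M = 1 := by
            rw [← mul_pow, div_mul_div_comm, h.hγδ, ← sq, div_self, one_pow]
            exact pow_ne_zero _ (by exact_mod_cast h.hg.ne')
          linear_combination (qTheta q (γ * s) * (γ * t * deriv (qTheta q) (γ * t)) -
              γ * s * deriv (qTheta q) (γ * s) * qTheta q (γ * t)) * hM)
      exact ⟨C, L * η, by positivity, hρ, hC⟩
    refine ⟨Ψ₀, Ψ₁, d0, d1, i0, i1, fun x y hx hy => ⟨_, tendsto_integrableKernel hΩ _ c' (dS d0 0)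
      (dS d1 1) (dθ hγ) dv key hx.mem_regularSet hy.mem_regularSet, ?_⟩⟩
    have dx := differentiableAt_ellipticFactor hq0 hq1 hγ hδ hx
    have dx1 := differentiableAt_qTheta_ofReal_mul hq0 hq1 hγ hx.ne_zero
    have dx2 : DifferentiableAt ℝ (fun s : ℝ => s * deriv (qTheta q) (s * γ)) x := by
      have := (differentiableAt_deriv_qTheta_mul hq0 hq1 hγ (s := (x : ℂ))
        (by exact_mod_cast hx.ne_zero)).hasDerivAt.comp_ofReal.differentiableAt
      simp only [mul_comm γ] at this
      exact (Complex.ofRealCLM.differentiableAt (x := x)).mul this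
    -- The limit contains `γxθ'(γx)`, the elliptic kernel `xθ'(xγ)`; the factor `γ⁻¹` in the
    -- constant accounts for the difference.
    rw [hc, ellipticKernel, if_pos rfl, thetaNormalized_eq, thetaNormalized_eq,
      integrableKernel_mul y dx dx1 dx2, ← integrableKernel_smul_right _ _ _ _ _ ?_]
    · simp only [mul_comm γ]
      congr 2
      funext s
      field_simp
    · simp only [mul_comm γ, mul_right_comm _ γ]
      exact dx2.mul_const γ
  · obtain ⟨n1, n2⟩ := h.qPoch_div_ne_zero hq0 hq1 hne
    set l := max ‖(g : ℂ) / γ‖ ‖(g : ℂ) / δ‖ with hl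
    have hl1 := hS.hl
    obtain ⟨Ψ₀, d0, i0, k0⟩ := exists_scaledFun_expansion hq0 hq1 hS hγ hδ (le_max_left _ _)
      (le_max_right _ _) n1 n2 nC0 (j := 0) zero_le_one
    obtain ⟨Ψ₁, d1, i1, k1⟩ := exists_scaledFun_expansion hq0 hq1 hS hγ hδ (le_max_left _ _)
      (le_max_right _ _) n1 n2 nC1 (j := 1) le_rfl
    obtain ⟨c', key, hc⟩ : ∃ c' : ℂ, (∀ K ⊆ regularSet q α γ δ, IsCompact K →
        ∃ C ρ : ℝ, 0 ≤ ρ ∧ ρ < 1 ∧ ∀ M, ∀ s ∈ K, ∀ t ∈ K,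
          ‖scaledFun q g α Ψ₀ 0 M s * scaledFun q g α Ψ₁ 1 M t -
            scaledFun q g α Ψ₁ 1 M s * scaledFun q g α Ψ₀ 0 M t -
            c' * (qTheta q (γ * s) * qTheta q (δ * t) -
              qTheta q (δ * s) * qTheta q (γ * t))‖ ≤ C * ρ ^ M) ∧
        basicConst q ζm ζp α β γ δ * c' = -ellipticConst q ζm ζp γ δ := by
      refine ⟨_, ?_, basicConst_mul_connCoeff hq0 hq1 ζm ζp h hne⟩
      intro K hKΩ hK
      -- Room for an error rate `η` that beats the growth `l^M` of the leading terms.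
      have hlt : q * l < 1 / l := by
        rw [lt_div_iff₀ (by linarith)]
        exact hS.hql
      obtain ⟨η, h1, h2⟩ := exists_between hlt
      have hη0 : 0 < η := lt_trans (by positivity) h1
      obtain ⟨ε₀, e0, f0⟩ := k0 K hK (fun s hs => (hKΩ hs).1) (fun s hs => (hKΩ hs).2.1)
        (fun s hs => (hKΩ hs).2.2.1) (fun s hs => (hKΩ hs).2.2.2) η h1
      obtain ⟨ε₁, e1, f1⟩ := k1 K hK (fun s hs => (hKΩ hs).1) (fun s hs => (hKΩ hs).2.1)
        (fun s hs => (hKΩ hs).2.2.1) (fun s hs => (hKΩ hs).2.2.2) η h1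
      have hρ : l * η < 1 := by
        rw [mul_comm]; exact (lt_div_iff₀ (by linarith)).1 h2
      have Ge : ∀ {y : ℂ}, y ≠ 0 → ‖(g : ℂ) / y‖ ≤ l →
          GrowthOn K l fun M s => ((g : ℂ) / y) ^ M * qTheta q (y * s) := fun hy hyl =>
        ((growthOn_pow K _).mul (growthOn_of_continuousOn hK
          ((dθ hy).continuousOn.mono hKΩ))).mono (by positivity) (by rwa [mul_one])
      obtain ⟨C, hC⟩ := growthOn_wronskian hl1 hη0.le hρ f0 f1 (Ge hγ (le_max_left _ _))
        (Ge hδ (le_max_right _ _)) e0 e1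
        (W := fun s t => qTheta q (γ * s) * qTheta q (δ * t) -
              qTheta q (δ * s) * qTheta q (γ * t)) (by
          intro M s hs t ht
          have hM : ((g : ℂ) / γ) ^ M * ((g : ℂ) / δ) ^ M = 1 := by
            rw [← mul_pow, div_mul_div_comm, h.hγδ, ← sq, div_self, one_pow]
            exact pow_ne_zero _ (by exact_mod_cast h.hg.ne')
          linear_combination (qTheta q (γ * s) * qTheta q (δ * t) -
              qTheta q (δ * s) * qTheta q (γ * t)) * hM)
      exact ⟨C, l * η, by positivity, hρ, hC⟩
    refine ⟨Ψ₀, Ψ₁, d0, d1, i0, i1, fun x y hx hy => ⟨_, tendsto_integrableKernel hΩ _ c' (dS d0 0)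
      (dS d1 1) (dθ hγ) (dθ hδ) key hx.mem_regularSet hy.mem_regularSet, ?_⟩⟩
    have dx := differentiableAt_ellipticFactor hq0 hq1 hγ hδ hx
    have dx1 := differentiableAt_qTheta_ofReal_mul hq0 hq1 hγ hx.ne_zero
    have dx2 := differentiableAt_qTheta_ofReal_mul hq0 hq1 hδ hx.ne_zero
    -- `P` carries `θ(xδ)` and `Q` carries `θ(xγ)`, so the two functions appear in the opposite
    -- order; this uses up the sign of `-ellipticConst`.
    rw [hc, ellipticKernel, if_neg hne, ellipticP, ellipticQ, thetaNormalized_eq,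
      thetaNormalized_eq, integrableKernel_mul y dx dx2 dx1, integrableKernel_swap]
    simp only [mul_comm γ, mul_comm δ]

/-! ### The functions of the basic kernel at scaled points -/

theorem qPoch_div_pow_mul_ne_zero (hq0 : 0 < q) (hq1 : q < 1) {z : ℂ} (h : qTheta q z ≠ 0)
    (hz : z ≠ 0) (j : ℕ) : qPoch q ((q : ℂ) / ((q : ℂ) ^ j * z)) ≠ 0 := by
  have hq := ofReal_q_ne_zero hq0
  have h1 : qTheta q ((q : ℂ) ^ j * z) ≠ 0 := by
    rw [qTheta_pow_mul hq0 hq1 hz]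
    have : (-1 : ℂ) ≠ 0 := by norm_num
    positivity
  exact right_ne_zero_of_mul h1

/-- The continued Heine transformation with `a = α/(q^jδ)`, `k = δq^j/β`, `z = β/(q^jγ)`, `w =
q/(αx)`. It moves `x` from the parameters to the variable. -/
theorem qPoch_mul_phiReg_eq (hq0 : 0 < q) (hq1 : q < 1) {g : ℝ} {α β γ δ : ℂ}
    (h : GoodParams q g α β γ δ) {j : ℕ} (hj : j ≤ 1) {Ψ : ℂ → ℂ} (hΨ : Differentiable ℂ Ψ)
    (hΨ1 : ∀ w, ‖w‖ < 1 → Ψ w = qPoch q w * phiSeries q (α / ((q : ℂ) ^ j * γ))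
        (α / ((q : ℂ) ^ j * δ)) (α * β / ((q : ℂ) ^ (2 * j) * (γ * δ))) w) {x : ℂ} (hx : x ≠ 0)
    (hxδ : qTheta q (δ * x) ≠ 0) :
    qPoch q ((q : ℂ) / ((q : ℂ) ^ j * (δ * x))) / qPoch q (α * β / ((q : ℂ) ^ (2 * j) * (γ * δ))) *
      phiReg q (α / ((q : ℂ) ^ j * δ)) (q / (β * x)) ((q : ℂ) / ((q : ℂ) ^ j * (δ * x)))
        (β / ((q : ℂ) ^ j * γ)) = Ψ (q / (α * x)) := by
  have hq := ofReal_q_ne_zero hq0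
  have hα := h.hα
  have hβ := h.hβ
  have hγ := h.hγ
  have hδ := h.hδ
  have nC := qPoch_ne_zero_of_norm_lt_one hq0 hq1
    (h.norm_C_lt_one hq0 hq1 (n := 2 * j) (by omega))
  have nd := qPoch_div_pow_mul_ne_zero hq0 hq1 hxδ (mul_ne_zero hδ hx) j
  have hz : ‖β / ((q : ℂ) ^ j * γ)‖ < q⁻¹ := by
    have h1 := h.hβγ
    rw [mul_comm, ← div_div, norm_div, norm_pow, norm_ofReal_q hq0]
    calc ‖β / γ‖ / q ^ j ≤ ‖β / γ‖ / q ^ 1 := by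
          exact div_le_div_of_nonneg_left (norm_nonneg _) (by positivity)
            (pow_le_pow_of_le_one hq0.le hq1.le hj)
      _ < 1 / q ^ 1 := by gcongr
      _ = q⁻¹ := by rw [pow_one, one_div]
  have e1 : α / ((q : ℂ) ^ j * δ) * (q / (α * x)) = q / ((q : ℂ) ^ j * (δ * x)) := by field_simp
  have e2 : α / ((q : ℂ) ^ j * δ) * (β / ((q : ℂ) ^ j * γ)) =
      α * β / ((q : ℂ) ^ (2 * j) * (γ * δ)) := by
    rw [two_mul, pow_add]; field_simp
  have e3 : δ * (q : ℂ) ^ j / β * (α / ((q : ℂ) ^ j * δ)) * (β / ((q : ℂ) ^ j * γ)) =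
      α / ((q : ℂ) ^ j * γ) := by field_simp
  have e4 : δ * (q : ℂ) ^ j / β * (α / ((q : ℂ) ^ j * δ)) * (q / (α * x)) = q / (β * x) := by
    field_simp
  have key := qPoch_mul_phiReg hq0 hq1 (α / ((q : ℂ) ^ j * δ)) (δ * (q : ℂ) ^ j / β) hz
    (w := q / (α * x)) (by rwa [e1]) (by rwa [e2]) hΨ (by rwa [e2, e3])
  rw [e1, e2, e4] at key
  rw [div_mul_eq_mul_div, key, mul_div_cancel_left₀ _ nC]

/-- The radicand in the definition of the functions `𝔉_r`. -/
def radicand (q : ℝ) (α β γ δ : ℂ) (x : ℝ) : ℂ :=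
  ((|x| : ℝ) : ℂ) * (qPoch q (x * α) * qPoch q (x * β) / (qTheta q (x * γ) * qTheta q (x * δ)))

theorem basicF_one_eq (hq0 : 0 < q) (hq1 : q < 1) {g : ℝ} {α β γ δ : ℂ}
    (h : GoodParams q g α β γ δ) {Ψ : ℂ → ℂ} (hΨ : Differentiable ℂ Ψ)
    (hΨ1 : ∀ w, ‖w‖ < 1 → Ψ w = qPoch q w * phiSeries q (α / ((q : ℂ) ^ 0 * γ))
        (α / ((q : ℂ) ^ 0 * δ)) (α * β / ((q : ℂ) ^ 0 * (γ * δ))) w) {x : ℝ} (hx : x ≠ 0)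
    (hxδ : qTheta q (δ * x) ≠ 0) :
    basicF q α β γ δ 1 x = csqrt (radicand q α β γ δ x) * Ψ (q / (α * x)) := by
  have hx' : (x : ℂ) ≠ 0 := by exact_mod_cast hx
  rw [← qPoch_mul_phiReg_eq hq0 hq1 h zero_le_one hΨ hΨ1 hx' hxδ]
  simp only [basicF, radicand]
  norm_num
  ring

theorem basicF_zero_eq (hq0 : 0 < q) (hq1 : q < 1) {g : ℝ} {α β γ δ : ℂ}
    (h : GoodParams q g α β γ δ) {Ψ : ℂ → ℂ} (hΨ : Differentiable ℂ Ψ)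
    (hΨ1 : ∀ w, ‖w‖ < 1 → Ψ w = qPoch q w * phiSeries q (α / ((q : ℂ) ^ 1 * γ))
        (α / ((q : ℂ) ^ 1 * δ)) (α * β / ((q : ℂ) ^ 2 * (γ * δ))) w) {x : ℝ} (hx : x ≠ 0)
    (hxδ : qTheta q (δ * x) ≠ 0) :
    basicF q α β γ δ 0 x = csqrt (radicand q α β γ δ x) * (-(x : ℂ) * Ψ (q / (α * x))) := by
  have hq := ofReal_q_ne_zero hq0
  have hx' : (x : ℂ) ≠ 0 := by exact_mod_cast hx
  have hδ := h.hδ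
  have hγ := h.hγ
  rw [← qPoch_mul_phiReg_eq hq0 hq1 h le_rfl hΨ hΨ1 hx' hxδ]
  have e1 : (q : ℂ) / ((q : ℂ) ^ 1 * (δ * x)) = (q : ℂ) ^ 0 / (δ * x) := by field_simp
  have e2 : α * β / ((q : ℂ) ^ (2 * 1) * (γ * δ)) =
      α * β * (q : ℂ) ^ (2 * ((0 : ℕ) : ℤ) - 2) / (γ * δ) := by
    rw [show (2 * ((0 : ℕ) : ℤ) - 2) = -((2 : ℕ) : ℤ) from rfl, zpow_neg, zpow_natCast]
    field_simp
  have e3 : ∀ u v : ℂ, v ≠ 0 → u / ((q : ℂ) ^ 1 * v) = u * (q : ℂ) ^ (((0 : ℕ) : ℤ) - 1) / v := by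
    intro u v hv
    rw [show (((0 : ℕ) : ℤ) - 1) = -((1 : ℕ) : ℤ) from rfl, zpow_neg, zpow_natCast]
    field_simp
  have e4 : (-(x : ℂ)) ^ (1 - ((0 : ℕ) : ℤ)) = -(x : ℂ) := by
    rw [show (1 - ((0 : ℕ) : ℤ)) = 1 from rfl, zpow_one]
  rw [e1, e2, e3 _ _ hδ, e3 _ _ hγ]
  simp only [basicF, radicand, e4]
  ring

theorem differentiableAt_sign {x : ℝ} (hx : x ≠ 0) : DifferentiableAt ℝ Real.sign x := by
  rcases lt_or_gt_of_ne hx with h | h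
  · refine (differentiableAt_const (-1 : ℝ)).congr_of_eventuallyEq ?_
    filter_upwards [gt_mem_nhds h] with y hy using Real.sign_of_neg hy
  · refine (differentiableAt_const (1 : ℝ)).congr_of_eventuallyEq ?_
    filter_upwards [lt_mem_nhds h] with y hy using Real.sign_of_pos hy

/-- The radicand at `q ^ M x`, normalized. -/
def scaledRadicand (q : ℝ) (α β γ δ : ℂ) (M : ℕ) (x : ℝ) : ℂ :=
  ((|x| : ℝ) : ℂ) * (qPoch q ((q : ℂ) ^ M * (x * α)) * qPoch q ((q : ℂ) ^ M * (x * β)) /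
    (qTheta q (x * γ) * qTheta q (x * δ)))

/-- The prefactor of `𝔉_r` at `q ^ M x`, normalized. -/
def scaledPrefactor (q : ℝ) (α β γ δ : ℂ) (M : ℕ) (x : ℝ) : ℂ :=
  ((Real.sqrt (q ^ M) * (-Real.sign x) ^ M : ℝ) : ℂ) * csqrt (scaledRadicand q α β γ δ M x)

/-- By quasi-periodicity and `γδ = g²`, scaling multiplies the radicand by `q^M τ²`, up to the
change of the two numerator symbols, where `τ` is the real value of `scaleFactor`. Its root involves
`|τ| = (-sgn x)^M τ`, and this is where the signs in the statement come from. -/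
theorem csqrt_radicand_eq (hq0 : 0 < q) (hq1 : q < 1) {g : ℝ} {α β γ δ : ℂ}
    (h : GoodParams q g α β γ δ) (M : ℕ) {x : ℝ} (hx : x ≠ 0) :
    csqrt (radicand q α β γ δ (q ^ M * x)) =
      scaledPrefactor q α β γ δ M x * scaleFactor q g M x := by
  have hq := ofReal_q_ne_zero hq0
  have hg := h.hg
  have hγ := h.hγ
  have hδ := h.hδ
  have hx' : (x : ℂ) ≠ 0 := by exact_mod_cast hx
  set τ : ℝ := (-(g * x)) ^ M * q ^ (M * (M - 1) / 2) with hτ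
  have hτ0 : τ ≠ 0 := by
    have : -(g * x) ≠ 0 := neg_ne_zero.2 (mul_ne_zero hg.ne' hx)
    positivity
  have hτc : scaleFactor q g M x = τ := by
    rw [scaleFactor, hτ]; push_cast; rfl
  have e1 : radicand q α β γ δ (q ^ M * x) =
      ((q ^ M * τ ^ 2 : ℝ) : ℂ) * scaledRadicand q α β γ δ M x := by
    have hγδ : γ * δ * x ^ 2 = (g * x) ^ 2 := by rw [h.hγδ]; ring
    rw [radicand, scaledRadicand, abs_mul, abs_of_pos (pow_pos hq0 M)]
    push_cast
    simp only [mul_assoc ((q : ℂ) ^ M)]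
    rw [qTheta_pow_mul hq0 hq1 (mul_ne_zero hx' hγ), qTheta_pow_mul hq0 hq1 (mul_ne_zero hx' hδ),
      ← hτc, scaleFactor]
    have e3 : (-1 : ℂ) ^ M * (-1) ^ M = 1 := by rw [← mul_pow]; simp
    have e4 : ((x : ℂ) * γ)⁻¹ ^ M * ((x : ℂ) * δ)⁻¹ ^ M = (((-((g : ℂ) * x)) ^ M) ^ 2)⁻¹ := by
      rw [← mul_pow, ← mul_inv, inv_pow, ← pow_mul, mul_comm M 2, pow_mul, neg_sq, ← hγδ]
      congr 2; ring
    have e5 : (-1 : ℂ) ^ M * ((x : ℂ) * γ)⁻¹ ^ M * ((q : ℂ) ^ (M * (M - 1) / 2))⁻¹ * qTheta q (x * γ) *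
        ((-1) ^ M * ((x : ℂ) * δ)⁻¹ ^ M * ((q : ℂ) ^ (M * (M - 1) / 2))⁻¹ * qTheta q (x * δ)) =
        (((-((g : ℂ) * x)) ^ M * (q : ℂ) ^ (M * (M - 1) / 2)) ^ 2)⁻¹ *
          (qTheta q (x * γ) * qTheta q (x * δ)) := by
      rw [mul_pow (_ ^ M), mul_inv (_ ^ 2), ← e4, ← inv_pow ((q : ℂ) ^ _)]
      linear_combination (((x : ℂ) * γ)⁻¹ ^ M * ((x : ℂ) * δ)⁻¹ ^ M *
        (((q : ℂ) ^ (M * (M - 1) / 2))⁻¹) ^ 2 * (qTheta q (x * γ) * qTheta q (x * δ))) * e3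
    rw [e5, ← div_div, div_inv_eq_mul]
    ring
  have e2 : Real.sqrt (q ^ M * τ ^ 2) = Real.sqrt (q ^ M) * (-Real.sign x) ^ M * τ := by
    rw [Real.sqrt_mul (pow_nonneg hq0.le M), Real.sqrt_sq_eq_abs, mul_assoc]
    congr 1
    have h1 : |(-(g * x))| = -Real.sign x * (-(g * x)) := by
      rcases lt_or_gt_of_ne hx with h2 | h2
      · rw [Real.sign_of_neg h2, abs_of_pos] <;> nlinarith
      · rw [Real.sign_of_pos h2, abs_of_neg] <;> nlinarith
    rw [hτ, abs_mul, abs_pow, abs_of_pos (pow_pos hq0 _), h1, mul_pow, mul_assoc]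
  rw [e1, csqrt_ofReal_mul (by positivity), e2, hτc, scaledPrefactor]
  push_cast
  ring

theorem tendsto_scaledRadicand (hq0 : 0 < q) (hq1 : q < 1) (α β γ δ : ℂ) (x : ℝ) :
    Tendsto (fun M => scaledRadicand q α β γ δ M x) atTop
      (𝓝 (((|x| : ℝ) : ℂ) * (1 / (qTheta q (x * γ) * qTheta q (x * δ))))) := by
  have hP : ∀ z : ℂ, Tendsto (fun M : ℕ => qPoch q ((q : ℂ) ^ M * z)) atTop (𝓝 1) := fun z => by
    have h1 := ((continuous_qPoch hq0 hq1).tendsto 0).comp (tendsto_pow_mul_zero hq0 hq1 z)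
    rw [qPoch_zero] at h1
    refine h1.congr fun M => ?_
    rw [Function.comp_apply, mul_comm]
  have := (((hP (x * α)).mul (hP (x * β))).div_const
    (qTheta q (x * γ) * qTheta q (x * δ))).const_mul ((|x| : ℝ) : ℂ)
  rwa [one_mul] at this

theorem GoodPoint.limit_radicand {α γ δ : ℂ} {x : ℝ} (hx : GoodPoint q α γ δ x) :
    ∃ r : ℝ, 0 < r ∧
      ((|x| : ℝ) : ℂ) * (1 / (qTheta q (x * γ) * qTheta q (x * δ))) = r ∧
      csqrt r = ellipticFactor q γ δ x := by
  obtain ⟨ρ, hρ, h⟩ := hx.pos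
  have h1 := abs_pos.2 hx.ne_zero
  refine ⟨|x| / ρ, by positivity, ?_, ?_⟩
  · rw [h]; push_cast; ring
  · rw [ellipticFactor, h, csqrt_ofReal (by positivity), csqrt_ofReal h1.le, csqrt_ofReal hρ.le,
      Real.sqrt_div h1.le]
    push_cast; ring

theorem eventually_scaledRadicand_mem (hq0 : 0 < q) (hq1 : q < 1) {α γ δ : ℂ} (β : ℂ) {x : ℝ}
    (hx : GoodPoint q α γ δ x) :
    ∀ᶠ M in atTop, scaledRadicand q α β γ δ M x ∈ Complex.slitPlane := by
  obtain ⟨r, hr, h1, -⟩ := hx.limit_radicand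
  refine (tendsto_scaledRadicand hq0 hq1 α β γ δ x).eventually
    (Complex.isOpen_slitPlane.mem_nhds ?_)
  rw [h1]
  exact Complex.ofReal_mem_slitPlane.2 hr

theorem tendsto_csqrt_scaledRadicand (hq0 : 0 < q) (hq1 : q < 1) {α γ δ : ℂ} (β : ℂ) {x : ℝ}
    (hx : GoodPoint q α γ δ x) :
    Tendsto (fun M => csqrt (scaledRadicand q α β γ δ M x)) atTop
      (𝓝 (ellipticFactor q γ δ x)) := by
  obtain ⟨r, hr, h1, h2⟩ := hx.limit_radicand
  have h3 := tendsto_scaledRadicand hq0 hq1 α β γ δ x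
  rw [h1] at h3
  rw [← h2]
  exact (differentiableAt_csqrt (Complex.ofReal_mem_slitPlane.2 hr)).continuousAt.tendsto.comp h3

theorem differentiableAt_scaledPrefactor (hq0 : 0 < q) (hq1 : q < 1) {α β γ δ : ℂ} (hγ : γ ≠ 0)
    (hδ : δ ≠ 0) {M : ℕ} {x : ℝ} (hx : GoodPoint q α γ δ x)
    (hM : scaledRadicand q α β γ δ M x ∈ Complex.slitPlane) :
    DifferentiableAt ℝ (scaledPrefactor q α β γ δ M) x := by
  have h1 : DifferentiableAt ℝ (fun x : ℝ => Real.sqrt (q ^ M) * (-Real.sign x) ^ M) x :=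
    ((differentiableAt_sign hx.ne_zero).neg.pow M).const_mul _
  have h2 : DifferentiableAt ℝ (fun x : ℝ =>
      ((Real.sqrt (q ^ M) * (-Real.sign x) ^ M : ℝ) : ℂ)) x :=
    (Complex.ofRealCLM.differentiableAt).comp x h1
  have hP : ∀ y : ℂ, DifferentiableAt ℝ (fun x : ℝ => qPoch q ((q : ℂ) ^ M * (x * y))) x := fun y => by
    have : Differentiable ℂ fun s : ℂ => qPoch q ((q : ℂ) ^ M * (s * y)) :=
      (differentiable_qPoch hq0 hq1).comp (by fun_prop)
    exact (this (x : ℂ)).hasDerivAt.comp_ofReal.differentiableAt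
  refine h2.mul (differentiableAt_csqrt_comp ?_ hM)
  refine DifferentiableAt.mul ?_ (((hP α).mul (hP β)).div
    ((differentiableAt_qTheta_ofReal_mul hq0 hq1 hγ hx.ne_zero).mul
      (differentiableAt_qTheta_ofReal_mul hq0 hq1 hδ hx.ne_zero)) ?_)
  · simpa using differentiableAt_ofReal_abs_mul (c := 1) (x := x) (by simpa using hx.ne_zero)
  · obtain ⟨ρ, hρ, h⟩ := hx.pos
    rw [h]
    exact_mod_cast hρ.ne'

/-- The factor `q^(-M)` from rescaling the kernel cancels the two factors `√(q^M)`, and the signs of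
the prefactors cancel `(sgn x sgn y)^M`. What remains is the limit of the stripped kernel times the
limits of two square roots. -/
theorem tendsto_basicKernel (hq0 : 0 < q) (hq1 : q < 1) (ζm ζp : ℝ) {g : ℝ} {α β γ δ : ℂ}
    (h : GoodParams q g α β γ δ) {x y : ℝ} (hx : GoodPoint q α γ δ x) (hy : GoodPoint q α γ δ y) :
    Tendsto (fun M : ℕ => (((Real.sign x * Real.sign y) ^ M : ℝ) : ℂ) *
      basicKernel q ζm ζp α β γ δ (q ^ M * x) (q ^ M * y)) atTop
      (𝓝 (ellipticKernel q ζm ζp γ δ x y)) := by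
  have hq := ofReal_q_ne_zero hq0
  have hα := h.hα
  have hδ := h.hδ
  obtain ⟨Ψ₀, Ψ₁, d0, d1, i0, i1, hlim⟩ :=
    exists_tendsto_integrableKernel_scaledFun hq0 hq1 ζm ζp h
  obtain ⟨E, hE, hEe⟩ := hlim x y hx hy
  have hF : ∀ M (s : ℝ), s ≠ 0 → qTheta q (δ * s) ≠ 0 →
      basicF q α β γ δ 1 (q ^ M * s) = scaledPrefactor q α β γ δ M s * scaledFun q g α Ψ₀ 0 M s ∧
      basicF q α β γ δ 0 (q ^ M * s) =
        scaledPrefactor q α β γ δ M s * scaledFun q g α Ψ₁ 1 M s := by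
    intro M s hs hsδ
    have hs' : (s : ℂ) ≠ 0 := by exact_mod_cast hs
    have hMs : q ^ M * s ≠ 0 := mul_ne_zero (pow_ne_zero _ hq0.ne') hs
    have hMδ : qTheta q (δ * ((q ^ M * s : ℝ) : ℂ)) ≠ 0 := by
      push_cast
      rw [mul_left_comm, qTheta_pow_mul hq0 hq1 (mul_ne_zero hδ hs')]
      have : (-1 : ℂ) ≠ 0 := by norm_num
      positivity
    have e : (q : ℂ) / (α * ((q ^ M * s : ℝ) : ℂ)) = (q : ℂ) / (α * s) * ((q : ℂ) ^ M)⁻¹ := by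
      push_cast
      field_simp
    rw [basicF_one_eq hq0 hq1 h d0 i0 hMs hMδ, basicF_zero_eq hq0 hq1 h d1 i1 hMs hMδ,
      csqrt_radicand_eq hq0 hq1 h M hs, e]
    constructor
    · rw [scaledFun]; ring
    · rw [scaledFun]; push_cast; ring
  -- The diagonal value contains derivatives, so the formulas for `𝔉_r` are needed in a
  -- neighbourhood of `x`.
  have hnear : ∀ᶠ s : ℝ in 𝓝 x, s ≠ 0 ∧ qTheta q (δ * s) ≠ 0 := by
    have hc : ContinuousAt (fun s : ℝ => qTheta q (s * δ)) x :=
      (differentiableAt_qTheta_ofReal_mul hq0 hq1 hδ hx.ne_zero).continuousAt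
    have hx2 := hx.hδ
    rw [mul_comm] at hx2
    filter_upwards [eventually_ne_nhds hx.ne_zero, hc.eventually_ne hx2] with s h1 h2
    exact ⟨h1, by rwa [mul_comm]⟩
  have hsgn : ∀ {x : ℝ}, x ≠ 0 → Real.sign x * Real.sign x = 1 := fun {x} hx => by
    rcases lt_or_gt_of_ne hx with h2 | h2
    · rw [Real.sign_of_neg h2]; norm_num
    · rw [Real.sign_of_pos h2]; norm_num
  have main : (fun M => csqrt (scaledRadicand q α β γ δ M x) *
      csqrt (scaledRadicand q α β γ δ M y) * integrableKernel (basicConst q ζm ζp α β γ δ)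
          (fun s : ℝ => scaledFun q g α Ψ₀ 0 M s) (fun s : ℝ => scaledFun q g α Ψ₁ 1 M s) x y)
      =ᶠ[atTop] fun M : ℕ => (((Real.sign x * Real.sign y) ^ M : ℝ) : ℂ) *
        basicKernel q ζm ζp α β γ δ (q ^ M * x) (q ^ M * y) := by
    filter_upwards [eventually_scaledRadicand_mem hq0 hq1 β hx] with M hM
    have dS : ∀ {Ψ : ℂ → ℂ}, Differentiable ℂ Ψ → ∀ j,
        DifferentiableAt ℝ (fun s : ℝ => scaledFun q g α Ψ j M s) x := fun hΨ j =>
      (differentiableAt_scaledFun g hα hΨ j M (s := (x : ℂ))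
        (by exact_mod_cast hx.ne_zero)).hasDerivAt.comp_ofReal.differentiableAt
    rw [basicKernel, integrableKernel_scale _ _ _ (pow_ne_zero M hq0.ne'),
      integrableKernel_congr _ (hnear.mono fun s hs => (hF M s hs.1 hs.2).1)
        (hnear.mono fun s hs => (hF M s hs.1 hs.2).2) (hF M y hy.ne_zero hy.hδ).1
        (hF M y hy.ne_zero hy.hδ).2,
      integrableKernel_mul y (differentiableAt_scaledPrefactor hq0 hq1 h.hγ hδ hx hM) (dS d0 0)
        (dS d1 1), scaledPrefactor, scaledPrefactor]
    have e1 : ((Real.sign x * Real.sign y) ^ M * ((q ^ M)⁻¹ *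
        ((Real.sqrt (q ^ M) * (-Real.sign x) ^ M) * (Real.sqrt (q ^ M) * (-Real.sign y) ^ M)))
        : ℝ) = 1 := by
      have h1 := Real.mul_self_sqrt (pow_nonneg hq0.le M)
      have h2 : (Real.sign x * Real.sign y) ^ M * ((-Real.sign x) ^ M * (-Real.sign y) ^ M) = 1 := by
        rw [← mul_pow, ← mul_pow]
        have : Real.sign x * Real.sign y * (-Real.sign x * -Real.sign y) = 1 := by
          have := hsgn hx.ne_zero
          have := hsgn hy.ne_zero
          grind
        rw [this, one_pow]
      have h3 : (q ^ M)⁻¹ * q ^ M = 1 := inv_mul_cancel₀ (pow_ne_zero _ hq0.ne')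
      rw [← h1] at h3
      grind
    have e2 := congrArg (fun r : ℝ => (r : ℂ)) e1
    push_cast at e2 ⊢
    generalize integrableKernel _ _ _ _ _ = I
    generalize csqrt _ = c1
    generalize csqrt _ = c2
    linear_combination (-(c1 * c2 * I)) * e2
  rw [hEe]
  exact (((tendsto_csqrt_scaledRadicand hq0 hq1 β hx).mul
    (tendsto_csqrt_scaledRadicand hq0 hq1 β hy)).mul hE).congr' main

/-! ### Admissible parameters -/

theorem qPoch_conj (hq0 : 0 < q) (hq1 : q < 1) (z : ℂ) :
    qPoch q ((starRingEnd ℂ) z) = (starRingEnd ℂ) (qPoch q z) := by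
  refine tendsto_nhds_unique (tendsto_qFin hq0 hq1 _) ?_
  refine ((Complex.continuous_conj.tendsto _).comp (tendsto_qFin hq0 hq1 z)).congr fun n => ?_
  simp [qFin, map_prod]

theorem qTheta_conj (hq0 : 0 < q) (hq1 : q < 1) (z : ℂ) :
    qTheta q ((starRingEnd ℂ) z) = (starRingEnd ℂ) (qTheta q z) := by
  rw [qTheta, qTheta, map_mul, ← qPoch_conj hq0 hq1, ← qPoch_conj hq0 hq1, map_div₀,
    Complex.conj_ofReal]

/-- On the real line `θ` is real and vanishes only at powers of `q`, so it keeps its sign on a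
connected set avoiding them and `0`. -/
theorem qTheta_mul_pos_of_isPreconnected (hq0 : 0 < q) (hq1 : q < 1) {S : Set ℝ}
    (hS : IsPreconnected S) (hS0 : ∀ z ∈ S, z ≠ 0) (hSq : ∀ z ∈ S, ∀ m : ℤ, z ≠ q ^ m) {z w : ℝ}
    (hz : z ∈ S) (hw : w ∈ S) :
    ∃ ρ : ℝ, 0 < ρ ∧ qTheta q z * qTheta q w = ρ := by
  have hre : ∀ t : ℝ, ((qTheta q t).re : ℂ) = qTheta q t := fun t => by
    rw [← Complex.conj_eq_iff_re, ← qTheta_conj hq0 hq1, Complex.conj_ofReal]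
  have hne : ∀ t ∈ S, (qTheta q t).re ≠ 0 := fun t ht h0 => by
    have h1 := hre t
    rw [h0, Complex.ofReal_zero] at h1
    exact qTheta_ne_zero hq0 hq1 (fun m hm => hSq t ht m (by exact_mod_cast hm)) h1.symm
  have hc : ContinuousOn (fun t : ℝ => (qTheta q t).re) S := fun t ht => by
    have h1 : ContinuousAt (fun t : ℝ => qTheta q t) t :=
      ContinuousAt.comp (f := fun t : ℝ => (t : ℂ)) (differentiableAt_qTheta hq0 hq1
        (by exact_mod_cast hS0 t ht)).continuousAt Complex.continuous_ofReal.continuousAt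
    exact (Complex.continuous_re.continuousAt.comp h1).continuousWithinAt
  have hno : ∀ {z w : ℝ}, z ∈ S → w ∈ S → (qTheta q z).re < 0 → 0 < (qTheta q w).re → False :=
    fun {z w} hz hw h1 h2 => by
    obtain ⟨t, ht, ht0⟩ := hS.intermediate_value hz hw hc ⟨h1.le, h2.le⟩
    exact hne t ht ht0
  refine ⟨(qTheta q z).re * (qTheta q w).re, ?_, ?_⟩
  · rcases lt_or_gt_of_ne (hne z hz) with h1 | h1 <;> rcases lt_or_gt_of_ne (hne w hw) with h2 | h2
    · exact mul_pos_of_neg_of_neg h1 h2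
    · exact (hno hz hw h1 h2).elim
    · exact (hno hw hz h2 h1).elim
    · exact mul_pos h1 h2
  · rw [Complex.ofReal_mul, hre, hre]

theorem ne_zpow_of_mem_Ioo (hq0 : 0 < q) (hq1 : q < 1) {n : ℤ} {z : ℝ}
    (hz : z ∈ Set.Ioo (q ^ (n + 1)) (q ^ n)) (m : ℤ) : z ≠ q ^ m := by
  rintro rfl
  have h1 := (zpow_lt_zpow_iff_right_of_lt_one₀ hq0 hq1).1 hz.1
  have h2 := (zpow_lt_zpow_iff_right_of_lt_one₀ hq0 hq1).1 hz.2
  omega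

theorem qTheta_mul_pos (hq0 : 0 < q) (hq1 : q < 1) {z w : ℝ}
    (h : (z < 0 ∧ w < 0) ∨ ∃ n : ℤ, z ∈ Set.Ioo (q ^ (n + 1)) (q ^ n) ∧
      w ∈ Set.Ioo (q ^ (n + 1)) (q ^ n)) :
    ∃ ρ : ℝ, 0 < ρ ∧ qTheta q z * qTheta q w = ρ := by
  rcases h with ⟨hz, hw⟩ | ⟨n, hz, hw⟩
  · exact qTheta_mul_pos_of_isPreconnected hq0 hq1 (S := Set.Iio 0) isPreconnected_Iio
      (fun z hz => (Set.mem_Iio.1 hz).ne)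
      (fun z hz m => ((Set.mem_Iio.1 hz).trans (zpow_pos hq0 m)).ne) hz hw
  · exact qTheta_mul_pos_of_isPreconnected hq0 hq1 isPreconnected_Ioo
      (fun z hz => ((zpow_pos hq0 _).trans hz.1).ne')
      (fun z hz => ne_zpow_of_mem_Ioo hq0 hq1 hz) hz hw

/-- For a conjugate pair the product is `|θ(tx)|²`. For a real pair, multiplication by a lattice
point moves the interval either into the negative axis or between consecutive powers of `q`. -/
theorem AdmissiblePair.qTheta_mul_pos (hq0 : 0 < q) (hq1 : q < 1) {ζm ζp : ℝ} (hζm : ζm < 0)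
    (hζp : 0 < ζp) {x y : ℂ} (h : AdmissiblePair q ζm ζp x y) {t : ℝ} (ht : t ∈ qLattice q ζm ζp) :
    ∃ ρ : ℝ, 0 < ρ ∧ qTheta q (t * x) * qTheta q (t * y) = ρ := by
  have ht0 : t ≠ 0 := by
    obtain ⟨m, rfl | rfl⟩ := ht
    · exact mul_ne_zero hζm.ne (zpow_ne_zero _ hq0.ne')
    · exact mul_ne_zero hζp.ne' (zpow_ne_zero _ hq0.ne')
  rcases h with ⟨rfl, him⟩ | ⟨a, b, rfl, rfl, h⟩
  · have e : (t : ℂ) * (starRingEnd ℂ) x = (starRingEnd ℂ) (t * x) := by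
      rw [map_mul, Complex.conj_ofReal]
    have hne : qTheta q (t * x) ≠ 0 := by
      refine qTheta_ne_zero hq0 hq1 fun m hm => ?_
      have := congrArg Complex.im hm
      rw [← Complex.ofReal_zpow, Complex.ofReal_im, Complex.im_ofReal_mul] at this
      exact (mul_ne_zero ht0 him) this
    refine ⟨Complex.normSq (qTheta q (t * x)), Complex.normSq_pos.2 hne, ?_⟩
    rw [e, qTheta_conj hq0 hq1, Complex.mul_conj]
  · have key := QZW.qTheta_mul_pos hq0 hq1 (z := t * a) (w := t * b) ?_
    · push_cast at key; exact key
    obtain ⟨k, ht⟩ := ht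
    have hk := zpow_pos hq0 k
    have hP : ∀ {ζ : ℝ}, 0 < ζ → ∀ {n : ℤ} {s : ℝ}, s ∈ Set.Ioo (ζ⁻¹ * q ^ (n + 1)) (ζ⁻¹ * q ^ n) →
        ζ * q ^ k * s ∈ Set.Ioo (q ^ (k + n + 1)) (q ^ (k + n)) := by
      intro ζ hζ n s hs
      obtain ⟨h1, h2⟩ := hs
      have h3 : 0 < ζ * q ^ k := by positivity
      have e : ∀ m : ℤ, ζ * q ^ k * (ζ⁻¹ * q ^ m) = q ^ (k + m) := fun m => by
        rw [zpow_add₀ hq0.ne']; field_simp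
      refine ⟨?_, ?_⟩
      · rw [add_assoc, ← e]; exact mul_lt_mul_of_pos_left h1 h3
      · rw [← e]; exact mul_lt_mul_of_pos_left h2 h3
    rcases h with ⟨m, ha, hb⟩ | ⟨n, ha, hb⟩
    · have hneg : ∀ {s : ℝ}, s ∈ Set.Ioo (ζm⁻¹ * q ^ m) (ζm⁻¹ * q ^ (m + 1)) →
          -s ∈ Set.Ioo ((-ζm)⁻¹ * q ^ (m + 1)) ((-ζm)⁻¹ * q ^ m) := by
        rintro s ⟨h1, h2⟩
        rw [inv_neg, neg_mul, neg_mul]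
        exact ⟨neg_lt_neg h2, neg_lt_neg h1⟩
      have hs0 : ∀ {s : ℝ}, s ∈ Set.Ioo (ζm⁻¹ * q ^ m) (ζm⁻¹ * q ^ (m + 1)) → s < 0 := by
        rintro s ⟨-, h2⟩
        exact h2.trans (mul_neg_of_neg_of_pos (inv_lt_zero.2 hζm) (zpow_pos hq0 _))
      rcases ht with rfl | rfl
      · right
        have h1 := hP (neg_pos.2 hζm) (hneg ha)
        have h2 := hP (neg_pos.2 hζm) (hneg hb)
        simp only [neg_mul, mul_neg, neg_neg] at h1 h2
        exact ⟨_, h1, h2⟩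
      · left
        exact ⟨mul_neg_of_pos_of_neg (by positivity) (hs0 ha),
          mul_neg_of_pos_of_neg (by positivity) (hs0 hb)⟩
    · have hs0 : ∀ {s : ℝ}, s ∈ Set.Ioo (ζp⁻¹ * q ^ (n + 1)) (ζp⁻¹ * q ^ n) → 0 < s := by
        rintro s ⟨h1, -⟩
        exact lt_trans (mul_pos (inv_pos.2 hζp) (zpow_pos hq0 _)) h1
      have hneg : ζm * q ^ k < 0 := mul_neg_of_neg_of_pos hζm hk
      rcases ht with rfl | rfl
      · left
        exact ⟨mul_neg_of_neg_of_pos hneg (hs0 ha), mul_neg_of_neg_of_pos hneg (hs0 hb)⟩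
      · right
        exact ⟨_, hP hζp ha, hP hζp hb⟩

theorem AdmissiblePair.mul_pos_and_norm_lt (hq0 : 0 < q) (hq1 : q < 1) {ζm ζp : ℝ} (hζm : ζm < 0)
    (hζp : 0 < ζp) {x y : ℂ} (h : AdmissiblePair q ζm ζp x y) :
    (∃ r : ℝ, 0 < r ∧ x * y = r) ∧ q * ‖x‖ < ‖y‖ ∧ q * ‖y‖ < ‖x‖ := by
  rcases h with ⟨rfl, him⟩ | ⟨a, b, rfl, rfl, h⟩
  · have hx : x ≠ 0 := fun h => him (by rw [h, Complex.zero_im])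
    have hx' := norm_pos_iff.2 hx
    refine ⟨⟨_, Complex.normSq_pos.2 hx, Complex.mul_conj x⟩, ?_, ?_⟩ <;>
    · rw [RCLike.norm_conj]; nlinarith
  · have key : ∀ {c a b : ℝ} {n : ℤ}, 0 < c → a ∈ Set.Ioo (c * q ^ (n + 1)) (c * q ^ n) →
        b ∈ Set.Ioo (c * q ^ (n + 1)) (c * q ^ n) → 0 < a ∧ 0 < b ∧ q * a < b ∧ q * b < a := by
      rintro c a b n hc ⟨h1, h2⟩ ⟨h3, h4⟩
      have e : c * q ^ (n + 1) = q * (c * q ^ n) := by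
        rw [zpow_add_one₀ hq0.ne']; ring
      have hn : 0 < c * q ^ n := mul_pos hc (zpow_pos hq0 n)
      have hn' : 0 < c * q ^ (n + 1) := mul_pos hc (zpow_pos hq0 _)
      refine ⟨hn'.trans h1, hn'.trans h3, ?_, ?_⟩ <;> nlinarith
    simp only [Complex.norm_real, Real.norm_eq_abs, ← Complex.ofReal_mul, Complex.ofReal_inj,
      exists_eq_right']
    rcases h with ⟨m, ha, hb⟩ | ⟨n, ha, hb⟩
    · have hneg : ∀ {s : ℝ}, s ∈ Set.Ioo (ζm⁻¹ * q ^ m) (ζm⁻¹ * q ^ (m + 1)) →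
          -s ∈ Set.Ioo ((-ζm)⁻¹ * q ^ (m + 1)) ((-ζm)⁻¹ * q ^ m) := by
        rintro s ⟨h1, h2⟩
        rw [inv_neg, neg_mul, neg_mul]
        exact ⟨neg_lt_neg h2, neg_lt_neg h1⟩
      obtain ⟨h1, h2, h3, h4⟩ := key (inv_pos.2 (neg_pos.2 hζm)) (hneg ha) (hneg hb)
      rw [abs_of_neg (by linarith), abs_of_neg (by linarith)]
      exact ⟨mul_pos_of_neg_of_neg (by linarith) (by linarith), h3, h4⟩
    · obtain ⟨h1, h2, h3, h4⟩ := key (inv_pos.2 hζp) ha hb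
      rw [abs_of_pos h1, abs_of_pos h2]
      exact ⟨mul_pos h1 h2, h3, h4⟩

theorem AdmissibleQuadruple.goodParams (hq0 : 0 < q) (hq1 : q < 1) {ζm ζp : ℝ} (hζm : ζm < 0)
    (hζp : 0 < ζp) {α β γ δ : ℂ} (h : AdmissibleQuadruple q ζm ζp α β γ δ) :
    ∃ g, GoodParams q g α β γ δ := by
  obtain ⟨hab, hcd, hlt⟩ := h
  obtain ⟨⟨r, hr, hαβ⟩, h1, h2⟩ := hab.mul_pos_and_norm_lt hq0 hq1 hζm hζp
  obtain ⟨⟨s, hs, hγδ⟩, h3, h4⟩ := hcd.mul_pos_and_norm_lt hq0 hq1 hζm hζp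
  rw [hαβ, hγδ, Complex.ofReal_re, Complex.ofReal_re] at hlt
  have hr' : (r : ℂ) ≠ 0 := by exact_mod_cast hr.ne'
  have hs' : (s : ℂ) ≠ 0 := by exact_mod_cast hs.ne'
  have hα : α ≠ 0 := left_ne_zero_of_mul (hαβ ▸ hr')
  have hβ : β ≠ 0 := right_ne_zero_of_mul (hαβ ▸ hr')
  have hγ : γ ≠ 0 := left_ne_zero_of_mul (hγδ ▸ hs')
  have hδ : δ ≠ 0 := right_ne_zero_of_mul (hγδ ▸ hs')
  have nr : ‖α‖ * ‖β‖ = r := by rw [← norm_mul, hαβ, Complex.norm_of_nonneg hr.le]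
  have ns : ‖γ‖ * ‖δ‖ = s := by rw [← norm_mul, hγδ, Complex.norm_of_nonneg hs.le]
  -- The chain is `q a² < ab = r < q² s` and `q s = q cd < c²`, whence `a² < q s < c²`.
  have key : ∀ {a b c d : ℝ}, 0 < a → 0 < c → q * a < b → q * d < c → a * b = r → c * d = s →
      a / c < 1 := by
    intro a b c d ha hc hqa hqd e1 e2
    rw [div_lt_one hc]
    refine lt_of_pow_lt_pow_left₀ 2 hc.le ?_
    have i1 : q * a ^ 2 < r := by nlinarith
    have i2 : q * s < c ^ 2 := by nlinarith
    have i3 : q * a ^ 2 < q * (q * s) := by nlinarith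
    exact (lt_of_mul_lt_mul_left i3 hq0.le).trans i2
  have pα := norm_pos_iff.2 hα
  have pβ := norm_pos_iff.2 hβ
  have pγ := norm_pos_iff.2 hγ
  have pδ := norm_pos_iff.2 hδ
  refine ⟨Real.sqrt s, Real.sqrt_pos.2 hs, ?_, hα, hβ, hγ, hδ, ?_, ?_, ?_, ?_, ?_, h3, h4⟩
  · rw [hγδ, ← Complex.ofReal_pow, Real.sq_sqrt hs.le]
  · rw [norm_div]; exact key pα pγ h1 h4 nr ns
  · rw [norm_div]; exact key pα pδ h1 h3 nr (by rw [mul_comm, ns])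
  · rw [norm_div]; exact key pβ pγ h2 h4 (by rw [mul_comm, nr]) ns
  · rw [norm_div]; exact key pβ pδ h2 h3 (by rw [mul_comm, nr]) (by rw [mul_comm, ns])
  · rw [hαβ, hγδ, norm_div, norm_mul, norm_pow, norm_ofReal_q hq0, Complex.norm_of_nonneg hr.le,
      Complex.norm_of_nonneg hs.le, div_lt_one (by positivity)]
    exact hlt

theorem AdmissibleQuadruple.goodPoint (hq0 : 0 < q) (hq1 : q < 1) {ζm ζp : ℝ} (hζm : ζm < 0)
    (hζp : 0 < ζp) {α β γ δ : ℂ} (h : AdmissibleQuadruple q ζm ζp α β γ δ) {x : ℝ}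
    (hx : x ∈ qLattice q ζm ζp) : GoodPoint q α γ δ x := by
  obtain ⟨ρ, hρ, h1⟩ := h.1.qTheta_mul_pos hq0 hq1 hζm hζp hx
  obtain ⟨σ, hσ, h2⟩ := h.2.1.qTheta_mul_pos hq0 hq1 hζm hζp hx
  have hρ' : (ρ : ℂ) ≠ 0 := by exact_mod_cast hρ.ne'
  have hσ' : (σ : ℂ) ≠ 0 := by exact_mod_cast hσ.ne'
  refine ⟨?_, ?_, ?_, ?_, σ, hσ, h2⟩
  · obtain ⟨m, rfl | rfl⟩ := hx
    · exact mul_ne_zero hζm.ne (zpow_ne_zero _ hq0.ne')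
    · exact mul_ne_zero hζp.ne' (zpow_ne_zero _ hq0.ne')
  · rw [mul_comm]; exact left_ne_zero_of_mul (h1 ▸ hρ')
  · rw [mul_comm]; exact left_ne_zero_of_mul (h2 ▸ hσ')
  · rw [mul_comm]; exact right_ne_zero_of_mul (h2 ▸ hσ')

end

/-! ### Point processes -/

section Cylinders
variable {ι : Type*}

theorem isClopen_cylinder {n : ℕ} (x : Fin n → ι) :
    IsClopen {ω : ι → Bool | ∀ i, ω (x i) = true} := by
  rw [Set.ofPred_forall]
  refine isClopen_iInter_of_finite fun i => ?_
  exact (isClopen_discrete {true}).preimage (continuous_apply (x i))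

theorem exists_fin_cylinder (s : Finset ι) : ∃ x : Fin s.card → ι, Function.Injective x ∧
    {ω : ι → Bool | ∀ i, ω (x i) = true} = {ω | ∀ i ∈ s, ω i = true} := by
  refine ⟨fun i => (s.equivFin.symm i : ι),
    Subtype.val_injective.comp s.equivFin.symm.injective, ?_⟩
  ext ω
  constructor
  · intro h i hi
    simpa using h (s.equivFin ⟨i, hi⟩)
  · exact fun h i => h _ (s.equivFin.symm i).2

/-- The sets of configurations containing a given finite set are closed under intersection and
generate the `σ`-algebra. -/
theorem probabilityMeasure_ext_of_cylinders [Countable ι] {μ ν : ProbabilityMeasure (ι → Bool)}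
    (h : ∀ (n : ℕ) (x : Fin n → ι), Function.Injective x →
      μ {ω | ∀ i, ω (x i) = true} = ν {ω | ∀ i, ω (x i) = true}) : μ = ν := by
  refine ProbabilityMeasure.toMeasure_injective ?_
  refine ext_of_generate_finite
    (Set.range fun s : Finset ι => {ω : ι → Bool | ∀ i ∈ s, ω i = true}) ?_ ?_ ?_ (by simp)
  · refine le_antisymm ?_ (MeasurableSpace.generateFrom_le ?_)
    · refine iSup_le fun i => ?_
      rw [← measurable_iff_comap_le]
      refine @measurable_to_bool _ (MeasurableSpace.generateFrom _) _ ?_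
      refine MeasurableSpace.measurableSet_generateFrom ⟨{i}, ?_⟩
      ext ω
      simp
    · rintro _ ⟨s, rfl⟩
      obtain ⟨x, -, hx⟩ := exists_fin_cylinder s
      beta_reduce
      rw [← hx]
      exact (isClopen_cylinder x).2.measurableSet
  · classical
    rintro _ ⟨s, rfl⟩ _ ⟨t, rfl⟩ -
    refine ⟨s ∪ t, ?_⟩
    ext ω
    simp only [Finset.mem_union, Set.mem_ofPred_eq, Set.mem_inter_iff]
    exact ⟨fun h => ⟨fun i hi => h i (Or.inl hi), fun i hi => h i (Or.inr hi)⟩,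
      fun h i hi => hi.elim (h.1 i) (h.2 i)⟩
  · rintro _ ⟨s, rfl⟩
    obtain ⟨x, hx1, hx⟩ := exists_fin_cylinder s
    beta_reduce
    rw [← hx, ← ProbabilityMeasure.ennreal_coeFn_eq_coeFn_toMeasure,
      ← ProbabilityMeasure.ennreal_coeFn_eq_coeFn_toMeasure, h _ x hx1]

end Cylinders

section
variable {q ζm ζp : ℝ}

theorem IsDeterminantal.unique {μ ν : ProbabilityMeasure (Conf q ζm ζp)} {K : ℝ → ℝ → ℂ}
    (hμ : IsDeterminantal μ K) (hν : IsDeterminantal ν K) : μ = ν := by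
  refine probabilityMeasure_ext_of_cylinders fun n x hx => ?_
  have h := (hμ n x hx).trans (hν n x hx).symm
  exact_mod_cast h

theorem IsDeterminantal.zoomMeasure (hq : q ≠ 0) {μ : ProbabilityMeasure (Conf q ζm ζp)}
    {K : ℝ → ℝ → ℂ} (hμ : IsDeterminantal μ K) (k : ℕ) :
    IsDeterminantal (zoomMeasure hq k μ) fun x y => K (q ^ k * x) (q ^ k * y) := by
  intro n x hx
  have h := hμ n (fun i => latticeScale hq k (x i)) fun i j hij => hx (Subtype.ext
    (mul_left_cancel₀ (pow_ne_zero k hq) (congrArg Subtype.val hij)))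
  rw [QZW.zoomMeasure, ProbabilityMeasure.map_apply _ _ (isClopen_cylinder x).2.measurableSet]
  exact h

/-- Conjugation by the diagonal matrix with entries `s_i^k = ±1`. -/
theorem det_sign_mul {n : ℕ} (s : Fin n → ℝ) (hs : ∀ i, s i * s i = 1) (k : ℕ)
    (A : Matrix (Fin n) (Fin n) ℂ) :
    (Matrix.of fun i j => (((s i * s j) ^ k : ℝ) : ℂ) * A i j).det = A.det := by
  have e : (Matrix.of fun i j => (((s i * s j) ^ k : ℝ) : ℂ) * A i j) =
      Matrix.of fun i j => ((s i : ℂ) ^ k) * (Matrix.of fun i j => ((s j : ℂ) ^ k) * A i j) i j := by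
    ext i j
    simp only [Matrix.of_apply]
    push_cast
    ring
  rw [e, Matrix.det_mul_column, Matrix.det_mul_row, ← mul_assoc, ← Finset.prod_mul_distrib,
    Finset.prod_eq_one, one_mul]
  intro i _
  rw [← mul_pow]
  have : (s i : ℂ) * s i = 1 := by exact_mod_cast hs i
  rw [this, one_pow]

theorem tendsto_zoomMeasure_cylinder (hq : q ≠ 0) (hζm : ζm ≠ 0) (hζp : ζp ≠ 0)
    {μ : ProbabilityMeasure (Conf q ζm ζp)} {K K' : ℝ → ℝ → ℂ} (hμ : IsDeterminantal μ K)
    (hK : ∀ x ∈ qLattice q ζm ζp, ∀ y ∈ qLattice q ζm ζp,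
      Tendsto (fun M : ℕ => (((Real.sign x * Real.sign y) ^ M : ℝ) : ℂ) *
        K (q ^ M * x) (q ^ M * y)) atTop (𝓝 (K' x y)))
    {n : ℕ} {x : Fin n → qLattice q ζm ζp} (hx : Function.Injective x) :
    Tendsto (fun k => (((zoomMeasure hq k μ {ω | ∀ i, ω (x i) = true} : NNReal) : ℝ) : ℂ)) atTop
      (𝓝 (Matrix.of fun i j => K' (x i) (x j)).det) := by
  have hs : ∀ i, Real.sign (x i) * Real.sign (x i) = 1 := fun i => by
    have h0 : (x i : ℝ) ≠ 0 := by
      obtain ⟨m, h | h⟩ := (x i).2 <;> rw [h]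
      · exact mul_ne_zero hζm (zpow_ne_zero _ hq)
      · exact mul_ne_zero hζp (zpow_ne_zero _ hq)
    rcases lt_or_gt_of_ne h0 with h2 | h2
    · rw [Real.sign_of_neg h2]; norm_num
    · rw [Real.sign_of_pos h2]; norm_num
  have hdet := (continuous_id.matrix_det (n := Fin n) (R := ℂ)).tendsto
    (Matrix.of fun i j => K' (x i) (x j))
  have hlim : Tendsto (fun M : ℕ => Matrix.of fun i j =>
      (((Real.sign (x i) * Real.sign (x j)) ^ M : ℝ) : ℂ) *
        K (q ^ M * x i) (q ^ M * x j)) atTop (𝓝 (Matrix.of fun i j => K' (x i) (x j))) :=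
    tendsto_pi_nhds.2 fun i => tendsto_pi_nhds.2 fun j => hK _ (x i).2 _ (x j).2
  refine (hdet.comp hlim).congr fun k => ?_
  rw [hμ.zoomMeasure hq k n x hx]
  exact det_sign_mul (fun i => Real.sign (x i)) hs k
    (Matrix.of fun i j => K (q ^ k * x i) (q ^ k * x j))

/-- Cylinders are clopen, so their probabilities depend continuously on the measure, and every
cluster point has the limiting correlations. By uniqueness there is only one cluster point;
compactness provides it and upgrades this to convergence. -/
theorem exists_tendsto_zoomMeasure (hq : q ≠ 0) (hζm : ζm ≠ 0) (hζp : ζp ≠ 0)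
    {μ : ProbabilityMeasure (Conf q ζm ζp)} {K K' : ℝ → ℝ → ℂ} (hμ : IsDeterminantal μ K)
    (hK : ∀ x ∈ qLattice q ζm ζp, ∀ y ∈ qLattice q ζm ζp,
      Tendsto (fun M : ℕ => (((Real.sign x * Real.sign y) ^ M : ℝ) : ℂ) *
        K (q ^ M * x) (q ^ M * y)) atTop (𝓝 (K' x y))) :
    ∃ ν : ProbabilityMeasure (Conf q ζm ζp), IsDeterminantal ν K' ∧
      Tendsto (fun k => zoomMeasure hq k μ) atTop (𝓝 ν) := by
  have key : ∀ ν, MapClusterPt ν atTop (fun k => zoomMeasure hq k μ) → IsDeterminantal ν K' := by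
    intro ν hν n x hx
    have hc : ContinuousAt (fun ρ : ProbabilityMeasure (Conf q ζm ζp) =>
        (((ρ {ω | ∀ i, ω (x i) = true} : NNReal) : ℝ) : ℂ)) ν := by
      have h1 : ContinuousAt (fun ρ : ProbabilityMeasure (Conf q ζm ζp) =>
          ρ {ω | ∀ i, ω (x i) = true}) ν :=
        ProbabilityMeasure.tendsto_measure_of_null_frontier_of_tendsto tendsto_id
          (by rw [(isClopen_cylinder x).frontier_eq]; simp)
      exact Complex.continuous_ofReal.continuousAt.comp
        (NNReal.continuous_coe.continuousAt.comp h1)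
    have h2 := hν.tendsto_comp hc
    exact eq_of_nhds_neBot
      (ClusterPt.mono h2 (tendsto_zoomMeasure_cylinder hq hζm hζp hμ hK hx))
  obtain ⟨ν, hν⟩ := exists_clusterPt_of_compactSpace (map (fun k => zoomMeasure hq k μ) atTop)
  refine ⟨ν, key ν hν, tendsto_nhds_of_unique_mapClusterPt fun ρ hρ => ?_⟩
  exact (key ρ hρ).unique (key ν hν)

end

end

end QZW

/-! ### The limit theorem -/

theorem theorem4p1 (q ζm ζp : ℝ) (hq0 : 0 < q) (hq1 : q < 1) (hζm : ζm < 0) (hζp : 0 < ζp)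
    (α β γ δ : ℂ) (hadm : QZW.AdmissibleQuadruple q ζm ζp α β γ δ) :
    (∀ x ∈ QZW.qLattice q ζm ζp, ∀ y ∈ QZW.qLattice q ζm ζp,
      Tendsto
        (fun M : ℕ => (((Real.sign x * Real.sign y) ^ M : ℝ) : ℂ) *
          QZW.basicKernel q ζm ζp α β γ δ (q ^ M * x) (q ^ M * y))
        atTop (𝓝 (QZW.ellipticKernel q ζm ζp γ δ x y))) ∧
    (∀ μ : ProbabilityMeasure (QZW.Conf q ζm ζp),
      QZW.IsDeterminantal μ (QZW.basicKernel q ζm ζp α β γ δ) →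
      ∃ ν : ProbabilityMeasure (QZW.Conf q ζm ζp),
        QZW.IsDeterminantal ν (QZW.ellipticKernel q ζm ζp γ δ) ∧
        (∀ ν' : ProbabilityMeasure (QZW.Conf q ζm ζp),
          QZW.IsDeterminantal ν' (QZW.ellipticKernel q ζm ζp γ δ) → ν' = ν) ∧
        Tendsto (fun k : ℕ => QZW.zoomMeasure hq0.ne' k μ) atTop (𝓝 ν)) := by
  obtain ⟨g, hg⟩ := hadm.goodParams hq0 hq1 hζm hζp
  have h1 : ∀ x ∈ QZW.qLattice q ζm ζp, ∀ y ∈ QZW.qLattice q ζm ζp,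
      Tendsto
        (fun M : ℕ => (((Real.sign x * Real.sign y) ^ M : ℝ) : ℂ) *
          QZW.basicKernel q ζm ζp α β γ δ (q ^ M * x) (q ^ M * y))
        atTop (𝓝 (QZW.ellipticKernel q ζm ζp γ δ x y)) := fun x hx y hy =>
    QZW.tendsto_basicKernel hq0 hq1 ζm ζp hg (hadm.goodPoint hq0 hq1 hζm hζp hx)
      (hadm.goodPoint hq0 hq1 hζm hζp hy)
  refine ⟨h1, fun μ hμ => ?_⟩
  obtain ⟨ν, hν, hlim⟩ := QZW.exists_tendsto_zoomMeasure hq0.ne' hζm.ne hζp.ne' hμ h1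
  exact ⟨ν, hν, fun ν' hν' => hν'.unique hν, hlim⟩
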